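/- **Setting.** Let $\mathfrak g$ be a real semisimple Lie algebra (possibly the realification of a complex one) with restricted roots with respect to a maximal split toral subalgebra, and let $\Sigma_{\mathfrak p}\subset\Sigma_{\mathfrak q}$ be sets of simple restricted roots, with corresponding nested standard parabolic subalgebras $\mathfrak q\subset\mathfrak p\subset\mathfrak g$ (sums of the root spaces of non-negative $\Sigma$-height and of the centralizer of the toral subalgebra). Let $\mathfrak g_{(i',i'')}$ be the sum of the root spaces with $\Sigma_{\mathfrak p}$-height $i'$ and $\Sigma_{\mathfrak q}$-height $i'+i''$ (the centralizer of the toral subalgebra lies in $\mathfrak g_{(0,0)}$), and put $\mathfrak g^{(i',*)}=\bigoplus_{j'\ge i',\,j''}\mathfrak g_{(j',j'')}$, $\mathbb V_{i'}=\mathfrak g^{(i',*)}/\mathfrak g^{(i'+1,*)}$, $\mathfrak p_+=\mathfrak g^{(1,*)}$. Let $G$ be a Lie group with Lie algebra $\mathfrak g$ and $Q\subset P\subset G$ subgroups corresponding to $\mathfrak q\subset\mathfrak p$, where $P$ lies between the normalizer $N_G(\mathfrak p)$ and its identity component, and $Q$ lies between $N_P(\mathfrak q)$ and its identity component; $P_+=\exp(\mathfrak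 p_+)$. Let $(p\colon\mathcal G\to M,\omega)$ be a parabolic geometry of type $(G,Q)$, i.e. a smooth principal $Q$-bundle with a Cartan connection $\omega\in\Omega^1(\mathcal G,\mathfrak g)$. Via $TM\cong\mathcal G\times_Q(\mathfrak g/\mathfrak q)$, the subspaces $\mathfrak g^{(i',*)}/\mathfrak q$ with $i'\le 0$ induce subbundles $T^{i'}_PM\subset TM$. Here $\mathfrak g^{(0,*)}=\mathfrak p$, and $T_\rho M:=T^0_PM$. For $i'<0$ put $\mathcal V_{i'}M=T^{i'}_PM/T^{i'+1}_PM\cong\mathcal G\times_Q\mathbb V_{i'}$. The torsion $\tau\in\Omega^2(M,TM)$ is the projection to $TM$ of the curvature of $\omega$. A *relative tractor bundle* is a bundle $\mathcal G\times_Q\mathbb W$, where $\mathbb W$ is a finite-dimensional representation of $P$ on which $P_+$ acts trivially. Identifying its sections with equivariant functions $f\colon\mathcal G\to\mathbb W$, its *relative tractor connection* is the partial connection given by $\nabla^\rho_{\xi}f=df(\omega^{-1}(s))+s\bullet f$ for $\xi\in\Gamma(T_\rho M)$, where $s\colon\mathcal G\to\mathfrak p$ is any equivariant function such that $\omega^{-1}(s)$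 projects to $\xi$, and $\bullet$ is the infinitesimal representation. A *tensorial construction* with vector spaces of fixed dimensions $n_1,\dots,n_m$ (tensor products, duals, symmetric and exterior powers, images of Young symmetrizers, densities, and so on) is the construction given by a smooth finite-dimensional representation of $\prod_j GL(n_j,\mathbb R)$, applied through frames. **Statement.** Suppose that $\tau(T_\rho M,T^{i'}_PM)\subset T^{i'}_PM$ for all $i'\le 0$. Let $\psi\colon U\to N$ be a local leaf space for $T_\rho M$ with connected fibers, i.e. $U\subset M$ is open and $\psi$ is a surjective submersion onto a smooth manifold $N$ with connected fibers and $\ker T_y\psi=(T_\rho M)_y$ for all $y\in U$. Then for each $i'\le 0$ there is a smooth subbundle $T^{i'}N\subset TN$ which corresponds to $T^{i'}_PM/T_\rho M$ under the isomorphism $(TM/T_\rho M)|_U\cong\psi^*TN$ induced by $T\psi$. In particular, $T^0N=0$. With $\operatorname{gr}_{i'}(TN)=T^{i'}N/T^{i'+1}N$ the following holds. 1. For each $i'<0$, $T\psi$ induces an isomorphism $\mathcal V_{i'}M|_U\cong\psi^*\operatorname{gr}_{i'}(TN)$ of smooth vector bundles. Each $\mathfrak g^{(i',*)}$ is $P$-invariant,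 and any tensorial construction with finitely many of the representations $\mathbb V_{i'}$, $i'<0$, is a smooth representation of $P$ on which $P_+$ acts trivially. The relative tractor bundle it induces is naturally identified with the same construction applied to the bundles $\mathcal V_{i'}M$, and its restriction to $U$ is naturally identified, as a smooth vector bundle, with the pullback along $\psi$ of the same construction applied to the bundles $\operatorname{gr}_{i'}(TN)$. 2. If in addition $\tau(T_\rho M,T^{i'}_PM)\subset T^{i'+1}_PM$ for all $i'<0$, then for any relative tractor bundle constructed as in (1), a smooth section over $U$ is parallel for the relative tractor connection if and only if it is the pullback of a smooth section over $N$ of the corresponding bundle. -/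

import Mathlib

open scoped Manifold ContDiff Topology

namespace RelativeBGG

noncomputable section

/-! ## Subquotients -/

section Subquotients

variable {V V' : Type*} [AddCommGroup V] [Module ℝ V] [AddCommGroup V'] [Module ℝ V']

/-- The subquotient `A / B` of a vector space, for subspaces `B ⊆ A`. -/
abbrev Gr (A B : Submodule ℝ V) : Type _ := ↥A ⧸ B.submoduleOf A

open Classical in
/-- The map `A / B → A' / B'` induced by a linear map `f` with `f A ⊆ A'` and `f B ⊆ B'`
(and `0` if `f` does not have these two properties). -/
def grMap (f : V →ₗ[ℝ] V') (A B : Submodule ℝ V) (A' B' : Submodule ℝ V') :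
    Gr A B →ₗ[ℝ] Gr A' B' :=
  if h : A ≤ A'.comap f ∧ B ≤ B'.comap f then
    Submodule.mapQ (B.submoduleOf A) (B'.submoduleOf A') (f.restrict h.1)
      (fun x hx => h.2 (show (x : V) ∈ B from hx))
  else 0

end Subquotients

/-! ## Nested standard parabolic subalgebras and the bigrading -/

section Algebra

variable {L : Type*} [LieRing L] [LieAlgebra ℝ L]

/-- A split toral subspace: an abelian subspace consisting of elements whose adjoint action is
diagonalizable over `ℝ`. -/
def IsSplitToral (𝔞 : Submodule ℝ L) : Prop :=
  (∀ x ∈ 𝔞, ∀ y ∈ 𝔞, ⁅x, y⁆ = 0) ∧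
    ∀ x ∈ 𝔞, ⨆ μ : ℝ, Module.End.eigenspace (LieAlgebra.ad ℝ L x) μ = ⊤

/-- The simultaneous eigenspace of `ad 𝔞` for the functional `lam`; for `lam = 0` this is the
centralizer of `𝔞`. -/
def rootSpace (𝔞 : Submodule ℝ L) (lam : Module.Dual ℝ 𝔞) : Submodule ℝ L where
  carrier := {x | ∀ h : 𝔞, ⁅(h : L), x⁆ = lam h • x}
  add_mem' := by
    intro x y hx hy h
    rw [lie_add, hx h, hy h, smul_add]
  zero_mem' := by
    intro h
    simp
  smul_mem' := by
    intro c x hx h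
    rw [lie_smul, hx h, smul_comm]

/-- Restricted roots with respect to `𝔞`. -/
def IsRestrictedRoot (𝔞 : Submodule ℝ L) (lam : Module.Dual ℝ 𝔞) : Prop :=
  lam ≠ 0 ∧ rootSpace 𝔞 lam ≠ ⊥

variable (L) in
/-- The data determining two nested standard parabolic subalgebras `𝔮 ⊆ 𝔭` of a real semisimple Lie
algebra: a maximal split toral subalgebra, a system of simple restricted roots and two sets
`Σ_𝔭 ⊆ Σ_𝔮` of simple restricted roots. (If `L` is the realification of a complex semisimple Lie
algebra, then the restricted roots and their root spaces are the usual complex ones.) -/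
structure NestedParabolics where
  /-- the maximal split toral subalgebra -/
  𝔞 : Submodule ℝ L
  maximal : Maximal IsSplitToral 𝔞
  /-- the number of simple restricted roots -/
  r : ℕ
  /-- the simple restricted roots -/
  simple : Fin r → Module.Dual ℝ 𝔞
  simple_isRoot : ∀ j, IsRestrictedRoot 𝔞 (simple j)
  simple_indep : LinearIndependent ℝ simple
  root_eq : ∀ lam, IsRestrictedRoot 𝔞 lam →
    ∃ c : Fin r → ℕ, lam = ∑ j, c j • simple j ∨ lam = -∑ j, c j • simple j
  /-- the set of simple roots defining `𝔭` -/
  Sp : Finset (Fin r)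
  /-- the set of simple roots defining `𝔮` -/
  Sq : Finset (Fin r)
  Sp_subset : Sp ⊆ Sq

namespace NestedParabolics

variable (D : NestedParabolics L)

/-- The restricted root space for `∑ j, c j • simple j`. -/
def space (c : Fin D.r → ℤ) : Submodule ℝ L :=
  rootSpace D.𝔞 (∑ j, c j • D.simple j)

/-- The standard parabolic subalgebra determined by a set `S` of simple restricted roots: the sum
of all root spaces of non-negative `S`-height (including the centralizer of `𝔞`). -/
def parabolic (S : Finset (Fin D.r)) : Submodule ℝ L :=
  ⨆ (c : Fin D.r → ℤ) (_ : 0 ≤ ∑ j ∈ S, c j), D.space c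

/-- The parabolic subalgebra `𝔭`. -/
def 𝔭 : Submodule ℝ L := D.parabolic D.Sp

/-- The parabolic subalgebra `𝔮`. -/
def 𝔮 : Submodule ℝ L := D.parabolic D.Sq

/-- The component `𝔤_(i',i'')` of the bigrading: the sum of all restricted root spaces with
`Σ_𝔭`-height `i'` and `Σ_𝔮`-height `i' + i''` (the centralizer of `𝔞` has bidegree `(0,0)`). -/
def bigraded (i' i'' : ℤ) : Submodule ℝ L :=
  ⨆ (c : Fin D.r → ℤ) (_ : ∑ j ∈ D.Sp, c j = i' ∧ ∑ j ∈ D.Sq, c j = i' + i''), D.space c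

/-- The filtration component `𝔤^(i,*)`, the sum of all `𝔤_(j',j'')` with `j' ≥ i`. -/
def fil (i : ℤ) : Submodule ℝ L :=
  ⨆ (j' : ℤ) (_ : i ≤ j') (j'' : ℤ), D.bigraded j' j''

/-- The nilradical `𝔭_+` of `𝔭`. -/
def 𝔭plus : Submodule ℝ L := D.fil 1

/-- The subquotient `𝕍_i = 𝔤^(i,*) / 𝔤^(i+1,*)`. -/
abbrev VV (i : ℤ) : Type _ := Gr (D.fil i) (D.fil (i + 1))

theorem fil_zero : D.fil 0 = D.𝔭 := by
  apply le_antisymm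
  · refine iSup_le fun j' => iSup_le fun hj => iSup_le fun j'' => iSup_le fun c => iSup_le fun hc => ?_
    exact le_iSup_of_le c (le_iSup_of_le (hc.1 ▸ hj) le_rfl)
  · refine iSup_le fun c => iSup_le fun hc => ?_
    refine le_iSup_of_le (∑ j ∈ D.Sp, c j) (le_iSup_of_le hc
      (le_iSup_of_le (∑ j ∈ D.Sq, c j - ∑ j ∈ D.Sp, c j) ?_))
    exact le_iSup_of_le c (le_iSup_of_le ⟨rfl, by ring⟩ le_rfl)

end NestedParabolics

end Algebra

/-! ## Lie groups -/

instance : ENat.LEInfty (minSmoothness ℝ 3) :=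
  ⟨by rw [minSmoothness_of_isRCLikeNormedField]; exact ENat.LEInfty.out⟩

section Groups

variable {EG : Type*} [NormedAddCommGroup EG] [NormedSpace ℝ EG] [FiniteDimensional ℝ EG]
  {G : Type*} [TopologicalSpace G] [ChartedSpace EG G] [Group G] [LieGroup 𝓘(ℝ, EG) ∞ G]
  {EP : Type*} [NormedAddCommGroup EP] [NormedSpace ℝ EP] [FiniteDimensional ℝ EP]
  {P : Type*} [TopologicalSpace P] [ChartedSpace EP P] [Group P] [LieGroup 𝓘(ℝ, EP) ∞ P]
  {EQ : Type*} [NormedAddCommGroup EQ] [NormedSpace ℝ EQ] [FiniteDimensional ℝ EQ]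
  {Q : Type*} [TopologicalSpace Q] [ChartedSpace EQ Q] [Group Q] [LieGroup 𝓘(ℝ, EQ) ∞ Q]

/-- The Lie algebra of `G`. -/
abbrev Lie (EG : Type*) [NormedAddCommGroup EG] [NormedSpace ℝ EG]
    (G : Type*) [TopologicalSpace G] [ChartedSpace EG G] [Group G] : Type _ :=
  GroupLieAlgebra 𝓘(ℝ, EG) G

/-- The adjoint action of `G` on its Lie algebra. -/
def Ad (g : G) : Lie EG G →ₗ[ℝ] Lie EG G :=
  (mfderiv 𝓘(ℝ, EG) 𝓘(ℝ, EG) (fun h : G => g * h * g⁻¹) 1).toLinearMap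

/-- The map on Lie algebras induced by a homomorphism of Lie groups. -/
def dHom (j : P →* G) : Lie EP P →ₗ[ℝ] Lie EG G :=
  (mfderiv 𝓘(ℝ, EP) 𝓘(ℝ, EG) j 1).toLinearMap

/-- The image of a subspace of the Lie algebra under the exponential map: the endpoints `γ 1` of
one-parameter subgroups `γ` with `γ'(0)` in that subspace. -/
def expImage (𝔫 : Submodule ℝ (Lie EG G)) : Set G :=
  {g | ∃ γ : ℝ → G, ContMDiff 𝓘(ℝ, ℝ) 𝓘(ℝ, EG) ∞ γ ∧ (∀ s t, γ (s + t) = γ s * γ t) ∧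
    (∃ X ∈ 𝔫, (X : EG) = (mfderiv 𝓘(ℝ, ℝ) 𝓘(ℝ, EG) γ 0 (1 : ℝ) : EG)) ∧ γ 1 = g}

/-- `j` realizes `P` as an embedded Lie subgroup of `G` with Lie algebra `𝔥`, contained in a subset
`N` of `G` and containing the connected component of the identity of `N`. -/
structure IsSubgroupBetween (j : P →* G) (𝔥 : Submodule ℝ (Lie EG G)) (N : Set G) : Prop where
  smooth : ContMDiff 𝓘(ℝ, EP) 𝓘(ℝ, EG) ∞ j
  isEmbedding : Topology.IsEmbedding j
  injective_dHom : Function.Injective (dHom j : Lie EP P →ₗ[ℝ] Lie EG G)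
  range_dHom : LinearMap.range (dHom j : Lie EP P →ₗ[ℝ] Lie EG G) = 𝔥
  range_subset : Set.range j ⊆ N
  component_subset : connectedComponentIn N 1 ⊆ Set.range j

/-- Groups `Q ⊆ P ⊆ G`, where `P` is a parabolic subgroup of `G` corresponding to `𝔭` (it lies
between the normalizer `N_G(𝔭)` and its identity component) and `Q ⊆ P` corresponds to `𝔮` (it lies
between `N_P(𝔮)` and its identity component). -/
structure NestedGroups (D : NestedParabolics (Lie EG G))
    (EP : Type*) [NormedAddCommGroup EP] [NormedSpace ℝ EP]
    (P : Type*) [TopologicalSpace P] [ChartedSpace EP P] [Group P]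
    (EQ : Type*) [NormedAddCommGroup EQ] [NormedSpace ℝ EQ]
    (Q : Type*) [TopologicalSpace Q] [ChartedSpace EQ Q] [Group Q] where
  /-- the inclusion of `P` in `G` -/
  jP : P →* G
  /-- the inclusion of `Q` in `P` -/
  jQ : Q →* P
  smooth_jQ : ContMDiff 𝓘(ℝ, EQ) 𝓘(ℝ, EP) ∞ jQ
  hP : IsSubgroupBetween (EP := EP) jP D.𝔭 {g : G | D.𝔭.map (Ad g) = D.𝔭}
  hQ : IsSubgroupBetween (EP := EQ) (jP.comp jQ) D.𝔮
    {g : G | g ∈ Set.range jP ∧ D.𝔮.map (Ad g) = D.𝔮}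

/-- The endomorphism of `𝕍_i` induced by the adjoint action of an element of `P ⊆ G`. -/
def adVV (D : NestedParabolics (Lie EG G)) (g : G) (i : ℤ) : D.VV i →ₗ[ℝ] D.VV i :=
  grMap (Ad g) (D.fil i) (D.fil (i + 1)) (D.fil i) (D.fil (i + 1))

end Groups

/-! ## Tensorial constructions -/

section Tensorial

/-- A tensorial construction with vector spaces (or vector bundles) of dimensions `n i`, `i : ι`,
is given by a smooth representation `rep` of `∏ i, GL(n i, ℝ)` on a vector space `W`. The map `rep`
is defined on all tuples of matrices, but only its values on invertible tuples matter.
Tensor products, direct sums, duals, symmetric and exterior powers, images of Young symmetrizers,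
density bundles and all their iterations are of this form. -/
structure TensorialConstruction {ι : Type*} [Fintype ι] (n : ι → ℕ)
    (W : Type*) [NormedAddCommGroup W] [NormedSpace ℝ W] where
  rep : (∀ i, (Fin (n i) → ℝ) →L[ℝ] (Fin (n i) → ℝ)) → (W →L[ℝ] W)
  rep_one : rep 1 = 1
  rep_mul : ∀ A A', IsUnit A → IsUnit A' → rep (A * A') = rep A * rep A'
  smooth : ContDiffOn ℝ ∞ rep {A | IsUnit A}

namespace TensorialConstruction

variable {ι : Type*} [Fintype ι] {n : ι → ℕ} {W : Type*} [NormedAddCommGroup W] [NormedSpace ℝ W]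

/-- The result of applying the construction to vector spaces `E i` of dimension `n i`: the space
associated to the `∏ i, GL(n i, ℝ)`-torsor of all tuples of frames `φ i : ℝ^(n i) ≅ E i` and the
representation `W`, i.e. the space of all equivariant `W`-valued functions of such tuples of frames
(extended by zero to tuples of linear maps that are not isomorphisms). -/
def obj (F : TensorialConstruction n W) (E : ι → Type*) [∀ i, AddCommGroup (E i)]
    [∀ i, Module ℝ (E i)] : Submodule ℝ ((∀ i, (Fin (n i) → ℝ) →ₗ[ℝ] E i) → W) where
  carrier := {s |
    (∀ φ : ∀ i, (Fin (n i) → ℝ) →ₗ[ℝ] E i, (∀ i, Function.Bijective (φ i)) →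
      ∀ A : ∀ i, (Fin (n i) → ℝ) →L[ℝ] (Fin (n i) → ℝ), IsUnit A →
        F.rep A (s fun i => φ i ∘ₗ (A i).toLinearMap) = s φ) ∧
    ∀ φ : ∀ i, (Fin (n i) → ℝ) →ₗ[ℝ] E i, ¬ (∀ i, Function.Bijective (φ i)) → s φ = 0}
  add_mem' := by
    rintro s t ⟨hs, hs'⟩ ⟨ht, ht'⟩
    refine ⟨fun φ hφ A hA => ?_, fun φ hφ => ?_⟩
    · simp only [Pi.add_apply, map_add, hs φ hφ A hA, ht φ hφ A hA]
    · simp only [Pi.add_apply, hs' φ hφ, ht' φ hφ, add_zero]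
  zero_mem' := by
    refine ⟨fun φ hφ A hA => ?_, fun φ hφ => rfl⟩
    simp
  smul_mem' := by
    rintro c s ⟨hs, hs'⟩
    refine ⟨fun φ hφ A hA => ?_, fun φ hφ => ?_⟩
    · simp only [Pi.smul_apply, map_smul, hs φ hφ A hA]
    · simp only [Pi.smul_apply, hs' φ hφ, smul_zero]

end TensorialConstruction

end Tensorial

/-! ## Subbundles of tangent bundles, their subquotients and tensorial constructions with them -/

section Bundles

variable {EX : Type*} [NormedAddCommGroup EX] [NormedSpace ℝ EX]
  {X : Type*} [TopologicalSpace X] [ChartedSpace EX X]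
  {EY : Type*} [NormedAddCommGroup EY] [NormedSpace ℝ EY]
  {Y : Type*} [TopologicalSpace Y] [ChartedSpace EY Y] [IsManifold 𝓘(ℝ, EY) ∞ Y]

/-- A family of subspaces of the tangent spaces of `Y` is a smooth subbundle if it locally admits
smooth frames. -/
def IsSmoothSubbundle (A : ∀ y : Y, Submodule ℝ (TangentSpace 𝓘(ℝ, EY) y)) : Prop :=
  ∀ y₀ : Y, ∃ O : Set Y, IsOpen O ∧ y₀ ∈ O ∧ ∃ (r : ℕ)
    (ξ : Fin r → ∀ y : Y, TangentSpace 𝓘(ℝ, EY) y),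
    (∀ k, ContMDiffOn 𝓘(ℝ, EY) 𝓘(ℝ, EY).tangent ∞
      (fun y => (⟨y, ξ k y⟩ : TangentBundle 𝓘(ℝ, EY) Y)) O) ∧
    ∀ y ∈ O, LinearIndependent ℝ (fun k => ξ k y) ∧
      Submodule.span ℝ (Set.range fun k => ξ k y) = A y

/-- Smoothness on `V ⊆ X` of a section `t` of the pullback along `g : X → Y` of the subquotient
`A / B` of `TY`: locally, `t` is represented by a smooth section of `g^* TY` with values in `A`. -/
def IsSmoothGrSection (EX : Type*) [NormedAddCommGroup EX] [NormedSpace ℝ EX]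
    {X : Type*} [TopologicalSpace X] [ChartedSpace EX X] (g : X → Y)
    (A B : ∀ y : Y, Submodule ℝ (TangentSpace 𝓘(ℝ, EY) y)) (V : Set X)
    (t : ∀ x, Gr (A (g x)) (B (g x))) : Prop :=
  ∀ x₀ ∈ V, ∃ O : Set X, IsOpen O ∧ x₀ ∈ O ∧ ∃ η : ∀ x, A (g x),
    ContMDiffOn 𝓘(ℝ, EX) 𝓘(ℝ, EY).tangent ∞
      (fun x => (⟨g x, (η x : TangentSpace 𝓘(ℝ, EY) (g x))⟩ : TangentBundle 𝓘(ℝ, EY) Y)) (O ∩ V) ∧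
    ∀ x ∈ O ∩ V, Submodule.Quotient.mk (η x) = t x

variable {ι : Type*} [Fintype ι] {n : ι → ℕ} {W : Type*} [NormedAddCommGroup W] [NormedSpace ℝ W]

/-- Smoothness on `V ⊆ X` of a section `σ` of the pullback along `g : X → Y` of the bundle obtained
by applying the tensorial construction `F` to the subquotients `A i / B i` of `TY`: evaluating `σ`
on (the pullback of) smooth local frames of these subquotients one obtains smooth `W`-valued
functions. -/
def IsSmoothTensorSection (EX : Type*) [NormedAddCommGroup EX] [NormedSpace ℝ EX]
    {X : Type*} [TopologicalSpace X] [ChartedSpace EX X]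
    (F : TensorialConstruction n W) (g : X → Y)
    (A B : ι → ∀ y : Y, Submodule ℝ (TangentSpace 𝓘(ℝ, EY) y)) (V : Set X)
    (σ : ∀ x, F.obj fun i => Gr (A i (g x)) (B i (g x))) : Prop :=
  ∀ x₀ ∈ V, ∃ O : Set Y, IsOpen O ∧ g x₀ ∈ O ∧
    ∃ φ : ∀ (y : Y) (i : ι), (Fin (n i) → ℝ) →ₗ[ℝ] Gr (A i y) (B i y),
      (∀ y ∈ O, ∀ i, Function.Bijective (φ y i)) ∧
      (∀ i e, IsSmoothGrSection EY (fun y : Y => y) (A i) (B i) O (fun y => φ y i e)) ∧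
      ContMDiffOn 𝓘(ℝ, EX) 𝓘(ℝ, W) ∞ (fun x => (σ x).1 (φ (g x))) (V ∩ g ⁻¹' O)

end Bundles

/-! ## Parabolic geometries -/

section Geometry

variable {EG : Type*} [NormedAddCommGroup EG] [NormedSpace ℝ EG] [FiniteDimensional ℝ EG]
  {G : Type*} [TopologicalSpace G] [ChartedSpace EG G] [Group G] [LieGroup 𝓘(ℝ, EG) ∞ G]
  {EP : Type*} [NormedAddCommGroup EP] [NormedSpace ℝ EP]
  {P : Type*} [TopologicalSpace P] [ChartedSpace EP P] [Group P]
  {EQ : Type*} [NormedAddCommGroup EQ] [NormedSpace ℝ EQ]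
  {Q : Type*} [TopologicalSpace Q] [ChartedSpace EQ Q] [Group Q]
  {D : NestedParabolics (Lie EG G)}

/-- A parabolic geometry `(π : B → M, ω)` of type `(G, Q)`: a principal `Q`-bundle with a Cartan
connection. -/
structure ParabolicGeometry (H : NestedGroups D EP P EQ Q)
    (EM : Type*) [NormedAddCommGroup EM] [NormedSpace ℝ EM]
    (M : Type*) [TopologicalSpace M] [ChartedSpace EM M]
    (EB : Type*) [NormedAddCommGroup EB] [NormedSpace ℝ EB]
    (B : Type*) [TopologicalSpace B] [ChartedSpace EB B] [IsManifold 𝓘(ℝ, EB) ∞ B] where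
  /-- the bundle projection -/
  π : B → M
  smooth_π : ContMDiff 𝓘(ℝ, EB) 𝓘(ℝ, EM) ∞ π
  /-- the principal right action -/
  act : B → Q → B
  smooth_act : ContMDiff (𝓘(ℝ, EB).prod 𝓘(ℝ, EQ)) 𝓘(ℝ, EB) ∞ (fun z : B × Q => act z.1 z.2)
  act_one : ∀ u, act u 1 = u
  act_mul : ∀ u q q', act u (q * q') = act (act u q) q'
  π_act : ∀ u q, π (act u q) = π u
  /-- local triviality: there are smooth local sections `s` such that `(x, q) ↦ s(x)·q` is a
  diffeomorphism onto the preimage of the domain of `s`; `t` is the second component of its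
  inverse -/
  locally_trivial : ∀ x : M, ∃ O : Set M, IsOpen O ∧ x ∈ O ∧ ∃ (s : M → B) (t : B → Q),
    ContMDiffOn 𝓘(ℝ, EM) 𝓘(ℝ, EB) ∞ s O ∧ ContMDiffOn 𝓘(ℝ, EB) 𝓘(ℝ, EQ) ∞ t (π ⁻¹' O) ∧
    (∀ y ∈ O, π (s y) = y) ∧ (∀ u ∈ π ⁻¹' O, act (s (π u)) (t u) = u) ∧
    ∀ y ∈ O, ∀ q, t (act (s y) q) = q
  /-- the Cartan connection `ω` -/
  conn : ∀ u : B, TangentSpace 𝓘(ℝ, EB) u ≃L[ℝ] Lie EG G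
  smooth_conn : ContMDiff (M' := EG) 𝓘(ℝ, EB).tangent 𝓘(ℝ, EG) ∞
    (fun v : TangentBundle 𝓘(ℝ, EB) B => conn v.1 v.2)
  /-- `(r^q)^* ω = Ad(q⁻¹) ∘ ω` -/
  conn_equivariant : ∀ (u : B) (q : Q) (v : TangentSpace 𝓘(ℝ, EB) u),
    conn (act u q) (mfderiv 𝓘(ℝ, EB) 𝓘(ℝ, EB) (fun u' => act u' q) u v) =
      Ad (H.jP (H.jQ q))⁻¹ (conn u v)
  /-- `ω` reproduces the generators of fundamental vector fields -/
  conn_fundamental : ∀ (u : B) (Z : Lie EQ Q),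
    conn (act u 1) (mfderiv 𝓘(ℝ, EQ) 𝓘(ℝ, EB) (fun q => act u q) 1 Z) = dHom (H.jP.comp H.jQ) Z

namespace ParabolicGeometry

variable {H : NestedGroups D EP P EQ Q}
  {EM : Type*} [NormedAddCommGroup EM] [NormedSpace ℝ EM]
  {M : Type*} [TopologicalSpace M] [ChartedSpace EM M] [IsManifold 𝓘(ℝ, EM) ∞ M]
  {EB : Type*} [NormedAddCommGroup EB] [NormedSpace ℝ EB]
  {B : Type*} [TopologicalSpace B] [ChartedSpace EB B] [IsManifold 𝓘(ℝ, EB) ∞ B]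
  (C : ParabolicGeometry H EM M EB B)

/-- The projection `𝔤 → T_(π u) M`, `X ↦ Tπ (ω_u⁻¹ X)`, which defines the isomorphism
`TM ≅ B ×_Q (𝔤/𝔮)`. -/
def toTangent (u : B) : Lie EG G →ₗ[ℝ] TangentSpace 𝓘(ℝ, EM) (C.π u) :=
  (mfderiv 𝓘(ℝ, EB) 𝓘(ℝ, EM) C.π u).toLinearMap ∘ₗ (C.conn u).symm.toLinearEquiv.toLinearMap

/-- The subbundle of `TM` induced by a `Q`-invariant subspace `𝔨` with `𝔮 ⊆ 𝔨 ⊆ 𝔤`. -/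
def inducedSubbundle (𝔨 : Submodule ℝ (Lie EG G)) (x : M) :
    Submodule ℝ (TangentSpace 𝓘(ℝ, EM) x) :=
  Submodule.span ℝ {v | ∃ u : B, ∃ Z ∈ 𝔨,
    (⟨x, v⟩ : TangentBundle 𝓘(ℝ, EM) M) = ⟨C.π u, C.toTangent u Z⟩}

/-- The relative tangent bundle `T_ρ M`, induced by `𝔭/𝔮`. -/
def relTangent (x : M) : Submodule ℝ (TangentSpace 𝓘(ℝ, EM) x) :=
  C.inducedSubbundle D.𝔭 x

/-- The subbundle `T^i_P M` for `i ≤ 0`, induced by `𝔤^(i,*)/𝔮`; for `i = 0` it equals `T_ρ M`. -/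
def tanFil (i : ℤ) (x : M) : Submodule ℝ (TangentSpace 𝓘(ℝ, EM) x) :=
  C.inducedSubbundle (D.fil i) x

/-- The bundle `𝒱_i M = T^i_P M / T^(i+1)_P M`, for `i < 0`. -/
abbrev VBundle (i : ℤ) (x : M) : Type _ := Gr (C.tanFil i x) (C.tanFil (i + 1) x)

/-- The map `𝕍_i → (𝒱_i M)_(π u)` determined by a point `u` of the Cartan bundle. -/
def toVBundle (u : B) (i : ℤ) : D.VV i →ₗ[ℝ] C.VBundle i (C.π u) :=
  grMap (C.toTangent u) (D.fil i) (D.fil (i + 1)) (C.tanFil i (C.π u)) (C.tanFil (i + 1) (C.π u))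

/-- The curvature function of the Cartan connection,
`κ(u)(X, Y) = [X, Y] - ω_u([ω⁻¹(X), ω⁻¹(Y)](u))`. -/
def curvature (u : B) (X Y : Lie EG G) : Lie EG G :=
  ⁅X, Y⁆ - C.conn u (VectorField.mlieBracket 𝓘(ℝ, EB)
    (fun v => (C.conn v).symm X) (fun v => (C.conn v).symm Y) u)

/-- The torsion `τ` evaluated on the projections to `TM` of `ω_u⁻¹ X` and `ω_u⁻¹ Y`. -/
def torsion (u : B) (X Y : Lie EG G) : TangentSpace 𝓘(ℝ, EM) (C.π u) :=
  C.toTangent u (C.curvature u X Y)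

/-- The condition `τ(T_ρ M, T^i_P M) ⊆ T^j_P M` on the torsion. -/
def TorsionMapsTo (i j : ℤ) : Prop :=
  ∀ (u : B) (X Y : Lie EG G), C.toTangent u X ∈ C.relTangent (C.π u) →
    C.toTangent u Y ∈ C.tanFil i (C.π u) → C.torsion u X Y ∈ C.tanFil j (C.π u)

/-! ### Leaf spaces -/

section LeafSpace

variable {EN : Type*} [NormedAddCommGroup EN] [NormedSpace ℝ EN]
  {N : Type*} [TopologicalSpace N] [ChartedSpace EN N] [IsManifold 𝓘(ℝ, EN) ∞ N]

/-- `ψ : U → N` is a local leaf space for `T_ρ M` with connected fibers. (The values of `ψ` outside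
of the open subset `U` are irrelevant.) -/
structure IsLeafSpace (EN : Type*) [NormedAddCommGroup EN] [NormedSpace ℝ EN]
    {N : Type*} [TopologicalSpace N] [ChartedSpace EN N] (U : Set M) (ψ : M → N) : Prop where
  isOpen : IsOpen U
  smooth : ContMDiffOn 𝓘(ℝ, EM) 𝓘(ℝ, EN) ∞ ψ U
  surjective : ψ '' U = Set.univ
  submersion : ∀ y ∈ U, Function.Surjective (mfderiv 𝓘(ℝ, EM) 𝓘(ℝ, EN) ψ y)
  ker_eq : ∀ y ∈ U, LinearMap.ker (mfderiv 𝓘(ℝ, EM) 𝓘(ℝ, EN) ψ y).toLinearMap = C.relTangent y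
  connected_fibers : ∀ z : N, IsConnected (U ∩ ψ ⁻¹' {z})

/-- The subspace `T^i N` of `T_z N` spanned by the images of the spaces `T^i_P M` at all points of
the fiber of `ψ` over `z`. -/
def tanFilN (EN : Type*) [NormedAddCommGroup EN] [NormedSpace ℝ EN]
    {N : Type*} [TopologicalSpace N] [ChartedSpace EN N] [IsManifold 𝓘(ℝ, EN) ∞ N]
    (U : Set M) (ψ : M → N) (i : ℤ) (z : N) : Submodule ℝ (TangentSpace 𝓘(ℝ, EN) z) :=
  Submodule.span ℝ {w | ∃ y ∈ U, ∃ v ∈ C.tanFil i y,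
    (⟨z, w⟩ : TangentBundle 𝓘(ℝ, EN) N) = ⟨ψ y, mfderiv 𝓘(ℝ, EM) 𝓘(ℝ, EN) ψ y v⟩}

/-- The component `gr_i(TN) = T^i N / T^(i+1) N` of the associated graded bundle. -/
abbrev grTN (EN : Type*) [NormedAddCommGroup EN] [NormedSpace ℝ EN]
    {N : Type*} [TopologicalSpace N] [ChartedSpace EN N] [IsManifold 𝓘(ℝ, EN) ∞ N]
    (U : Set M) (ψ : M → N) (i : ℤ) (z : N) : Type _ :=
  Gr (C.tanFilN EN U ψ i z) (C.tanFilN EN U ψ (i + 1) z)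

/-- The map `(𝒱_i M)_y → gr_i(T_(ψ y) N)` induced by `T_y ψ`. -/
def grψ (EN : Type*) [NormedAddCommGroup EN] [NormedSpace ℝ EN]
    {N : Type*} [TopologicalSpace N] [ChartedSpace EN N] [IsManifold 𝓘(ℝ, EN) ∞ N]
    (U : Set M) (ψ : M → N) (y : M) (i : ℤ) : C.VBundle i y →ₗ[ℝ] C.grTN EN U ψ i (ψ y) :=
  grMap (mfderiv 𝓘(ℝ, EM) 𝓘(ℝ, EN) ψ y).toLinearMap
    (C.tanFil i y) (C.tanFil (i + 1) y)
    (C.tanFilN EN U ψ i (ψ y)) (C.tanFilN EN U ψ (i + 1) (ψ y))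

end LeafSpace

/-! ### Relative tractor bundles and their connections -/

section Tractor

variable {W : Type*} [NormedAddCommGroup W] [NormedSpace ℝ W]

/-- `ρ` is a smooth representation of `P` on which `P_+ = exp(𝔭_+)` acts trivially, so that its
restriction to `Q` induces a relative tractor bundle. -/
structure IsRelTractorRep (H : NestedGroups D EP P EQ Q) (ρ : P → (W →L[ℝ] W)) : Prop where
  smooth : ContMDiff 𝓘(ℝ, EP) 𝓘(ℝ, W →L[ℝ] W) ∞ ρ
  map_one : ρ 1 = 1
  map_mul : ∀ p p', ρ (p * p') = ρ p * ρ p'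
  trivial : ∀ p, H.jP p ∈ expImage D.𝔭plus → ρ p = 1

/-- Sections over `U` of the bundle `B ×_Q W` are identified with functions `f : B → W` that are
`Q`-equivariant over `U`, i.e. `f(u·q) = ρ(q)⁻¹ f(u)`. -/
def IsSection (ρ : P → (W →L[ℝ] W)) (U : Set M) (f : B → W) : Prop :=
  ∀ u, C.π u ∈ U → ∀ q : Q, ρ (H.jQ q) (f (C.act u q)) = f u

/-- The relative tractor connection on `B ×_Q W`: the function corresponding to
`∇^ρ_(Π(s)) f = D_s f + s • f` at `u`, where `s(u)` is the element of `𝔭` corresponding to the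
element `Z` of the Lie algebra of `P`. Here `D` is the fundamental derivative, i.e. the derivative
in the direction of `ω⁻¹(s)`, and `•` is the infinitesimal representation of the Lie algebra
of `P`. -/
def relTractorConnection (ρ : P → (W →L[ℝ] W)) (f : B → W) (u : B) (Z : Lie EP P) : W :=
  let Df : W := mfderiv 𝓘(ℝ, EB) 𝓘(ℝ, W) f u ((C.conn u).symm (dHom H.jP Z))
  let dρ : W →L[ℝ] W := mfderiv 𝓘(ℝ, EP) 𝓘(ℝ, W →L[ℝ] W) ρ 1 Z
  Df + dρ (f u)

/-- A section over `U` is parallel for the relative tractor connection. -/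
def IsParallel (ρ : P → (W →L[ℝ] W)) (U : Set M) (f : B → W) : Prop :=
  ∀ u, C.π u ∈ U → ∀ Z : Lie EP P, C.relTractorConnection ρ f u Z = 0

variable {ι : Type*} [Fintype ι] {n : ι → ℕ}

/-- The representation obtained by applying a tensorial construction to the representations
`𝕍_(k i)`, where `𝕍_(k i)` is identified with `ℝ^(n i)` via `b i`. -/
def tensorRep (H : NestedGroups D EP P EQ Q) (F : TensorialConstruction n W) (k : ι → ℤ)
    (b : ∀ i, (Fin (n i) → ℝ) ≃ₗ[ℝ] D.VV (k i)) (p : P) : W →L[ℝ] W :=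
  F.rep fun i => LinearMap.toContinuousLinearMap
    ((b i).symm.toLinearMap ∘ₗ adVV D (H.jP p) (k i) ∘ₗ (b i).toLinearMap)

variable {EY : Type*} [NormedAddCommGroup EY] [NormedSpace ℝ EY]
  {Y : Type*} [TopologicalSpace Y] [ChartedSpace EY Y] [IsManifold 𝓘(ℝ, EY) ∞ Y]

/-- The function on `B` corresponding to a section `σ` of the pullback along `g` of a tensorial
construction `F` applied to subquotients `E i / E' i` of `TY`, where a point `u` of `B`
determines frames `fr u i` of the fibers at `g (π u)` of these subquotients. -/
def toFun (F : TensorialConstruction n W) (g : M → Y)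
    (E E' : ι → ∀ y : Y, Submodule ℝ (TangentSpace 𝓘(ℝ, EY) y))
    (fr : ∀ u i, (Fin (n i) → ℝ) →ₗ[ℝ] Gr (E i (g (C.π u))) (E' i (g (C.π u))))
    (σ : ∀ x, F.obj fun i => Gr (E i (g x)) (E' i (g x))) (u : B) : W :=
  (σ (C.π u)).1 (fr u)

/-- The frames `fr` identify, over `U`, the bundle `B ×_Q W` with the pullback along `g` of the
tensorial construction `F` applied to the subquotients `E i / E' i` of `TY`, by
an isomorphism of smooth vector bundles which sends the class of `(u, w)` to the element whose
value on the frame `fr u` is `w`. -/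
structure IdentifiesBundles (ρ : P → (W →L[ℝ] W)) (F : TensorialConstruction n W)
    (U : Set M) (g : M → Y)
    (E E' : ι → ∀ y : Y, Submodule ℝ (TangentSpace 𝓘(ℝ, EY) y))
    (fr : ∀ u i, (Fin (n i) → ℝ) →ₗ[ℝ] Gr (E i (g (C.π u))) (E' i (g (C.π u)))) : Prop where
  frame : ∀ u, C.π u ∈ U → ∀ i, Function.Bijective (fr u i)
  fiber : ∀ u, C.π u ∈ U → Function.Bijective
    (fun a : F.obj (fun i => Gr (E i (g (C.π u))) (E' i (g (C.π u)))) => a.1 (fr u))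
  isSection : ∀ σ, C.IsSection ρ U (C.toFun F g E E' fr σ)
  exists_section : ∀ f, C.IsSection ρ U f →
    ∃ σ, ∀ u, C.π u ∈ U → C.toFun F g E E' fr σ u = f u
  smooth_iff : ∀ V ⊆ U, IsOpen V → ∀ σ, IsSmoothTensorSection EM F g E E' V σ ↔
    ContMDiffOn 𝓘(ℝ, EB) 𝓘(ℝ, W) ∞ (C.toFun F g E E' fr σ) (C.π ⁻¹' V)

end Tractor

end ParabolicGeometry

end Geometry

end

end RelativeBGG

open RelativeBGG

set_option linter.unusedSectionVars false

namespace RelativeBGG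

/-! For a point `u` of the Cartan bundle over `U` let `L(u) X = T(ψ ∘ π)(ω_u⁻¹ X)`, a map from `𝔤`
onto the tangent space of `N` at `ψ(π u)`; its kernel is `𝔭` because `T_ρ M` is the kernel of `Tψ`.
In a chart of `N`, `L(u) X` is the derivative of a vector-valued function along the constant field
`ω⁻¹ X`. If `X ∈ 𝔭`, then `L(·) X` vanishes identically, and the commutator formula `fd_parBr`
reduces to `X·(L Y) = L([X, Y] - κ(X, Y))`. Both halves of the theorem come from this equation.

If the torsion maps `T_ρ M × T^i_P M` to `T^i_P M`, then for `Y ∈ 𝔤^(i,*)` the right side lies in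
`L(𝔤^(i,*))`. The subspace `L(u)(𝔤^(i,*))` is therefore locally constant along the fibres of `ψ ∘ π`
(`IsRelSubmersion.eventually_map_frm_eq`). Since `Q` preserves `𝔤^(i,*)` and the fibres of `ψ` are
connected, it depends on the point of `N` only (`IsLeafSpace.map_frm_eq`), and it is `T^i N`. A
complement of `𝔭` in `𝔤^(i,*)` and a local section through the Cartan bundle give smooth frames of
it.

If the torsion even takes values in `T^(i+1)_P M`, then modulo `𝔤^(i+1,*)` the curvature drops out
and the frames of `gr_i(TN)` given by the points `u` change along the fibres by `ad X`. The matrix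
`T(u)` comparing the frame at `u` with the one at a fixed `u₀` then satisfies `X·T = T ad X`
(`IsAdapted.exists_transport`). Hence `F.rep (T u)` turns the relative tractor connection into the
ordinary derivative (`vd_rep_apply_eq`): a section `f` is parallel if and only if `F.rep (T u) (f
u)` is locally constant along the fibres, that is, if and only if the element with value `f u` on
the frame of `u` does not change along the fibre.

The identifications of bundles hold for any submersion adapted to the filtrations
(`IsAdapted.identifiesBundles`), and are applied to `ψ` and to the identity of `M`.

Two facts about groups are needed. An automorphism of `𝔤` preserving `𝔭` preserves every `𝔤^(i,*)`
(`map_fil_of_map_fil_zero`): Killing duality gives the nilradical, and comparing the eigenvalues of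
the grading element with those of its image gives the rest. Moreover the derivative of `Ad` is `ad`
(`vd_AdL`), which identifies the infinitesimal representation and shows that `exp(𝔭_+)` acts
trivially on the graded pieces. -/

theorem eq_of_iSupIndep_of_le {ι α : Type*} [CompleteLattice α] [IsModularLattice α]
    {A B : ι → α} (hB : iSupIndep B) (hle : ∀ i, A i ≤ B i) (htop : ⨆ i, A i = ⊤) (i : ι) :
    A i = B i := by
  refine le_antisymm (hle i) ?_
  have h1 : A i ⊔ ⨆ (j) (_ : j ≠ i), A j = ⊤ := by
    rw [← htop]
    refine le_antisymm ?_ ?_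
    · exact sup_le (le_iSup _ _) (iSup₂_le fun j _ => le_iSup _ _)
    · refine iSup_le fun j => ?_
      by_cases h : j = i
      · subst h; exact le_sup_left
      · exact le_sup_of_le_right (le_iSup₂_of_le j h le_rfl)
  have h2 : (⨆ (j) (_ : j ≠ i), A j) ⊓ B i = ⊥ := by
    refine le_bot_iff.1 (le_trans (inf_le_inf_right _ (iSup₂_mono fun j _ => hle j)) ?_)
    exact (disjoint_iff.1 (hB i).symm).le
  -- The modular law applies since `A i ≤ B i`; independence of `B` then removes all summands other
  -- than `A i`.
  calc B i = (A i ⊔ ⨆ (j) (_ : j ≠ i), A j) ⊓ B i := by rw [h1, top_inf_eq]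
    _ = A i ⊔ (⨆ (j) (_ : j ≠ i), A j) ⊓ B i := (sup_inf_assoc_of_le _ (hle i)).symm ▸ rfl
    _ ≤ A i := by rw [h2, sup_bot_eq]

/-! ### Diagonalizable operators -/

section Diagonalizable

open Module.End

variable {V : Type*} [AddCommGroup V] [Module ℝ V]

/-- The eigenspaces already span, and the generalized eigenspaces containing them are independent,
so there is no room for anything more. -/
theorem maxGenEigenspace_eq_eigenspace_of_iSup_eq_top {f : Module.End ℝ V}
    (hf : ⨆ μ : ℝ, eigenspace f μ = ⊤) (μ : ℝ) : maxGenEigenspace f μ = eigenspace f μ :=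
  (eq_of_iSupIndep_of_le f.independent_maxGenEigenspace
    (fun ν => (f.genEigenspace ν).mono le_top) hf μ).symm

theorem eq_iSup_inf_eigenspace [FiniteDimensional ℝ V] {f : Module.End ℝ V}
    (hf : ⨆ μ : ℝ, eigenspace f μ = ⊤) {p : Submodule ℝ V} (hp : ∀ x ∈ p, f x ∈ p) :
    p = ⨆ μ : ℝ, p ⊓ eigenspace f μ :=
  Submodule.eq_iSup_inf_genEigenspace (k := 1) hp hf

/-- Each eigenspace of `f` is invariant under the commuting map `g` and so splits into joint
eigenvectors. This is what allows a diagonalizable element to be adjoined to a split toral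
subalgebra. -/
theorem iSup_eigenspace_add_smul_eq_top [FiniteDimensional ℝ V] {f g : Module.End ℝ V}
    (hf : ⨆ μ : ℝ, eigenspace f μ = ⊤) (hg : ⨆ μ : ℝ, eigenspace g μ = ⊤)
    (hc : ∀ x, f (g x) = g (f x)) (c : ℝ) : ⨆ μ : ℝ, eigenspace (f + c • g) μ = ⊤ := by
  rw [eq_top_iff, ← hf]
  refine iSup_le fun μ => ?_
  have := eq_iSup_inf_eigenspace hg (p := eigenspace f μ) (by
    intro x hx
    rw [mem_eigenspace_iff] at hx ⊢
    rw [hc, hx, map_smul])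
  rw [this]
  refine iSup_le fun ν => le_iSup_of_le (μ + c * ν) ?_
  rintro x ⟨hx, hx'⟩
  have hx := mem_eigenspace_iff.1 hx
  have hx' := mem_eigenspace_iff.1 hx'
  rw [mem_eigenspace_iff]
  simp [hx, hx', add_smul, mul_smul]

/-- An eigenvector lying in the sum of the eigenspaces with eigenvalues in `S` has its eigenvalue
in `S`. -/
theorem eigenvalue_mem_of_mem_iSup {f : Module.End ℝ V} {S : Set ℝ} {μ : ℝ} {x : V}
    (hx : x ∈ eigenspace f μ) (hx0 : x ≠ 0) (hS : x ∈ ⨆ ν ∈ S, eigenspace f ν) : μ ∈ S := by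
  by_contra h
  have := (f.eigenspaces_iSupIndep) μ
  apply hx0
  refine (Submodule.disjoint_def.1 this) x hx ?_
  refine (iSup₂_le fun ν hν => ?_ : (⨆ ν ∈ S, eigenspace f ν) ≤ _) hS
  exact le_iSup₂_of_le ν (fun e => h (e ▸ hν)) le_rfl

end Diagonalizable

/-! ### The grading by `Σ_𝔭`-height -/

namespace NestedParabolics

open Module.End

variable {L : Type*} [LieRing L] [LieAlgebra ℝ L] [FiniteDimensional ℝ L]
  (D : NestedParabolics L)

/-- The operators `ad h`, `h ∈ 𝔞`, commute and are diagonalizable, hence simultaneously so. The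
joint eigenvalues a priori form an arbitrary function on `𝔞`. -/
theorem iSup_rootSpace : ⨆ lam, rootSpace D.𝔞 lam = ⊤ := by
  have hD := D.maximal.prop
  have key := iSup_iInf_maxGenEigenspace_eq_top_of_iSup_maxGenEigenspace_eq_top_of_commute
    (fun h : D.𝔞 => LieAlgebra.ad ℝ L (h : L)) (by
      intro x y _
      refine LinearMap.ext fun z => ?_
      change ⁅(x : L), ⁅(y : L), z⁆⁆ = ⁅(y : L), ⁅(x : L), z⁆⁆
      rw [leibniz_lie, hD.1 x x.2 y y.2, zero_lie, zero_add]) (by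
      intro x
      rw [← top_le_iff, ← hD.2 x x.2]
      exact iSup_mono fun μ => (genEigenspace _ _).mono le_top)
  rw [← top_le_iff, ← key]
  refine iSup_le fun χ => ?_
  have hmem : ∀ x ∈ ⨅ h : D.𝔞, maxGenEigenspace (LieAlgebra.ad ℝ L (h : L)) (χ h),
      ∀ h : D.𝔞, ⁅(h : L), x⁆ = χ h • x := by
    intro x hx h
    have := (Submodule.mem_iInf _).1 hx h
    rw [maxGenEigenspace_eq_eigenspace_of_iSup_eq_top (hD.2 h h.2), mem_eigenspace_iff] at this
    exact this
  by_cases h0 : (⨅ h : D.𝔞, maxGenEigenspace (LieAlgebra.ad ℝ L (h : L)) (χ h)) = ⊥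
  · exact h0.le.trans bot_le
  obtain ⟨v, hv, hv0⟩ := Submodule.exists_mem_ne_zero_of_ne_bot h0
  have hv := hmem v hv
  -- The eigenvalue function is linear because it can be read off from the action on the single
  -- non-zero vector `v`.
  refine le_iSup_of_le
    { toFun := χ
      map_add' := fun x y => ?_
      map_smul' := fun c x => ?_ } (fun x hx h => hmem x hx h)
  · apply smul_left_injective ℝ hv0
    simp only [add_smul]
    rw [← hv, ← hv, ← hv, Submodule.coe_add, add_lie]
  · apply smul_left_injective ℝ hv0
    simp only [RingHom.id_apply, smul_eq_mul, mul_smul]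
    rw [← hv, ← hv, Submodule.coe_smul, smul_lie]

theorem iSup_space : ⨆ c, D.space c = ⊤ := by
  rw [← top_le_iff, ← D.iSup_rootSpace]
  refine iSup_le fun lam => ?_
  by_cases h0 : rootSpace D.𝔞 lam = ⊥
  · exact h0.le.trans bot_le
  by_cases h1 : lam = 0
  · refine le_iSup_of_le 0 ?_
    simp [space, h1]
  obtain ⟨c, hc | hc⟩ := D.root_eq lam ⟨h1, h0⟩
  · exact le_iSup_of_le (fun j => (c j : ℤ)) (by simp [space, hc])
  · exact le_iSup_of_le (fun j => -(c j : ℤ)) (by simp [space, hc])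

/-- Non-zero spaces have coefficients of a constant sign. -/
theorem nonneg_or_nonpos_of_space_ne_bot {c : Fin D.r → ℤ} (h : D.space c ≠ ⊥) :
    (∀ j, 0 ≤ c j) ∨ ∀ j, c j ≤ 0 := by
  by_cases h1 : ∑ j, c j • D.simple j = 0
  · have := Fintype.linearIndependent_iff.1 D.simple_indep (fun j => (c j : ℝ)) (by
      simpa [← Int.cast_smul_eq_zsmul ℝ] using h1)
    left; intro j
    have := this j
    norm_cast at this
    exact this.ge
  obtain ⟨d, hd | hd⟩ := D.root_eq _ ⟨h1, h⟩
  · left; intro j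
    have := Fintype.linearIndependent_iff.1 D.simple_indep (fun j => (c j - d j : ℝ)) (by
      simp only [sub_smul, Finset.sum_sub_distrib, sub_eq_zero]
      simpa [← Int.cast_smul_eq_zsmul ℝ, ← Nat.cast_smul_eq_nsmul ℝ] using hd) j
    have : (c j : ℝ) = (d j : ℤ) := by push_cast; linarith
    have : c j = d j := by exact_mod_cast this
    omega
  · right; intro j
    have := Fintype.linearIndependent_iff.1 D.simple_indep (fun j => (c j + d j : ℝ)) (by
      simp only [add_smul, Finset.sum_add_distrib, ← eq_neg_iff_add_eq_zero]
      simpa [← Int.cast_smul_eq_zsmul ℝ, ← Nat.cast_smul_eq_nsmul ℝ] using hd) j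
    have : (c j : ℝ) = (-d j : ℤ) := by push_cast; linarith
    have : c j = -d j := by exact_mod_cast this
    omega

/-- By independence of the simple roots the values can be prescribed by a functional on the dual of
`𝔞`, and finite-dimensionality turns this functional into an element of `𝔞`. -/
theorem exists_grading_element :
    ∃ E : D.𝔞, ∀ j, D.simple j E = if j ∈ D.Sp then 1 else 0 := by
  classical
  obtain ⟨f, hf⟩ : ∃ f : Module.Dual ℝ (Module.Dual ℝ D.𝔞),
      ∀ j, f (D.simple j) = if j ∈ D.Sp then 1 else 0 := by
    obtain ⟨f, hf⟩ := LinearMap.exists_extend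
      ((Module.Basis.span D.simple_indep).constr ℝ fun j => if j ∈ D.Sp then (1 : ℝ) else 0)
    refine ⟨f, fun j => ?_⟩
    have := LinearMap.congr_fun hf ((Module.Basis.span D.simple_indep) j)
    rw [Module.Basis.constr_basis] at this
    simpa [Module.Basis.span_apply] using this
  refine ⟨(Module.evalEquiv ℝ D.𝔞).symm f, fun j => ?_⟩
  rw [← hf j]
  simp

/-- An element of `𝔞` whose adjoint action has the eigenvalue `i` on spaces of `Σ_𝔭`-height `i`. -/
noncomputable def gradingElement : D.𝔞 := D.exists_grading_element.choose

/-- The eigenspaces of the grading element. -/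
noncomputable def graded (μ : ℝ) : Submodule ℝ L :=
  eigenspace (LieAlgebra.ad ℝ L (D.gradingElement : L)) μ

theorem mem_graded {μ : ℝ} {x : L} : x ∈ D.graded μ ↔ ⁅(D.gradingElement : L), x⁆ = μ • x :=
  mem_eigenspace_iff

theorem sum_smul_simple_apply (c : Fin D.r → ℤ) (h : D.𝔞) :
    (∑ j, c j • D.simple j) h = ∑ j, (c j : ℝ) * D.simple j h := by
  simp

theorem sum_gradingElement (c : Fin D.r → ℤ) :
    (∑ j, c j • D.simple j) D.gradingElement = ((∑ j ∈ D.Sp, c j : ℤ) : ℝ) := by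
  rw [sum_smul_simple_apply]
  simp only [gradingElement, D.exists_grading_element.choose_spec]
  simp

theorem space_le_graded (c : Fin D.r → ℤ) :
    D.space c ≤ D.graded ((∑ j ∈ D.Sp, c j : ℤ) : ℝ) := by
  intro x hx
  rw [mem_graded, ← D.sum_gradingElement]
  exact hx D.gradingElement

/-- The sums of root spaces of fixed height lie in the independent eigenspaces and together span, so
they exhaust them. In particular the eigenspace of a non-integral `μ` vanishes. -/
theorem graded_eq (μ : ℝ) : D.graded μ =
    ⨆ (c : Fin D.r → ℤ) (_ : ((∑ j ∈ D.Sp, c j : ℤ) : ℝ) = μ), D.space c := by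
  refine (eq_of_iSupIndep_of_le (A := fun μ : ℝ =>
    ⨆ (c : Fin D.r → ℤ) (_ : ((∑ j ∈ D.Sp, c j : ℤ) : ℝ) = μ), D.space c)
    (B := D.graded) (eigenspaces_iSupIndep _) (fun ν => ?_) ?_ μ).symm
  · exact iSup₂_le fun c hc => hc ▸ D.space_le_graded c
  · rw [← top_le_iff, ← D.iSup_space]
    exact iSup_le fun c => le_iSup_of_le _ (le_iSup₂_of_le c rfl le_rfl)

theorem fil_eq_iSup_space (i : ℤ) :
    D.fil i = ⨆ (c : Fin D.r → ℤ) (_ : i ≤ ∑ j ∈ D.Sp, c j), D.space c := by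
  apply le_antisymm
  · refine iSup_le fun j' => iSup_le fun hj => iSup_le fun j'' => iSup_le fun c => iSup_le fun hc => ?_
    exact le_iSup_of_le c (le_iSup_of_le (hc.1 ▸ hj) le_rfl)
  · refine iSup_le fun c => iSup_le fun hc => ?_
    refine le_iSup_of_le (∑ j ∈ D.Sp, c j) (le_iSup_of_le hc
      (le_iSup_of_le (∑ j ∈ D.Sq, c j - ∑ j ∈ D.Sp, c j) ?_))
    exact le_iSup_of_le c (le_iSup_of_le ⟨rfl, by ring⟩ le_rfl)

/-- This describes the filtration through the eigenvalues of one operator, which can be compared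
with its conjugate under an automorphism. -/
theorem fil_eq (i : ℤ) : D.fil i = ⨆ μ ∈ Set.Ici (i : ℝ), D.graded μ := by
  rw [fil_eq_iSup_space]
  apply le_antisymm
  · refine iSup₂_le fun c hc => le_iSup₂_of_le _ ?_ (D.space_le_graded c)
    exact (Int.cast_le (R := ℝ)).2 hc
  · refine iSup₂_le fun μ hμ => ?_
    rw [graded_eq]
    refine iSup₂_le fun c hc => le_iSup₂_of_le c ?_ le_rfl
    rw [← hc] at hμ
    exact (Int.cast_le (R := ℝ)).1 hμ

theorem graded_le_fil {i : ℤ} {μ : ℝ} (h : (i : ℝ) ≤ μ) : D.graded μ ≤ D.fil i := by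
  rw [fil_eq]
  exact le_iSup₂_of_le μ h le_rfl

theorem iSup_graded : ⨆ μ, D.graded μ = ⊤ := by
  rw [← top_le_iff, ← D.iSup_space]
  exact iSup_le fun c => le_iSup_of_le _ (D.space_le_graded c)

theorem fil_antitone : Antitone D.fil := by
  intro i j hij
  rw [fil_eq_iSup_space, fil_eq_iSup_space]
  exact iSup₂_le fun c hc => le_iSup₂_of_le c (hij.trans hc) le_rfl

theorem fil_eq_sup (i : ℤ) : D.fil i = D.graded i ⊔ D.fil (i + 1) := by
  apply le_antisymm
  · rw [fil_eq_iSup_space]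
    refine iSup₂_le fun c hc => ?_
    rcases hc.lt_or_eq with h | h
    · refine le_sup_of_le_right ?_
      rw [fil_eq_iSup_space]
      exact le_iSup₂_of_le c h le_rfl
    · exact le_sup_of_le_left (h ▸ D.space_le_graded c)
  · exact sup_le (D.graded_le_fil le_rfl) (D.fil_antitone (by omega))

theorem disjoint_graded_fil {i j : ℤ} (h : i < j) : Disjoint (D.graded i) (D.fil j) := by
  rw [Submodule.disjoint_def]
  intro x hx hx'
  by_contra h0
  rw [fil_eq] at hx'
  have := eigenvalue_mem_of_mem_iSup hx h0 hx'
  simp only [Set.mem_Ici, Int.cast_le] at this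
  omega

theorem finite_graded_ne_bot : {μ : ℝ | D.graded μ ≠ ⊥}.Finite :=
  Module.End.finite_hasEigenvalue (LieAlgebra.ad ℝ L (D.gradingElement : L))

/-- The grading element has finitely many eigenvalues. The bound starts the descending inductions
along the filtration. -/
theorem exists_fil_eq_bot : ∃ n : ℕ, ∀ i : ℤ, n ≤ i → D.fil i = ⊥ := by
  obtain ⟨b, hb⟩ := D.finite_graded_ne_bot.bddAbove
  obtain ⟨n, hn⟩ := exists_nat_gt b
  refine ⟨n, fun i hi => ?_⟩
  rw [fil_eq, ← le_bot_iff]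
  refine iSup₂_le fun μ hμ => ?_
  by_contra h
  have h1 := hb (show μ ∈ {μ : ℝ | D.graded μ ≠ ⊥} from fun h' => h h'.le)
  have : ((n : ℤ) : ℝ) ≤ i := Int.cast_le.2 hi
  simp only [Set.mem_Ici] at hμ
  push_cast at this
  linarith

theorem exists_fil_eq_top : ∃ n : ℕ, ∀ i : ℤ, i ≤ -n → D.fil i = ⊤ := by
  obtain ⟨b, hb⟩ := D.finite_graded_ne_bot.bddBelow
  obtain ⟨n, hn⟩ := exists_nat_gt (-b)
  refine ⟨n, fun i hi => ?_⟩
  rw [← top_le_iff, ← D.iSup_graded]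
  refine iSup_le fun μ => ?_
  by_cases h : D.graded μ = ⊥
  · exact h.le.trans bot_le
  refine D.graded_le_fil ?_
  have h1 := hb (show μ ∈ {μ : ℝ | D.graded μ ≠ ⊥} from h)
  have : (i : ℝ) ≤ ((-n : ℤ) : ℝ) := Int.cast_le.2 hi
  push_cast at this
  linarith

theorem lie_mem_graded {μ ν : ℝ} {x y : L} (hx : x ∈ D.graded μ) (hy : y ∈ D.graded ν) :
    ⁅x, y⁆ ∈ D.graded (μ + ν) := by
  rw [mem_graded] at *
  rw [leibniz_lie, hx, hy, smul_lie, lie_smul, add_smul]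

theorem lie_mem_fil {i j : ℤ} {x y : L} (hx : x ∈ D.fil i) (hy : y ∈ D.fil j) :
    ⁅x, y⁆ ∈ D.fil (i + j) := by
  have h1 : ∀ μ ∈ Set.Ici (i : ℝ), ∀ x ∈ D.graded μ, ⁅x, y⁆ ∈ D.fil (i + j) := by
    intro μ hμ x hx
    have : D.fil j ≤ (D.fil (i + j)).comap (LieAlgebra.ad ℝ L x : L →ₗ[ℝ] L) := by
      rw [D.fil_eq j]
      refine iSup₂_le fun ν hν y hy => ?_
      refine D.graded_le_fil ?_ (D.lie_mem_graded hx hy)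
      push_cast
      exact add_le_add hμ hν
    exact this hy
  have : D.fil i ≤ (D.fil (i + j)).comap (LieAlgebra.ad ℝ L y : L →ₗ[ℝ] L) := by
    rw [D.fil_eq i]
    refine iSup₂_le fun μ hμ x hx => ?_
    rw [Submodule.mem_comap, LieAlgebra.ad_apply, ← lie_skew]
    exact neg_mem (h1 μ hμ x hx)
  rw [← lie_skew]
  exact neg_mem (this hx)

theorem lie_mem_fil_of_le {i j k : ℤ} (h : k ≤ i + j) {x y : L} (hx : x ∈ D.fil i)
    (hy : y ∈ D.fil j) : ⁅x, y⁆ ∈ D.fil k :=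
  D.fil_antitone h (D.lie_mem_fil hx hy)

section Killing

/-- Invariance of the Killing form under the grading element gives `(μ + ν) * killingForm ℝ L x y =
0`. -/
theorem killingForm_graded {μ ν : ℝ} (h : μ + ν ≠ 0) {x y : L} (hx : x ∈ D.graded μ)
    (hy : y ∈ D.graded ν) : killingForm ℝ L x y = 0 := by
  rw [mem_graded] at hx hy
  have := LieModule.traceForm_apply_lie_apply ℝ L L x (D.gradingElement : L) y
  rw [← lie_skew, hx, hy] at this
  simp only [map_neg, map_smul, LinearMap.neg_apply, LinearMap.smul_apply, smul_eq_mul] at this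
  have h2 : (μ + ν) * killingForm ℝ L x y = 0 := by
    simp only [killingForm]
    linarith
  exact (mul_eq_zero.1 h2).resolve_left h

/-- Heights at least `1 - i` and at least `i` have a positive sum, which gives one direction.
Conversely, the component of `x` of height below `1 - i`, hence at most `-i`, is orthogonal to `fil
i` by assumption and to the spaces of height below `i` because the heights have a negative sum;
nondegeneracy makes it zero. -/
theorem mem_fil_iff_killingForm [LieAlgebra.IsKilling ℝ L] (i : ℤ) (x : L) :
    x ∈ D.fil (1 - i) ↔ ∀ y ∈ D.fil i, killingForm ℝ L x y = 0 := by
  have key : ∀ x ∈ D.fil (1 - i), ∀ y ∈ D.fil i, killingForm ℝ L x y = 0 := by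
    intro x hx y hy
    have h1 : ∀ c : Fin D.r → ℤ, 1 - i ≤ ∑ j ∈ D.Sp, c j → ∀ x ∈ D.space c,
        killingForm ℝ L x y = 0 := by
      intro c hc x hx
      have : D.fil i ≤ LinearMap.ker (killingForm ℝ L x) := by
        rw [fil_eq_iSup_space]
        refine iSup₂_le fun d hd y hy => ?_
        refine D.killingForm_graded ?_ (D.space_le_graded c hx) (D.space_le_graded d hy)
        norm_cast
        omega
      exact this hy
    have : D.fil (1 - i) ≤ LinearMap.ker ((killingForm ℝ L).flip y) := by
      rw [fil_eq_iSup_space]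
      exact iSup₂_le fun c hc x hx => h1 c hc x hx
    exact this hx
  refine ⟨key x, fun h => ?_⟩
  have htop : D.fil (1 - i) ⊔ ⨆ (c : Fin D.r → ℤ) (_ : ∑ j ∈ D.Sp, c j < 1 - i), D.space c = ⊤ := by
    rw [← top_le_iff, ← D.iSup_space]
    refine iSup_le fun c => ?_
    by_cases hc : ∑ j ∈ D.Sp, c j < 1 - i
    · exact le_sup_of_le_right (le_iSup₂_of_le c hc le_rfl)
    · refine le_sup_of_le_left ?_
      rw [fil_eq_iSup_space]
      exact le_iSup₂_of_le c (not_lt.1 hc) le_rfl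
  obtain ⟨x₁, hx₁, x₂, hx₂, rfl⟩ := Submodule.mem_sup.1 (htop.ge (Submodule.mem_top (x := x)))
  suffices x₂ = 0 by rw [this, add_zero]; exact hx₁
  have h2 : ∀ y ∈ D.fil i, killingForm ℝ L x₂ y = 0 := by
    intro y hy
    have := h y hy
    rwa [map_add, LinearMap.add_apply, key x₁ hx₁ y hy, zero_add] at this
  have h3 : ∀ y, killingForm ℝ L x₂ y = 0 := by
    intro y
    have : (⊤ : Submodule ℝ L) ≤ LinearMap.ker (killingForm ℝ L x₂) := by
      rw [← D.iSup_space]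
      refine iSup_le fun d y hy => ?_
      by_cases hd : i ≤ ∑ j ∈ D.Sp, d j
      · refine h2 y ?_
        rw [fil_eq_iSup_space]
        exact Submodule.mem_iSup_of_mem d (Submodule.mem_iSup_of_mem hd hy)
      have : (⨆ (c : Fin D.r → ℤ) (_ : ∑ j ∈ D.Sp, c j < 1 - i), D.space c) ≤
          LinearMap.ker ((killingForm ℝ L).flip y) := by
        refine iSup₂_le fun c hc x hx => ?_
        refine D.killingForm_graded ?_ (D.space_le_graded c hx) (D.space_le_graded d hy)
        norm_cast
        omega
      exact this hx₂
    exact this Submodule.mem_top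
  have hnd := LieAlgebra.IsKilling.ker_killingForm_eq_bot ℝ L
  have : x₂ ∈ LinearMap.ker (killingForm ℝ L) := LinearMap.ext h3
  rw [hnd] at this
  exact this

/-- Automorphisms preserve the Killing form, hence also annihilators of invariant subspaces. -/
theorem map_fil_one_sub [LieAlgebra.IsKilling ℝ L] (φ : L ≃ₗ⁅ℝ⁆ L) {i : ℤ}
    (h : (D.fil i).map (φ : L →ₗ[ℝ] L) = D.fil i) :
    (D.fil (1 - i)).map (φ : L →ₗ[ℝ] L) = D.fil (1 - i) := by
  refine Submodule.eq_of_le_of_finrank_eq ?_ ?_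
  · rintro _ ⟨x, hx, rfl⟩
    rw [mem_fil_iff_killingForm]
    intro y hy
    rw [← h] at hy
    obtain ⟨z, hz, rfl⟩ := hy
    exact (LieAlgebra.killingForm_of_equiv_apply φ x z).trans ((D.mem_fil_iff_killingForm i x).1 hx z hz)
  · exact LinearEquiv.finrank_map_eq φ.toLinearEquiv _

end Killing

end NestedParabolics

/-! ### Automorphisms preserving `𝔭` preserve the filtration -/

namespace NestedParabolics

open Module.End

variable {L : Type*} [LieRing L] [LieAlgebra ℝ L] [FiniteDimensional ℝ L]
  (D : NestedParabolics L)

theorem le_graded_zero : D.𝔞 ≤ D.graded 0 := by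
  intro h hh
  rw [mem_graded, zero_smul]
  exact D.maximal.prop.1 _ D.gradingElement.2 _ hh

/-- A diagonalizable element that commutes with `𝔞` lies in `𝔞`. -/
theorem mem_of_commute_of_diagonalizable {e : L} (hc : ∀ h ∈ D.𝔞, ⁅e, h⁆ = 0)
    (hd : ⨆ μ : ℝ, eigenspace (LieAlgebra.ad ℝ L e) μ = ⊤) : e ∈ D.𝔞 := by
  have hc' : ∀ h ∈ D.𝔞, ⁅h, e⁆ = 0 := fun h hh => by rw [← lie_skew, hc h hh, neg_zero]
  have key : IsSplitToral (D.𝔞 ⊔ Submodule.span ℝ {e}) := by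
    constructor
    · intro x hx y hy
      obtain ⟨x₁, hx₁, x₂, hx₂, rfl⟩ := Submodule.mem_sup.1 hx
      obtain ⟨y₁, hy₁, y₂, hy₂, rfl⟩ := Submodule.mem_sup.1 hy
      obtain ⟨s, rfl⟩ := Submodule.mem_span_singleton.1 hx₂
      obtain ⟨t, rfl⟩ := Submodule.mem_span_singleton.1 hy₂
      simp [D.maximal.prop.1 _ hx₁ _ hy₁, hc _ hy₁, hc' _ hx₁]
    · intro x hx
      obtain ⟨x₁, hx₁, x₂, hx₂, rfl⟩ := Submodule.mem_sup.1 hx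
      obtain ⟨s, rfl⟩ := Submodule.mem_span_singleton.1 hx₂
      rw [map_add, map_smul]
      refine iSup_eigenspace_add_smul_eq_top (D.maximal.prop.2 x₁ hx₁) hd (fun z => ?_) s
      change ⁅x₁, ⁅e, z⁆⁆ = ⁅e, ⁅x₁, z⁆⁆
      rw [leibniz_lie, hc' _ hx₁, zero_lie, zero_add]
  exact D.maximal.le_of_ge key le_sup_left
    (Submodule.mem_sup_right (Submodule.mem_span_singleton_self e))

section Perturbation

variable {D} {e n : L} (he : e ∈ D.graded 0) (hn : n ∈ D.fil 1)
include he hn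

/-- The leading component of an eigenvector of `e + n` is an eigenvector of `e`. -/
theorem exists_leading_eigenvector {m : ℤ} {x : L} (hx : x ∈ D.fil m) {μ : ℝ}
    (hμ : ⁅e + n, x⁆ = μ • x) :
    ∃ a ∈ D.graded m, ⁅e, a⁆ = μ • a ∧ x - a ∈ D.fil (m + 1) := by
  rw [fil_eq_sup] at hx
  obtain ⟨a, ha, b, hb, rfl⟩ := Submodule.mem_sup.1 hx
  refine ⟨a, ha, ?_, by simpa using hb⟩
  rw [← sub_eq_zero]
  have h1 : ⁅e, a⁆ - μ • a ∈ D.graded m := by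
    refine sub_mem ?_ (Submodule.smul_mem _ _ ha)
    simpa using D.lie_mem_graded he ha
  have hen : e + n ∈ D.fil 0 :=
    add_mem (D.graded_le_fil (by simp) he) (D.fil_antitone (by omega) hn)
  have h2 : ⁅e, a⁆ - μ • a ∈ D.fil (m + 1) := by
    have : ⁅e, a⁆ - μ • a = μ • b - ⁅n, a⁆ - ⁅e + n, b⁆ := by
      rw [lie_add, smul_add, add_lie e n a] at hμ
      have : ⁅e, a⁆ = μ • a + μ • b - ⁅e + n, b⁆ - ⁅n, a⁆ := by rw [← hμ]; abel
      rw [this]; abel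
    rw [this]
    refine sub_mem (sub_mem (Submodule.smul_mem _ _ hb) ?_) ?_
    · exact D.lie_mem_fil_of_le (by omega) hn (D.graded_le_fil le_rfl ha)
    · exact D.lie_mem_fil_of_le (by omega) hen hb
  exact (Submodule.disjoint_def.1 (D.disjoint_graded_fil (lt_add_one m))) _ h1 h2

/-- Since `e + n ∈ fil 0`, its adjoint action preserves `fil m`, and a diagonalizable operator is
diagonalizable on invariant subspaces. -/
theorem fil_eq_iSup_inf_eigenspace
    (hd : ⨆ μ : ℝ, eigenspace (LieAlgebra.ad ℝ L (e + n)) μ = ⊤) (m : ℤ) :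
    D.fil m = ⨆ μ : ℝ, D.fil m ⊓ eigenspace (LieAlgebra.ad ℝ L (e + n)) μ := by
  refine eq_iSup_inf_eigenspace hd fun x hx => ?_
  refine D.lie_mem_fil_of_le (i := 0) (by omega) ?_ hx
  exact add_mem (D.graded_le_fil (by simp) he) (D.fil_antitone (by omega) hn)

/-- If all eigenvalues of the diagonalizable `ad (e + n)` on `fil m` belong to `S`, then `fil m` is
a sum of eigenspaces of `ad e` with eigenvalues in `S`. -/
theorem fil_le_iSup_eigenspace
    (hd : ⨆ μ : ℝ, eigenspace (LieAlgebra.ad ℝ L (e + n)) μ = ⊤) {m : ℤ} {S : Set ℝ}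
    (hS : ∀ μ, ∀ x ∈ D.fil m, x ≠ 0 → ⁅e + n, x⁆ = μ • x → μ ∈ S) :
    D.fil m ≤ ⨆ μ ∈ S, eigenspace (LieAlgebra.ad ℝ L e) μ := by
  obtain ⟨N, hN⟩ := D.exists_fil_eq_bot
  -- Descending induction from the degree `N` in which the filtration vanishes. An eigenvector of `e
  -- + n` is its leading component, an eigenvector of `e` for the same eigenvalue, plus a term of
  -- higher degree.
  suffices ∀ k : ℕ, ∀ i : ℤ, m ≤ i → N - k ≤ i →
      D.fil i ≤ ⨆ μ ∈ S, eigenspace (LieAlgebra.ad ℝ L e) μ from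
    this (N - m).toNat m le_rfl (by omega)
  intro k
  induction k with
  | zero => intro i _ hi; rw [hN i (by simpa using hi)]; exact bot_le
  | succ k ih =>
    intro i hm hi
    have ih' := ih (i + 1) (by omega) (by push_cast at hi ⊢; omega)
    rw [fil_eq_iSup_inf_eigenspace he hn hd]
    refine iSup_le fun μ => ?_
    rintro x ⟨hx, hx'⟩
    have hx' : ⁅e + n, x⁆ = μ • x := mem_eigenspace_iff.1 hx'
    by_cases hx0 : x = 0
    · rw [hx0]; exact zero_mem _
    obtain ⟨a, -, ha, hxa⟩ := exists_leading_eigenvector he hn hx hx'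
    have hμ := hS μ x (D.fil_antitone hm hx) hx0 hx'
    rw [← sub_add_cancel x a]
    exact add_mem (ih' hxa) (Submodule.mem_iSup_of_mem μ (Submodule.mem_iSup_of_mem hμ
      (mem_eigenspace_iff.2 ha)))

end Perturbation

theorem mem_graded_of_space (h : D.𝔞) (c : Fin D.r → ℤ) {x : L} (hx : x ∈ D.space c) :
    ⁅(h : L), x⁆ = (∑ j, (c j : ℝ) * D.simple j h) • x := by
  rw [← sum_smul_simple_apply]
  exact hx h

theorem simple_space (j : Fin D.r) : D.space (Pi.single j 1) = rootSpace D.𝔞 (D.simple j) := by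
  classical
  unfold space
  congr 1
  rw [Finset.sum_eq_single j]
  · simp
  · intro b _ hb; simp [hb]
  · simp

/-- The filtration `fil` is determined by the parabolic subalgebra `𝔭`. -/
theorem map_fil_of_map_fil_zero [LieAlgebra.IsKilling ℝ L] (φ : L ≃ₗ⁅ℝ⁆ L)
    (h : (D.fil 0).map (φ : L →ₗ[ℝ] L) = D.fil 0) (i : ℤ) :
    (D.fil i).map (φ : L →ₗ[ℝ] L) = D.fil i := by
  classical
  -- `fil 1` is the Killing annihilator of `fil 0`.
  have h1 : (D.fil 1).map (φ : L →ₗ[ℝ] L) = D.fil 1 := by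
    simpa using D.map_fil_one_sub φ h
  set E : L := (D.gradingElement : L) with hE
  have hEf : E ∈ D.fil 0 := D.graded_le_fil (by simp) (D.le_graded_zero D.gradingElement.2)
  have hE' : φ E ∈ D.fil 0 := h ▸ Submodule.mem_map_of_mem hEf
  rw [fil_eq_sup] at hE'
  -- The image `φ E` of the grading element is split into its part `e` of degree zero and a
  -- nilradical part `n`. The aim is to locate `e` in `𝔞` and to bound the values of the simple
  -- roots on it.
  obtain ⟨e, he, n, hn, hen⟩ := Submodule.mem_sup.1 hE'
  have he : e ∈ D.graded 0 := by simpa using he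
  have hn : n ∈ D.fil 1 := by simpa using hn
  -- eigenvectors of `ad (φ E)`
  have heig : ∀ μ : ℝ, ∀ x, ⁅e + n, φ x⁆ = μ • φ x ↔ x ∈ D.graded μ := by
    intro μ x
    rw [hen, ← LieEquiv.map_lie, ← map_smul, mem_graded]
    exact φ.injective.eq_iff
  have hdiag : ⨆ μ : ℝ, eigenspace (LieAlgebra.ad ℝ L (e + n)) μ = ⊤ := by
    have : (⊤ : Submodule ℝ L) = (⊤ : Submodule ℝ L).map (φ : L →ₗ[ℝ] L) := by
      rw [Submodule.map_top]; exact (LinearMap.range_eq_top.2 φ.surjective).symm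
    rw [← top_le_iff, this, ← D.iSup_graded, Submodule.map_iSup]
    refine iSup_mono fun μ => ?_
    rintro _ ⟨x, hx, rfl⟩
    exact mem_eigenspace_iff.2 ((heig μ x).2 hx)
  -- `e` is central in the centralizer of the grading element
  have hcen : ∀ y ∈ D.graded 0, ⁅e, y⁆ = 0 := by
    intro y hy
    have hy0 : y ∈ D.fil 0 := D.graded_le_fil (by simp) hy
    rw [← h] at hy0
    obtain ⟨z, hz, rfl⟩ := hy0
    -- `ad E` maps `fil 0` to `fil 1`; applying `φ`, so does `ad (e + n)`, and hence `ad e`. But `ad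
    -- e` preserves degree.
    have hz1 : ⁅E, z⁆ ∈ D.fil 1 := by
      rw [SetLike.mem_coe, fil_eq_sup] at hz
      obtain ⟨a, ha, b, hb, rfl⟩ := Submodule.mem_sup.1 hz
      rw [Int.cast_zero] at ha
      rw [lie_add, D.mem_graded.1 ha, zero_smul, zero_add]
      exact D.lie_mem_fil_of_le (by omega) hEf hb
    have h2 : ⁅φ E, φ z⁆ ∈ D.fil 1 := by
      rw [← LieEquiv.map_lie, ← h1]; exact Submodule.mem_map_of_mem hz1
    rw [← hen, add_lie] at h2
    have h3 : ⁅e, φ z⁆ ∈ D.fil 1 := by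
      have h4 : ⁅n, φ z⁆ ∈ D.fil 1 := by
        refine D.lie_mem_fil_of_le (j := 0) (by omega) hn ?_
        rw [← h]; exact Submodule.mem_map_of_mem hz
      simpa using sub_mem h2 h4
    refine (Submodule.disjoint_def.1 (D.disjoint_graded_fil (zero_lt_one))) _ ?_ h3
    simpa using D.lie_mem_graded he hy
  have hediag : ⨆ μ : ℝ, eigenspace (LieAlgebra.ad ℝ L e) μ = ⊤ := by
    obtain ⟨N, hN⟩ := D.exists_fil_eq_top
    -- In degree `-N` the filtration is everything, and no restriction on the eigenvalues is needed.
    have := fil_le_iSup_eigenspace he hn hdiag (m := -N) (S := Set.univ) (by simp)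
    rw [hN _ le_rfl, top_le_iff] at this
    simpa using this
  -- Here maximality of `𝔞` enters: `e` commutes with `𝔞 ≤ graded 0` and is diagonalizable. From now
  -- on roots can be evaluated on `e`.
  have hea : e ∈ D.𝔞 := D.mem_of_commute_of_diagonalizable
    (fun y hy => hcen y (D.le_graded_zero hy)) hediag
  -- eigenvalues of `ad (φ E)` on `fil 1`
  have hone : ∀ μ, ∀ x ∈ D.fil 1, x ≠ 0 → ⁅e + n, x⁆ = μ • x → μ ∈ Set.Ici (1 : ℝ) := by
    intro μ x hx hx0 hμ
    rw [← h1] at hx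
    obtain ⟨z, hz, rfl⟩ := hx
    have hz' : z ∈ D.graded μ := (heig μ z).1 hμ
    have hz0 : z ≠ 0 := by rintro rfl; exact hx0 (map_zero _)
    rw [SetLike.mem_coe, fil_eq] at hz
    simpa using eigenvalue_mem_of_mem_iSup hz' hz0 hz
  have hle1 := fil_le_iSup_eigenspace he hn hdiag hone
  have hroot : ∀ j, ∃ x ∈ D.space (Pi.single j 1), x ≠ 0 ∧
      ⁅e, x⁆ = D.simple j ⟨e, hea⟩ • x := by
    intro j
    obtain ⟨x, hx, hx0⟩ := Submodule.exists_mem_ne_zero_of_ne_bot (D.simple_isRoot j).2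
    exact ⟨x, D.simple_space j ▸ hx, hx0, hx ⟨e, hea⟩⟩
  -- Such a root space lies in `graded 0`, where `ad e` vanishes.
  have hnot : ∀ j ∉ D.Sp, D.simple j ⟨e, hea⟩ = 0 := by
    intro j hj
    obtain ⟨x, hx, hx0, hex⟩ := hroot j
    have := D.space_le_graded _ hx
    rw [Finset.sum_pi_single', if_neg hj, Int.cast_zero] at this
    rw [hcen x this] at hex
    exact (smul_eq_zero.1 hex.symm).resolve_right hx0
  -- Such a root space lies in `fil 1`, where the eigenvalues of `ad e` are among those of `ad (e +
  -- n)` and hence at least `1`.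
  have hin : ∀ j ∈ D.Sp, 1 ≤ D.simple j ⟨e, hea⟩ := by
    intro j hj
    obtain ⟨x, hx, hx0, hex⟩ := hroot j
    have := D.space_le_graded _ hx
    rw [Finset.sum_pi_single', if_pos hj] at this
    exact eigenvalue_mem_of_mem_iSup (mem_eigenspace_iff.2 hex) hx0
      (hle1 (D.graded_le_fil le_rfl this))
  -- eigenvalues of `ad e` on `graded d`
  have heval : ∀ d : ℤ, 1 ≤ d → ∀ a ∈ D.graded d, a ≠ 0 → ∀ μ : ℝ, ⁅e, a⁆ = μ • a → d ≤ μ := by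
    intro d hd a ha ha0 μ hμ
    refine eigenvalue_mem_of_mem_iSup (f := LieAlgebra.ad ℝ L e)
      (S := Set.Ici (d : ℝ)) (mem_eigenspace_iff.2 hμ) ha0 ?_
    have : D.graded d ≤ ⨆ ν ∈ Set.Ici (d : ℝ), eigenspace (LieAlgebra.ad ℝ L e) ν := by
      rw [graded_eq]
      refine iSup₂_le fun c hc => ?_
      by_cases hbot : D.space c = ⊥
      · exact hbot.le.trans bot_le
      have hc : ∑ j ∈ D.Sp, c j = d := Int.cast_injective hc
      -- The coefficients of a root have one sign, and the height `d` is positive.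
      have hpos : ∀ j, 0 ≤ c j := by
        rcases D.nonneg_or_nonpos_of_space_ne_bot hbot with h | h
        · exact h
        · have := Finset.sum_nonpos (s := D.Sp) (fun j _ => h j)
          omega
      refine le_iSup₂_of_le (∑ j, (c j : ℝ) * D.simple j ⟨e, hea⟩) ?_ fun x hx =>
        mem_eigenspace_iff.2 (D.mem_graded_of_space ⟨e, hea⟩ c hx)
      rw [Set.mem_Ici, ← hc, Int.cast_sum]
      calc ∑ j ∈ D.Sp, (c j : ℝ) ≤ ∑ j ∈ D.Sp, (c j : ℝ) * D.simple j ⟨e, hea⟩ := by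
            refine Finset.sum_le_sum fun j hj => ?_
            have h0 : (0 : ℝ) ≤ c j := by exact_mod_cast hpos j
            nlinarith [hin j hj]
        _ = _ := by
            refine Finset.sum_subset (Finset.subset_univ _) fun j _ hj => ?_
            rw [hnot j hj, mul_zero]
    exact this ha
  have hpos : ∀ m : ℤ, 1 ≤ m → (D.fil m).map (φ : L →ₗ[ℝ] L) = D.fil m := by
    intro m hm
    symm
    -- By dimension it is enough that every eigenvector of `ad (φ E)` in `fil m` is the image of an
    -- eigenvector of `ad E` with eigenvalue at least `m`.
    refine Submodule.eq_of_le_of_finrank_eq ?_ (LinearEquiv.finrank_map_eq φ.toLinearEquiv _).symm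
    refine (fil_eq_iSup_inf_eigenspace he hn hdiag m).le.trans (iSup_le fun μ => ?_)
    rintro x ⟨hx, hμ⟩
    have hμ : ⁅e + n, x⁆ = μ • x := mem_eigenspace_iff.1 hμ
    obtain ⟨z, rfl⟩ := φ.surjective x
    refine Submodule.mem_map_of_mem ?_
    have hz := (heig μ z).1 hμ
    by_cases hmμ : (m : ℝ) ≤ μ
    · exact D.graded_le_fil hmμ hz
    -- If `μ < m`, then a leading component in degree `m + k` would have an eigenvalue of `ad e` of
    -- size at least `m + k`; so it vanishes, and the vector moves up the filtration until it is
    -- zero.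
    have hall : ∀ k : ℕ, φ z ∈ D.fil (m + k) := by
      intro k
      induction k with
      | zero => simpa using hx
      | succ k ih =>
        obtain ⟨a, ha, hea', hza⟩ := exists_leading_eigenvector he hn ih hμ
        have : a = 0 := by
          by_contra ha0
          have := heval _ (by omega) a ha ha0 μ hea'
          push_cast at this
          have : (0 : ℝ) ≤ k := k.cast_nonneg
          linarith
        rw [this, sub_zero] at hza
        push_cast
        rwa [← add_assoc]
    obtain ⟨N, hN⟩ := D.exists_fil_eq_bot
    have := hall (N - m).toNat
    rw [hN _ (by omega), Submodule.mem_bot] at this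
    have : z = 0 := φ.injective (this.trans (map_zero φ).symm)
    rw [this]; exact zero_mem _
  rcases lt_trichotomy i 0 with hi | rfl | hi
  -- For negative `i` the degree `1 - i` is positive, and Killing duality carries the result back.
  · have := D.map_fil_one_sub φ (hpos (1 - i) (by omega))
    simpa using this
  · exact h
  · exact hpos i hi

end NestedParabolics

/-! ### Derivatives and brackets of vector fields in charts -/

theorem two_le_infty : (2 : WithTop ℕ∞) ≤ ∞ := ENat.LEInfty.out

/-- The two terms containing second derivatives of `Φ` cancel by symmetry. -/
theorem fderiv_lieBracket {E W : Type*} [NormedAddCommGroup E] [NormedSpace ℝ E]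
    [NormedAddCommGroup W] [NormedSpace ℝ W] {Φ : E → W} {v w : E → E} {a : E}
    (hΦ : ContDiffAt ℝ ∞ Φ a) (hv : DifferentiableAt ℝ v a) (hw : DifferentiableAt ℝ w a) :
    fderiv ℝ Φ a (VectorField.lieBracket ℝ v w a) =
      fderiv ℝ (fun b => fderiv ℝ Φ b (w b)) a (v a) -
      fderiv ℝ (fun b => fderiv ℝ Φ b (v b)) a (w a) := by
  have hsymm := hΦ.isSymmSndFDerivAt (by
    rw [minSmoothness_of_isRCLikeNormedField]; exact two_le_infty)
  have hd : DifferentiableAt ℝ (fderiv ℝ Φ) a :=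
    (hΦ.fderiv_right (m := ∞) (by norm_num)).differentiableAt (by norm_num)
  rw [VectorField.lieBracket_eq, fderiv_clm_apply hd hv, fderiv_clm_apply hd hw]
  simp only [add_apply, ContinuousLinearMap.comp_apply, ContinuousLinearMap.flip_apply, map_sub]
  rw [hsymm.eq (v a) (w a)]
  abel

section Charts

variable {E : Type*} [NormedAddCommGroup E] [NormedSpace ℝ E]
  {M : Type*} [TopologicalSpace M] [ChartedSpace E M] [IsManifold 𝓘(ℝ, E) ∞ M]
  {W : Type*} [NormedAddCommGroup W] [NormedSpace ℝ W]

theorem isManifold_one : IsManifold 𝓘(ℝ, E) 1 M := .of_le (n := ∞) (by norm_num)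

theorem isManifold_two : IsManifold 𝓘(ℝ, E) 2 M := .of_le (n := ∞) two_le_infty

/-- The coordinates of tangent vectors in the chart at `x₀`. -/
noncomputable def chartCoord (x₀ y : M) : TangentSpace 𝓘(ℝ, E) y →L[ℝ] E :=
  mfderiv 𝓘(ℝ, E) 𝓘(ℝ, E) (extChartAt 𝓘(ℝ, E) x₀) y

/-- The derivative of a vector-valued function. -/
noncomputable def vd (F : M → W) (y : M) : TangentSpace 𝓘(ℝ, E) y →L[ℝ] W :=
  mfderiv 𝓘(ℝ, E) 𝓘(ℝ, W) F y

/-- A tangent vector at `x` is represented by its coordinates in the preferred chart at `x`, so at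
the base point chart computations need no translation. -/
theorem chartCoord_self (x : M) (v : TangentSpace 𝓘(ℝ, E) x) : chartCoord x x v = v := by
  have := isManifold_one (E := E) (M := M)
  have h := mfderiv_chartAt_eq_tangentCoordChange (I := 𝓘(ℝ, E)) (mem_chart_source E x)
  have h2 := tangentCoordChange_self (I := 𝓘(ℝ, E)) (v := v) (mem_extChartAt_source (I := 𝓘(ℝ, E)) x)
  have h3 := DFunLike.congr_fun h v
  exact h3.trans h2

theorem chartCoord_isInvertible {x₀ y : M} (hy : y ∈ (chartAt E x₀).source) :
    (chartCoord (E := E) x₀ y).IsInvertible := by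
  have := isManifold_one (E := E) (M := M)
  exact isInvertible_mfderiv_extChartAt (by simpa using hy)

theorem chartCoord_bijective {x₀ y : M} (hy : y ∈ (chartAt E x₀).source) :
    Function.Bijective (chartCoord (E := E) x₀ y) := by
  obtain ⟨e, he⟩ := chartCoord_isInvertible hy
  rw [← he]
  exact e.bijective

theorem vd_eq_fderiv {F : M → W} {x₀ y : M} (hy : y ∈ (chartAt E x₀).source)
    (hF : MDifferentiableAt 𝓘(ℝ, E) 𝓘(ℝ, W) F y) (v : TangentSpace 𝓘(ℝ, E) y) :
    vd F y v = fderiv ℝ (F ∘ (extChartAt 𝓘(ℝ, E) x₀).symm) (extChartAt 𝓘(ℝ, E) x₀ y)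
      (chartCoord x₀ y v) := by
  have := isManifold_one (E := E) (M := M)
  have hy' : y ∈ (extChartAt 𝓘(ℝ, E) x₀).source := by simpa using hy
  have hmem := (extChartAt 𝓘(ℝ, E) x₀).map_source hy'
  have hs : MDifferentiableAt 𝓘(ℝ, E) 𝓘(ℝ, E) (extChartAt 𝓘(ℝ, E) x₀).symm
      (extChartAt 𝓘(ℝ, E) x₀ y) := by
    have := mdifferentiableWithinAt_extChartAt_symm hmem
    rw [modelWithCornersSelf_coe, Set.range_id] at this
    exact mdifferentiableWithinAt_univ.1 this
  have hc : MDifferentiableAt 𝓘(ℝ, E) 𝓘(ℝ, W) (F ∘ (extChartAt 𝓘(ℝ, E) x₀).symm)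
      (extChartAt 𝓘(ℝ, E) x₀ y) := by
    refine MDifferentiableAt.comp _ ?_ hs
    rwa [(extChartAt 𝓘(ℝ, E) x₀).left_inv hy']
  have key : mfderiv 𝓘(ℝ, E) 𝓘(ℝ, W)
      ((F ∘ (extChartAt 𝓘(ℝ, E) x₀).symm) ∘ extChartAt 𝓘(ℝ, E) x₀) y =
      (mfderiv 𝓘(ℝ, E) 𝓘(ℝ, W) (F ∘ (extChartAt 𝓘(ℝ, E) x₀).symm)
        (extChartAt 𝓘(ℝ, E) x₀ y)).comp (mfderiv 𝓘(ℝ, E) 𝓘(ℝ, E) (extChartAt 𝓘(ℝ, E) x₀) y) :=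
    mfderiv_comp y hc (mdifferentiableAt_extChartAt hy)
  have heq : ((F ∘ (extChartAt 𝓘(ℝ, E) x₀).symm) ∘ extChartAt 𝓘(ℝ, E) x₀) =ᶠ[𝓝 y] F := by
    filter_upwards [extChartAt_source_mem_nhds' hy'] with z hz
    exact congrArg F ((extChartAt 𝓘(ℝ, E) x₀).left_inv hz)
  have h1 := heq.mfderiv_eq (I := 𝓘(ℝ, E)) (I' := 𝓘(ℝ, W))
  rw [key, mfderiv_eq_fderiv] at h1
  exact (DFunLike.congr_fun h1 v).symm

theorem vd_eq_fderiv_self {F : M → W} {x : M}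
    (hF : MDifferentiableAt 𝓘(ℝ, E) 𝓘(ℝ, W) F x) (v : TangentSpace 𝓘(ℝ, E) x) :
    vd F x v = fderiv ℝ (F ∘ (extChartAt 𝓘(ℝ, E) x).symm) (extChartAt 𝓘(ℝ, E) x x) v := by
  rw [vd_eq_fderiv (mem_chart_source E x) hF, chartCoord_self]

theorem contDiffAt_comp_extChartAt_symm {F : M → W} {x₀ y : M}
    (hy : y ∈ (chartAt E x₀).source) (hF : ContMDiffAt 𝓘(ℝ, E) 𝓘(ℝ, W) ∞ F y) :
    ContDiffAt ℝ ∞ (F ∘ (extChartAt 𝓘(ℝ, E) x₀).symm) (extChartAt 𝓘(ℝ, E) x₀ y) := by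
  have hy' : y ∈ (extChartAt 𝓘(ℝ, E) x₀).source := by simpa using hy
  have hmem := (extChartAt 𝓘(ℝ, E) x₀).map_source hy'
  rw [← contMDiffAt_iff_contDiffAt]
  refine ContMDiffAt.comp (I' := 𝓘(ℝ, E)) _ ?_ ((contMDiffOn_extChartAt_symm (n := ∞) x₀).contMDiffAt
    (extChartAt_target_mem_nhds' hmem))
  rwa [(extChartAt 𝓘(ℝ, E) x₀).left_inv hy']

/-- The coordinate expression of a vector field in the chart at `x₀`. -/
noncomputable def chartField (x₀ : M) (V : ∀ y : M, TangentSpace 𝓘(ℝ, E) y) (a : E) : E :=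
  chartCoord x₀ ((extChartAt 𝓘(ℝ, E) x₀).symm a) (V ((extChartAt 𝓘(ℝ, E) x₀).symm a))

open VectorField in
theorem mpullbackWithin_extChartAt_symm {x₀ : M} {a : E} (V : ∀ y : M, TangentSpace 𝓘(ℝ, E) y)
    (ha : a ∈ (extChartAt 𝓘(ℝ, E) x₀).target) :
    mpullbackWithin 𝓘(ℝ, E) 𝓘(ℝ, E) (extChartAt 𝓘(ℝ, E) x₀).symm V
      (Set.range 𝓘(ℝ, E)) a = chartField x₀ V a := by
  have := isManifold_one (E := E) (M := M)
  rw [mpullbackWithin_apply, ContinuousLinearMap.inverse_eq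
    (mfderivWithin_extChartAt_symm_comp_mfderiv_extChartAt ha)
    (mfderiv_extChartAt_comp_mfderivWithin_extChartAt_symm ha)]
  rfl

theorem eventually_mem_extChartAt_target (x : M) :
    ∀ᶠ a in 𝓝 (extChartAt 𝓘(ℝ, E) x x), a ∈ (extChartAt 𝓘(ℝ, E) x).target :=
  extChartAt_target_mem_nhds x

theorem chartField_self (x : M) (V : ∀ y : M, TangentSpace 𝓘(ℝ, E) y) :
    chartField x V (extChartAt 𝓘(ℝ, E) x x) = V x := by
  unfold chartField
  rw [extChartAt_to_inv, chartCoord_self]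

open VectorField in
theorem differentiableAt_chartField [CompleteSpace E] {x : M}
    {V : ∀ y : M, TangentSpace 𝓘(ℝ, E) y}
    (hV : MDifferentiableAt 𝓘(ℝ, E) 𝓘(ℝ, E).tangent
      (fun y => (⟨y, V y⟩ : TangentBundle 𝓘(ℝ, E) M)) x) :
    DifferentiableAt ℝ (chartField x V) (extChartAt 𝓘(ℝ, E) x x) := by
  have := isManifold_one (E := E) (M := M)
  have := isManifold_two (E := E) (M := M)
  have := (hV.mdifferentiableWithinAt
    (s := Set.univ)).differentiableWithinAt_mpullbackWithin_vectorField
  rw [Set.preimage_univ, Set.univ_inter, modelWithCornersSelf_coe, Set.range_id] at this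
  have h2 : DifferentiableAt ℝ (fun a => mpullbackWithin 𝓘(ℝ, E) 𝓘(ℝ, E)
      (extChartAt 𝓘(ℝ, E) x).symm V (Set.range 𝓘(ℝ, E)) a : E → E) (extChartAt 𝓘(ℝ, E) x x) := by
    rw [modelWithCornersSelf_coe, Set.range_id]
    exact differentiableWithinAt_univ.1 this
  refine h2.congr_of_eventuallyEq ?_
  filter_upwards [eventually_mem_extChartAt_target x] with a ha
  exact (mpullbackWithin_extChartAt_symm V ha).symm

open VectorField in
-- The bracket on a manifold is defined by pulling back to the chart at `x`, whose differential at
-- `x` is the identity.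
theorem mlieBracket_eq_lieBracket (x : M) (V V' : ∀ y : M, TangentSpace 𝓘(ℝ, E) y) :
    mlieBracket 𝓘(ℝ, E) V V' x =
      lieBracket ℝ (chartField x V) (chartField x V') (extChartAt 𝓘(ℝ, E) x x) := by
  rw [← mlieBracketWithin_univ, mlieBracketWithin_apply]
  have hinv : (mfderiv 𝓘(ℝ, E) 𝓘(ℝ, E) (extChartAt 𝓘(ℝ, E) x) x).inverse =
      ContinuousLinearMap.id ℝ E := by
    have : (mfderiv 𝓘(ℝ, E) 𝓘(ℝ, E) (extChartAt 𝓘(ℝ, E) x) x) = ContinuousLinearMap.id ℝ E :=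
      ContinuousLinearMap.ext (chartCoord_self x)
    rw [this]
    exact ContinuousLinearMap.inverse_id
  rw [hinv]
  have hev : ∀ V : ∀ y : M, TangentSpace 𝓘(ℝ, E) y,
      (fun a => mpullbackWithin 𝓘(ℝ, E) 𝓘(ℝ, E) (extChartAt 𝓘(ℝ, E) x).symm V
        (Set.range 𝓘(ℝ, E)) a : E → E) =ᶠ[𝓝 (extChartAt 𝓘(ℝ, E) x x)] chartField x V := by
    intro V
    filter_upwards [eventually_mem_extChartAt_target x] with a ha
    exact mpullbackWithin_extChartAt_symm V ha
  have huniv : (extChartAt 𝓘(ℝ, E) x).symm ⁻¹' Set.univ ∩ Set.range 𝓘(ℝ, E) = Set.univ := by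
    rw [Set.preimage_univ, Set.univ_inter, modelWithCornersSelf_coe, Set.range_id]
  rw [huniv, ← (hev V).lieBracket_vectorField_eq (hev V')]
  exact congrFun lieBracketWithin_univ (extChartAt 𝓘(ℝ, E) x x)

theorem vd_congr {F F' : M → W} {x : M} (h : F =ᶠ[𝓝 x] F') (v : TangentSpace 𝓘(ℝ, E) x) :
    vd F x v = vd F' x v := by
  unfold vd
  exact DFunLike.congr_fun (h.mfderiv_eq (I := 𝓘(ℝ, E)) (I' := 𝓘(ℝ, W))) v

theorem mdifferentiableAt_comp_extChartAt {x : M} {φ : E → W}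
    (hφ : DifferentiableAt ℝ φ (extChartAt 𝓘(ℝ, E) x x)) :
    MDifferentiableAt 𝓘(ℝ, E) 𝓘(ℝ, W) (fun y => φ (extChartAt 𝓘(ℝ, E) x y)) x := by
  have := isManifold_one (E := E) (M := M)
  exact MDifferentiableAt.comp (I' := 𝓘(ℝ, E)) x hφ.mdifferentiableAt
    (mdifferentiableAt_extChartAt (mem_chart_source E x))

theorem vd_comp_extChartAt {x : M} {φ : E → W}
    (hφ : DifferentiableAt ℝ φ (extChartAt 𝓘(ℝ, E) x x)) (v : TangentSpace 𝓘(ℝ, E) x) :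
    vd (fun y => φ (extChartAt 𝓘(ℝ, E) x y)) x v = fderiv ℝ φ (extChartAt 𝓘(ℝ, E) x x) v := by
  rw [vd_eq_fderiv_self (mdifferentiableAt_comp_extChartAt hφ)]
  have : ((fun y => φ (extChartAt 𝓘(ℝ, E) x y)) ∘ (extChartAt 𝓘(ℝ, E) x).symm)
      =ᶠ[𝓝 (extChartAt 𝓘(ℝ, E) x x)] φ := by
    filter_upwards [eventually_mem_extChartAt_target x] with a ha
    simp only [Function.comp_apply]
    rw [(extChartAt 𝓘(ℝ, E) x).right_inv ha]
  rw [this.fderiv_eq]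

theorem eventually_mdifferentiableAt {F : M → W} {x : M}
    (hF : ContMDiffAt 𝓘(ℝ, E) 𝓘(ℝ, W) ∞ F x) :
    ∀ᶠ y in 𝓝 x, MDifferentiableAt 𝓘(ℝ, E) 𝓘(ℝ, W) F y := by
  have := isManifold_one (E := E) (M := M)
  have h1 : ContMDiffAt 𝓘(ℝ, E) 𝓘(ℝ, W) 1 F x := hF.of_le (by norm_num)
  filter_upwards [(contMDiffAt_iff_contMDiffAt_nhds (by simp)).1 h1] with y hy
  exact hy.mdifferentiableAt (by norm_num)

/-- The derivative of a function along a vector field, in the chart at `x`. -/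
theorem vd_field_eventuallyEq {F : M → W} {x : M} (hF : ContMDiffAt 𝓘(ℝ, E) 𝓘(ℝ, W) ∞ F x)
    (V : ∀ y : M, TangentSpace 𝓘(ℝ, E) y) :
    (fun y => vd F y (V y)) =ᶠ[𝓝 x] fun y =>
      (fun a => fderiv ℝ (F ∘ (extChartAt 𝓘(ℝ, E) x).symm) a (chartField x V a))
        (extChartAt 𝓘(ℝ, E) x y) := by
  filter_upwards [eventually_mdifferentiableAt hF, chart_source_mem_nhds E x] with y hy hyx
  rw [vd_eq_fderiv hyx hy]
  simp only [chartField]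
  rw [(extChartAt 𝓘(ℝ, E) x).left_inv (by simpa using hyx)]

theorem differentiableAt_fderiv_chartField [CompleteSpace E] {F : M → W} {x : M}
    (hF : ContMDiffAt 𝓘(ℝ, E) 𝓘(ℝ, W) ∞ F x) {V : ∀ y : M, TangentSpace 𝓘(ℝ, E) y}
    (hV : MDifferentiableAt 𝓘(ℝ, E) 𝓘(ℝ, E).tangent
      (fun y => (⟨y, V y⟩ : TangentBundle 𝓘(ℝ, E) M)) x) :
    DifferentiableAt ℝ
      (fun a => fderiv ℝ (F ∘ (extChartAt 𝓘(ℝ, E) x).symm) a (chartField x V a))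
      (extChartAt 𝓘(ℝ, E) x x) := by
  have hF' := contDiffAt_comp_extChartAt_symm (mem_chart_source E x) hF
  exact ((hF'.fderiv_right (m := ∞) (by norm_num)).differentiableAt (by norm_num)).clm_apply
    (differentiableAt_chartField hV)

open VectorField in
/-- The bracket of vector fields, considered as derivations of functions, is a commutator. -/
theorem vd_mlieBracket [CompleteSpace E] {F : M → W} {x : M}
    (hF : ContMDiffAt 𝓘(ℝ, E) 𝓘(ℝ, W) ∞ F x)
    {V V' : ∀ y : M, TangentSpace 𝓘(ℝ, E) y}
    (hV : MDifferentiableAt 𝓘(ℝ, E) 𝓘(ℝ, E).tangent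
      (fun y => (⟨y, V y⟩ : TangentBundle 𝓘(ℝ, E) M)) x)
    (hV' : MDifferentiableAt 𝓘(ℝ, E) 𝓘(ℝ, E).tangent
      (fun y => (⟨y, V' y⟩ : TangentBundle 𝓘(ℝ, E) M)) x) :
    vd F x (mlieBracket 𝓘(ℝ, E) V V' x) =
      vd (fun y => vd F y (V' y)) x (V x) - vd (fun y => vd F y (V y)) x (V' x) := by
  have hF' : ContDiffAt ℝ ∞ (F ∘ (extChartAt 𝓘(ℝ, E) x).symm) (extChartAt 𝓘(ℝ, E) x x) :=
    contDiffAt_comp_extChartAt_symm (mem_chart_source E x) hF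
  have h1 := vd_eq_fderiv_self (hF.mdifferentiableAt (by norm_num)) (mlieBracket 𝓘(ℝ, E) V V' x)
  have h2 := fderiv_lieBracket hF' (differentiableAt_chartField hV)
    (differentiableAt_chartField hV')
  rw [chartField_self, chartField_self] at h2
  rw [h1, mlieBracket_eq_lieBracket, vd_congr (vd_field_eventuallyEq hF V'),
    vd_congr (vd_field_eventuallyEq hF V),
    vd_comp_extChartAt (differentiableAt_fderiv_chartField hF hV'),
    vd_comp_extChartAt (differentiableAt_fderiv_chartField hF hV)]
  exact h2

section Rules

variable {W' W'' : Type*} [NormedAddCommGroup W'] [NormedSpace ℝ W']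
  [NormedAddCommGroup W''] [NormedSpace ℝ W'']

theorem vd_comp {F : M → W} {x : M} {φ : W → W'} (hφ : DifferentiableAt ℝ φ (F x))
    (hF : MDifferentiableAt 𝓘(ℝ, E) 𝓘(ℝ, W) F x) (v : TangentSpace 𝓘(ℝ, E) x) :
    vd (fun y => φ (F y)) x v = fderiv ℝ φ (F x) (vd F x v) := by
  have := mfderiv_comp (I' := 𝓘(ℝ, W)) x hφ.mdifferentiableAt hF
  rw [mfderiv_eq_fderiv] at this
  exact DFunLike.congr_fun this v

theorem differentiableAt_comp_extChartAt_symm {F : M → W} {x : M}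
    (hF : MDifferentiableAt 𝓘(ℝ, E) 𝓘(ℝ, W) F x) :
    DifferentiableAt ℝ (F ∘ (extChartAt 𝓘(ℝ, E) x).symm) (extChartAt 𝓘(ℝ, E) x x) := by
  have := hF.differentiableWithinAt_writtenInExtChartAt
  rw [modelWithCornersSelf_coe, Set.range_id] at this
  exact differentiableWithinAt_univ.1 this

theorem vd_clm_apply {A : M → W →L[ℝ] W'} {F : M → W} {x : M}
    (hA : MDifferentiableAt 𝓘(ℝ, E) 𝓘(ℝ, W →L[ℝ] W') A x)
    (hF : MDifferentiableAt 𝓘(ℝ, E) 𝓘(ℝ, W) F x) (v : TangentSpace 𝓘(ℝ, E) x) :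
    vd (fun y => A y (F y)) x v = A x (vd F x v) + vd A x v (F x) := by
  have hAF : MDifferentiableAt 𝓘(ℝ, E) 𝓘(ℝ, W') (fun y => A y (F y)) x := hA.clm_apply hF
  rw [vd_eq_fderiv_self hAF, vd_eq_fderiv_self hA, vd_eq_fderiv_self hF]
  have := fderiv_clm_apply (differentiableAt_comp_extChartAt_symm hA)
    (differentiableAt_comp_extChartAt_symm hF)
  simp only [Function.comp_apply, extChartAt_to_inv] at this
  exact DFunLike.congr_fun this v

theorem vd_clm {F : M → W} {x : M} (φ : W →L[ℝ] W')
    (hF : MDifferentiableAt 𝓘(ℝ, E) 𝓘(ℝ, W) F x) (v : TangentSpace 𝓘(ℝ, E) x) :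
    vd (fun y => φ (F y)) x v = φ (vd F x v) := by
  rw [vd_comp φ.differentiableAt hF, φ.fderiv]

end Rules

end Charts

/-! ### The adjoint action by Lie algebra automorphisms -/

section AdjointAction

open VectorField

variable {EG : Type*} [NormedAddCommGroup EG] [NormedSpace ℝ EG] [FiniteDimensional ℝ EG]
  {G : Type*} [TopologicalSpace G] [ChartedSpace EG G] [Group G] [LieGroup 𝓘(ℝ, EG) ∞ G]

theorem chartCoord_of_eq {E : Type*} [NormedAddCommGroup E] [NormedSpace ℝ E]
    {M : Type*} [TopologicalSpace M] [ChartedSpace E M] [IsManifold 𝓘(ℝ, E) ∞ M]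
    {x y : M} (h : y = x) (v : TangentSpace 𝓘(ℝ, E) y) : (chartCoord x y v : E) = v := by
  subst h
  exact chartCoord_self y v

/-- Conjugation by `g`. -/
def conj (g h : G) : G := g * h * g⁻¹

theorem contMDiff_conj (g : G) : ContMDiff 𝓘(ℝ, EG) 𝓘(ℝ, EG) ∞ (conj g) :=
  (contMDiff_const.mul contMDiff_id).mul contMDiff_const

theorem conj_one (g : G) : conj g 1 = 1 := by simp [conj]

theorem mdifferentiableAt_conj (g h : G) :
    MDifferentiableAt 𝓘(ℝ, EG) 𝓘(ℝ, EG) (conj g) h :=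
  (contMDiff_conj g).contMDiffAt.mdifferentiableAt (by norm_num)

theorem Ad_apply (g : G) (v : Lie EG G) :
    (Ad g v : EG) = mfderiv 𝓘(ℝ, EG) 𝓘(ℝ, EG) (conj g) 1 v := rfl

theorem Ad_one (v : Lie EG G) : Ad (1 : G) v = v := by
  have h : (conj (1 : G)) = id := by ext x; simp [conj]
  have : (Ad (1 : G) v : EG) = v := by
    rw [Ad_apply, h, mfderiv_id]
    rfl
  exact this

theorem mfderiv_conj_conj (g h k : G) (v : TangentSpace 𝓘(ℝ, EG) k) :
    (mfderiv 𝓘(ℝ, EG) 𝓘(ℝ, EG) (conj (g * h)) k v : EG) =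
      mfderiv 𝓘(ℝ, EG) 𝓘(ℝ, EG) (conj g) (conj h k)
        (mfderiv 𝓘(ℝ, EG) 𝓘(ℝ, EG) (conj h) k v) := by
  have h1 : conj (g * h) = conj g ∘ conj h := by ext x; simp [conj, mul_assoc]
  rw [h1, mfderiv_comp (I' := 𝓘(ℝ, EG)) k (mdifferentiableAt_conj g _) (mdifferentiableAt_conj h _)]
  rfl

theorem Ad_mul (g h : G) (v : Lie EG G) : Ad (g * h) v = Ad g (Ad h v) := by
  have h2 := mfderiv_conj_conj g h 1 v
  -- Tangent spaces at propositionally equal points are different types with the same model space.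
  -- Comparing values in the model space allows the base point to be substituted; the same device
  -- recurs below.
  have h3 : ∀ y : G, y = 1 → ∀ w : EG, (mfderiv 𝓘(ℝ, EG) 𝓘(ℝ, EG) (conj g) y w : EG) =
      mfderiv 𝓘(ℝ, EG) 𝓘(ℝ, EG) (conj g) 1 w := by
    rintro y rfl w; rfl
  exact h2.trans (h3 _ (conj_one h) _)

theorem Ad_inv_Ad (g : G) (v : Lie EG G) : Ad g⁻¹ (Ad g v) = v := by
  rw [← Ad_mul, inv_mul_cancel, Ad_one]

theorem Ad_Ad_inv (g : G) (v : Lie EG G) : Ad g (Ad g⁻¹ v) = v := by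
  rw [← Ad_mul, mul_inv_cancel, Ad_one]

theorem inverse_mfderiv_conj (g h : G) :
    (mfderiv 𝓘(ℝ, EG) 𝓘(ℝ, EG) (conj g) h).inverse =
      mfderiv 𝓘(ℝ, EG) 𝓘(ℝ, EG) (conj g⁻¹) (conj g h) := by
  have h0 : ∀ y : G, ∀ w : TangentSpace 𝓘(ℝ, EG) y,
      (mfderiv 𝓘(ℝ, EG) 𝓘(ℝ, EG) (conj (1 : G)) y w : EG) = w := by
    intro y w
    have h : (conj (1 : G)) = id := by ext x; simp [conj]
    rw [h, mfderiv_id]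
    rfl
  have h3 : ∀ k : G, ∀ y : G, y = h → ∀ w : EG, (mfderiv 𝓘(ℝ, EG) 𝓘(ℝ, EG) (conj k) y w : EG) =
      mfderiv 𝓘(ℝ, EG) 𝓘(ℝ, EG) (conj k) h w := by
    rintro k y rfl w; rfl
  have hh : conj g⁻¹ (conj g h) = h := by simp [conj, mul_assoc]
  refine ContinuousLinearMap.inverse_eq ?_ ?_
  · refine ContinuousLinearMap.ext fun w => ?_
    have := mfderiv_conj_conj g g⁻¹ (conj g h) w
    rw [mul_inv_cancel, h0] at this
    exact ((this.trans (h3 _ _ hh _)).symm : _)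
  · refine ContinuousLinearMap.ext fun w => ?_
    have := mfderiv_conj_conj g⁻¹ g h w
    rw [inv_mul_cancel, h0] at this
    exact this.symm

/-- Differentiating `g (h x) g⁻¹ = (g h g⁻¹)(g x g⁻¹)` at `x = 1` shows that conjugation relates
left invariant fields to left invariant fields; its action on their values at `1` is `Ad g`. -/
theorem mpullback_conj_mulInvariantVectorField (g : G) (v : Lie EG G) :
    mpullback 𝓘(ℝ, EG) 𝓘(ℝ, EG) (conj g)
      (mulInvariantVectorField (I := 𝓘(ℝ, EG)) (Ad g v : Lie EG G)) =
      mulInvariantVectorField (I := 𝓘(ℝ, EG)) v := by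
  ext h
  have hmul : ∀ k y : G, MDifferentiableAt 𝓘(ℝ, EG) 𝓘(ℝ, EG) (fun x : G => k * x) y := fun k y =>
    (contMDiff_mul_left (n := ∞)).contMDiffAt.mdifferentiableAt (by norm_num)
  have hcomp : conj g ∘ (fun x => h * x) = (fun x => conj g h * x) ∘ conj g := by
    ext x; simp [conj, mul_assoc]
  have h1 := mfderiv_comp (I' := 𝓘(ℝ, EG)) (1 : G) (mdifferentiableAt_conj g (h * 1)) (hmul h 1)
  have h2 := mfderiv_comp (I' := 𝓘(ℝ, EG)) (1 : G) (hmul (conj g h) (conj g 1))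
    (mdifferentiableAt_conj g 1)
  have h3 : ∀ y : G, y = h → ∀ w : EG, (mfderiv 𝓘(ℝ, EG) 𝓘(ℝ, EG) (conj g) y w : EG) =
      mfderiv 𝓘(ℝ, EG) 𝓘(ℝ, EG) (conj g) h w := by
    rintro y rfl w; rfl
  have h4 : ∀ y : G, y = 1 → ∀ w : EG,
      (mfderiv 𝓘(ℝ, EG) 𝓘(ℝ, EG) (fun x => conj g h * x) y w : EG) =
      mfderiv 𝓘(ℝ, EG) 𝓘(ℝ, EG) (fun x => conj g h * x) 1 w := by
    rintro y rfl w; rfl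
  have key : (mulInvariantVectorField (I := 𝓘(ℝ, EG)) (Ad g v : Lie EG G) (conj g h) : EG) =
      mfderiv 𝓘(ℝ, EG) 𝓘(ℝ, EG) (conj g) h (mulInvariantVectorField (I := 𝓘(ℝ, EG)) v h) := by
    have e1 : (mfderiv 𝓘(ℝ, EG) 𝓘(ℝ, EG) (conj g ∘ (fun x => h * x)) 1 v : EG) =
        mfderiv 𝓘(ℝ, EG) 𝓘(ℝ, EG) (conj g) h (mulInvariantVectorField (I := 𝓘(ℝ, EG)) v h) :=
      (DFunLike.congr_fun h1 v).trans (h3 _ (mul_one h) _)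
    have e2 : (mfderiv 𝓘(ℝ, EG) 𝓘(ℝ, EG) ((fun x => conj g h * x) ∘ conj g) 1 v : EG) =
        mulInvariantVectorField (I := 𝓘(ℝ, EG)) (Ad g v : Lie EG G) (conj g h) :=
      (DFunLike.congr_fun h2 v).trans (h4 _ (conj_one g) _)
    rw [← e1, ← e2, hcomp]
  rw [mpullback_apply, inverse_mfderiv_conj]
  have e3 := mfderiv_conj_conj g⁻¹ g h (mulInvariantVectorField (I := 𝓘(ℝ, EG)) v h)
  have e4 : conj (g⁻¹ * g) = (id : G → G) := by ext x; simp [conj]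
  rw [e4, mfderiv_id] at e3
  refine Eq.trans ?_ e3.symm
  exact congrArg (fun w : EG => (mfderiv 𝓘(ℝ, EG) 𝓘(ℝ, EG) (conj g⁻¹) (conj g h) w : EG)) key

/-- The adjoint action preserves the Lie bracket. -/
theorem Ad_lie (g : G) (v w : Lie EG G) : Ad g ⁅v, w⁆ = ⁅Ad g v, Ad g w⁆ := by
  have h := mpullback_mlieBracket (I := 𝓘(ℝ, EG)) (I' := 𝓘(ℝ, EG)) (n := ∞) (f := conj g) (x₀ := 1)
    (V := mulInvariantVectorField (I := 𝓘(ℝ, EG)) (Ad g v : Lie EG G))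
    (W := mulInvariantVectorField (I := 𝓘(ℝ, EG)) (Ad g w : Lie EG G))
    (mdifferentiableAt_mulInvariantVectorField _) (mdifferentiableAt_mulInvariantVectorField _)
    (contMDiff_conj g).contMDiffAt (by
      rw [minSmoothness_of_isRCLikeNormedField]; exact two_le_infty)
  rw [mpullback_conj_mulInvariantVectorField, mpullback_conj_mulInvariantVectorField,
    mpullback_apply, inverse_mfderiv_conj] at h
  have h5 : ∀ y : G, y = 1 →
      (mlieBracket 𝓘(ℝ, EG) (mulInvariantVectorField (I := 𝓘(ℝ, EG)) (Ad g v : Lie EG G))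
      (mulInvariantVectorField (I := 𝓘(ℝ, EG)) (Ad g w : Lie EG G)) y : EG) =
      (⁅Ad g v, Ad g w⁆ : Lie EG G) := by
    rintro y rfl; rfl
  have h3 : ∀ y : G, y = 1 → ∀ w : EG, (mfderiv 𝓘(ℝ, EG) 𝓘(ℝ, EG) (conj g⁻¹) y w : EG) =
      mfderiv 𝓘(ℝ, EG) 𝓘(ℝ, EG) (conj g⁻¹) 1 w := by
    rintro y rfl w; rfl
  have h6 : Ad g⁻¹ ⁅Ad g v, Ad g w⁆ = (⁅v, w⁆ : Lie EG G) := by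
    rw [GroupLieAlgebra.bracket_def v w, ← h]
    refine ((h3 _ (conj_one g) _).trans ?_).symm
    exact congrArg (fun z : EG => (mfderiv 𝓘(ℝ, EG) 𝓘(ℝ, EG) (conj g⁻¹) 1 z : EG))
      (h5 _ (conj_one g))
  rw [← h6, Ad_Ad_inv]

/-- The adjoint action by automorphisms of the Lie algebra. -/
noncomputable def AdEquiv (g : G) : Lie EG G ≃ₗ⁅ℝ⁆ Lie EG G where
  __ := (Ad g : Lie EG G →ₗ[ℝ] Lie EG G)
  map_lie' := Ad_lie g _ _
  invFun := Ad g⁻¹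
  left_inv := Ad_inv_Ad g
  right_inv := Ad_Ad_inv g

end AdjointAction

/-! ### The derivative of the adjoint action -/

section AdjointDerivative

open VectorField

variable {EG : Type*} [NormedAddCommGroup EG] [NormedSpace ℝ EG] [FiniteDimensional ℝ EG]
  {G : Type*} [TopologicalSpace G] [ChartedSpace EG G] [Group G] [LieGroup 𝓘(ℝ, EG) ∞ G]

/-- The adjoint action, as a continuous linear map on the model space. -/
noncomputable def AdL (g : G) : EG →L[ℝ] EG := mfderiv 𝓘(ℝ, EG) 𝓘(ℝ, EG) (conj g) 1

theorem AdL_one : AdL (1 : G) = (1 : EG →L[ℝ] EG) :=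
  ContinuousLinearMap.ext fun v => Ad_one (G := G) (v : Lie EG G)

theorem AdL_mul (g h : G) : (AdL (g * h) : EG →L[ℝ] EG) = AdL g * AdL h :=
  ContinuousLinearMap.ext fun v => Ad_mul (G := G) g h (v : Lie EG G)

/-- Conjugation in the chart at the identity. -/
noncomputable def conjChart (g : G) (b : EG) : EG :=
  extChartAt 𝓘(ℝ, EG) (1 : G) (conj g ((extChartAt 𝓘(ℝ, EG) (1 : G)).symm b))

/-- Conjugation fixes `1`, so the chart at `1` serves for source and target. Smooth dependence on
`g` then becomes a statement about derivatives of a family of maps of a fixed vector space. -/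
theorem AdL_eq_fderiv (g : G) :
    AdL g = fderiv ℝ (conjChart g) (extChartAt 𝓘(ℝ, EG) (1 : G) 1) := by
  have := isManifold_one (E := EG) (M := G)
  refine ContinuousLinearMap.ext fun v => ?_
  have hκ : MDifferentiableAt 𝓘(ℝ, EG) 𝓘(ℝ, EG) (extChartAt 𝓘(ℝ, EG) (1 : G)) (conj g 1) := by
    rw [conj_one]
    exact mdifferentiableAt_extChartAt (mem_chart_source EG (1 : G))
  have h := vd_eq_fderiv_self (F := fun h => extChartAt 𝓘(ℝ, EG) (1 : G) (conj g h)) (x := (1 : G))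
    (hκ.comp (1 : G) (mdifferentiableAt_conj g 1)) v
  have h2 := DFunLike.congr_fun (mfderiv_comp (I' := 𝓘(ℝ, EG)) (1 : G) hκ
    (mdifferentiableAt_conj g 1)) v
  have h3 := chartCoord_of_eq (conj_one g) (mfderiv 𝓘(ℝ, EG) 𝓘(ℝ, EG) (conj g) 1 v)
  exact (h3.symm.trans h2.symm).trans h

theorem contMDiffAt_conjChart (g : G) :
    ContMDiffAt (𝓘(ℝ, EG).prod 𝓘(ℝ, EG)) 𝓘(ℝ, EG) ∞
      (Function.uncurry (conjChart (EG := EG) (G := G)))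
      (g, extChartAt 𝓘(ℝ, EG) (1 : G) 1) := by
  have h1 : ContMDiffAt 𝓘(ℝ, EG) 𝓘(ℝ, EG) ∞ (extChartAt 𝓘(ℝ, EG) (1 : G)).symm
      (extChartAt 𝓘(ℝ, EG) (1 : G) 1) :=
    (contMDiffOn_extChartAt_symm (1 : G)).contMDiffAt (extChartAt_target_mem_nhds 1)
  have h2 : ContMDiffAt (𝓘(ℝ, EG).prod 𝓘(ℝ, EG)) 𝓘(ℝ, EG) ∞
      (fun z : G × EG => conj z.1 ((extChartAt 𝓘(ℝ, EG) (1 : G)).symm z.2))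
      (g, extChartAt 𝓘(ℝ, EG) (1 : G) 1) := by
    have h4 : ContMDiffAt (𝓘(ℝ, EG).prod 𝓘(ℝ, EG)) 𝓘(ℝ, EG) ∞
        (fun z : G × EG => (extChartAt 𝓘(ℝ, EG) (1 : G)).symm z.2)
        (g, extChartAt 𝓘(ℝ, EG) (1 : G) 1) := h1.comp (g, extChartAt 𝓘(ℝ, EG) (1 : G) 1)
          contMDiffAt_snd
    have h5 : ContMDiffAt (𝓘(ℝ, EG).prod 𝓘(ℝ, EG)) 𝓘(ℝ, EG) ∞ (fun z : G × EG => z.1)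
        (g, extChartAt 𝓘(ℝ, EG) (1 : G) 1) := contMDiffAt_fst
    exact (h5.mul h4).mul h5.inv
  have h3 : ContMDiffAt 𝓘(ℝ, EG) 𝓘(ℝ, EG) ∞ (extChartAt 𝓘(ℝ, EG) (1 : G))
      (conj g ((extChartAt 𝓘(ℝ, EG) (1 : G)).symm (extChartAt 𝓘(ℝ, EG) (1 : G) 1))) := by
    rw [extChartAt_to_inv, conj_one]
    exact contMDiffAt_extChartAt
  exact ContMDiffAt.comp (I' := 𝓘(ℝ, EG)) (g, extChartAt 𝓘(ℝ, EG) (1 : G) 1) h3 h2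

theorem contMDiff_AdL : ContMDiff 𝓘(ℝ, EG) 𝓘(ℝ, EG →L[ℝ] EG) ∞ (AdL : G → EG →L[ℝ] EG) := by
  intro g
  have h := ContMDiffAt.mfderiv (I := 𝓘(ℝ, EG)) (I' := 𝓘(ℝ, EG)) (J := 𝓘(ℝ, EG)) (m := ∞) (n := ∞)
    (conjChart (EG := EG) (G := G)) (fun _ => extChartAt 𝓘(ℝ, EG) (1 : G) 1) (x₀ := g)
    (contMDiffAt_conjChart g) contMDiffAt_const (by norm_num)
  have h2 := congrFun (inTangentCoordinates_model_space (I := 𝓘(ℝ, EG)) (I' := 𝓘(ℝ, EG)) (fun _ : G => extChartAt 𝓘(ℝ, EG) (1 : G) 1)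
    (fun g' : G => conjChart g' (extChartAt 𝓘(ℝ, EG) (1 : G) 1))
    (fun g' : G => (fderiv ℝ (conjChart g') (extChartAt 𝓘(ℝ, EG) (1 : G) 1) : EG →L[ℝ] EG)) g)
  refine h.congr_of_eventuallyEq (Filter.Eventually.of_forall fun g' => ?_)
  refine (AdL_eq_fderiv g').trans ((h2 g').symm.trans ?_)
  simp only [mfderiv_eq_fderiv]

/-- Multiplication in the chart at the identity. -/
noncomputable def mulChart (G : Type*) [TopologicalSpace G] [ChartedSpace EG G] [Group G]
    (z : EG × EG) : EG :=
  extChartAt 𝓘(ℝ, EG) (1 : G)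
    ((extChartAt 𝓘(ℝ, EG) (1 : G)).symm z.1 * (extChartAt 𝓘(ℝ, EG) (1 : G)).symm z.2)

theorem contDiffAt_mulChart {a b : EG} (ha : a ∈ (extChartAt 𝓘(ℝ, EG) (1 : G)).target)
    (hb : b ∈ (extChartAt 𝓘(ℝ, EG) (1 : G)).target)
    (hab : (extChartAt 𝓘(ℝ, EG) (1 : G)).symm a * (extChartAt 𝓘(ℝ, EG) (1 : G)).symm b ∈
      (chartAt EG (1 : G)).source) :
    ContDiffAt ℝ ∞ (mulChart (EG := EG) G) (a, b) := by
  rw [← contMDiffAt_iff_contDiffAt]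
  have hs : ∀ {c : EG}, c ∈ (extChartAt 𝓘(ℝ, EG) (1 : G)).target →
      ContMDiffAt 𝓘(ℝ, EG) 𝓘(ℝ, EG) ∞ (extChartAt 𝓘(ℝ, EG) (1 : G)).symm c := fun hc =>
    (contMDiffOn_extChartAt_symm (1 : G)).contMDiffAt (extChartAt_target_mem_nhds' hc)
  have h1 : ContMDiffAt 𝓘(ℝ, EG × EG) 𝓘(ℝ, EG) ∞
      (fun z : EG × EG => (extChartAt 𝓘(ℝ, EG) (1 : G)).symm z.1) (a, b) :=
    ContMDiffAt.comp (I' := 𝓘(ℝ, EG)) (a, b) (hs ha) contDiff_fst.contDiffAt.contMDiffAt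
  have h2 : ContMDiffAt 𝓘(ℝ, EG × EG) 𝓘(ℝ, EG) ∞
      (fun z : EG × EG => (extChartAt 𝓘(ℝ, EG) (1 : G)).symm z.2) (a, b) :=
    ContMDiffAt.comp (I' := 𝓘(ℝ, EG)) (a, b) (hs hb) contDiff_snd.contDiffAt.contMDiffAt
  exact ContMDiffAt.comp (I' := 𝓘(ℝ, EG)) (a, b) (contMDiffAt_extChartAt' hab) (h1.mul h2)

theorem mulChart_left {a : EG} (ha : a ∈ (extChartAt 𝓘(ℝ, EG) (1 : G)).target) :
    mulChart G (a, extChartAt 𝓘(ℝ, EG) (1 : G) 1) = a := by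
  unfold mulChart
  rw [extChartAt_to_inv, mul_one, (extChartAt 𝓘(ℝ, EG) (1 : G)).right_inv ha]

theorem symm_mem_chart_source {a : EG} (ha : a ∈ (extChartAt 𝓘(ℝ, EG) (1 : G)).target) :
    (extChartAt 𝓘(ℝ, EG) (1 : G)).symm a ∈ (chartAt EG (1 : G)).source := by
  have := (extChartAt 𝓘(ℝ, EG) (1 : G)).map_target ha
  rwa [extChartAt_source] at this

/-- In this form derivatives of left invariant fields are second derivatives of the multiplication.
-/
theorem chartField_mulInvariantVectorField (v : Lie EG G) {a : EG}
    (ha : a ∈ (extChartAt 𝓘(ℝ, EG) (1 : G)).target) :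
    chartField (1 : G) (mulInvariantVectorField (I := 𝓘(ℝ, EG)) v) a =
      fderiv ℝ (mulChart G) (a, extChartAt 𝓘(ℝ, EG) (1 : G) 1) ((0 : EG), (v : EG)) := by
  have := isManifold_one (E := EG) (M := G)
  set κ := extChartAt 𝓘(ℝ, EG) (1 : G) with hκdef
  have hs := symm_mem_chart_source ha
  have hs1 : κ.symm a * 1 ∈ (chartAt EG (1 : G)).source := by rwa [mul_one]
  have hmul : MDifferentiableAt 𝓘(ℝ, EG) 𝓘(ℝ, EG) (fun x : G => κ.symm a * x) 1 :=
    (contMDiff_mul_left (n := ∞)).contMDiffAt.mdifferentiableAt (by norm_num)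
  have hκ : MDifferentiableAt 𝓘(ℝ, EG) 𝓘(ℝ, EG) κ (κ.symm a * 1) :=
    mdifferentiableAt_extChartAt hs1
  have h := vd_eq_fderiv_self (F := fun h => κ (κ.symm a * h)) (x := (1 : G)) (hκ.comp (1 : G) hmul) v
  have h2 := DFunLike.congr_fun (mfderiv_comp (I' := 𝓘(ℝ, EG)) (1 : G) hκ hmul) v
  have h3 : ∀ y : G, y = κ.symm a → ∀ w : EG, (mfderiv 𝓘(ℝ, EG) 𝓘(ℝ, EG) κ y w : EG) =
      mfderiv 𝓘(ℝ, EG) 𝓘(ℝ, EG) κ (κ.symm a) w := by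
    rintro y rfl w; rfl
  have h4 : (chartField (1 : G) (mulInvariantVectorField (I := 𝓘(ℝ, EG)) v) a : EG) =
      fderiv ℝ ((fun h => κ (κ.symm a * h)) ∘ κ.symm) (κ 1) v :=
    ((h3 _ (mul_one (κ.symm a)) _).symm.trans h2.symm).trans h
  rw [h4]
  have h5 : (fun h => κ (κ.symm a * h)) ∘ κ.symm = fun b => mulChart G (a, b) := rfl
  have h6 : HasFDerivAt (fun b : EG => (a, b)) (ContinuousLinearMap.inr ℝ EG EG) (κ 1) :=
    hasFDerivAt_prodMk_right a (κ 1)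
  have h7 : DifferentiableAt ℝ (mulChart G) (a, κ 1) :=
    (contDiffAt_mulChart ha (mem_extChartAt_target (1 : G)) (by
      rw [extChartAt_to_inv]; exact hs1)).differentiableAt (by norm_num)
  have h8 : HasFDerivAt (fun b => mulChart G (a, b))
      ((fderiv ℝ (mulChart G) (a, κ 1)).comp (ContinuousLinearMap.inr ℝ EG EG)) (κ 1) :=
    HasFDerivAt.comp (κ 1) h7.hasFDerivAt h6
  rw [h5, h8.fderiv]
  rfl

/-- The relation between left translations, right translations and conjugation. -/
theorem fderiv_mulChart_conj (v : EG) {a : EG}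
    (ha : a ∈ (extChartAt 𝓘(ℝ, EG) (1 : G)).target) :
    fderiv ℝ (mulChart G) (a, extChartAt 𝓘(ℝ, EG) (1 : G) 1) ((0 : EG), v) =
      fderiv ℝ (mulChart G) (extChartAt 𝓘(ℝ, EG) (1 : G) 1, a)
        (AdL ((extChartAt 𝓘(ℝ, EG) (1 : G)).symm a) v, (0 : EG)) := by
  set κ := extChartAt 𝓘(ℝ, EG) (1 : G) with hκdef
  have hs := symm_mem_chart_source ha
  have ht1 := mem_extChartAt_target (I := 𝓘(ℝ, EG)) (1 : G)
  have h7 : DifferentiableAt ℝ (mulChart G) (a, κ 1) :=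
    (contDiffAt_mulChart ha ht1 (by
      rw [extChartAt_to_inv, mul_one]; exact hs)).differentiableAt (by norm_num)
  have h7' : DifferentiableAt ℝ (mulChart G) (κ 1, a) :=
    (contDiffAt_mulChart ht1 ha (by
      rw [extChartAt_to_inv, one_mul]; exact hs)).differentiableAt (by norm_num)
  have h8 : HasFDerivAt (fun b => mulChart G (a, b))
      ((fderiv ℝ (mulChart G) (a, κ 1)).comp (ContinuousLinearMap.inr ℝ EG EG)) (κ 1) :=
    HasFDerivAt.comp (κ 1) h7.hasFDerivAt (hasFDerivAt_prodMk_right a (κ 1))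
  have hc1 : conjChart (κ.symm a) (κ 1) = κ 1 := by
    unfold conjChart
    rw [extChartAt_to_inv, conj_one]
  have hcd : ContDiffAt ℝ ∞ (conjChart (κ.symm a)) (κ 1) := by
    rw [← contMDiffAt_iff_contDiffAt]
    exact ContMDiffAt.comp (I' := 𝓘(ℝ, EG).prod 𝓘(ℝ, EG))
      (g := Function.uncurry (conjChart (EG := EG) (G := G)))
      (f := fun b : EG => ((κ.symm a, b) : G × EG)) (κ 1) (contMDiffAt_conjChart (κ.symm a))
      (contMDiffAt_const.prodMk contMDiffAt_id)
  have h9 : HasFDerivAt (conjChart (κ.symm a)) (AdL (κ.symm a)) (κ 1) := by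
    rw [AdL_eq_fderiv]
    exact (hcd.differentiableAt (by norm_num)).hasFDerivAt
  have h10 : HasFDerivAt (fun b => mulChart G (conjChart (κ.symm a) b, a))
      ((fderiv ℝ (mulChart G) (κ 1, a)).comp
        ((AdL (κ.symm a)).prod (0 : EG →L[ℝ] EG))) (κ 1) := by
    refine HasFDerivAt.comp (κ 1) (g := mulChart G)
      (f := fun b => (conjChart (κ.symm a) b, a)) ?_ (h9.prodMk (hasFDerivAt_const a (κ 1)))
    rw [hc1]
    exact h7'.hasFDerivAt
  -- This is `a b = (a b a⁻¹) a`. It holds only for `b` near the identity, where the conjugate stays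
  -- in the chart domain.
  have hev : (fun b => mulChart G (a, b)) =ᶠ[𝓝 (κ 1)]
      fun b => mulChart G (conjChart (κ.symm a) b, a) := by
    have hcont : ContinuousAt (fun b => conj (κ.symm a) (κ.symm b)) (κ 1) := by
      refine ContinuousAt.comp (g := conj (κ.symm a)) (contMDiff_conj (EG := EG) _).continuous.continuousAt
        (continuousAt_extChartAt_symm (1 : G))
    have hmem : κ.source ∈ 𝓝 (conj (κ.symm a) (κ.symm (κ 1))) := by
      rw [extChartAt_to_inv, conj_one]
      exact extChartAt_source_mem_nhds (1 : G)
    filter_upwards [hcont hmem] with b hb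
    unfold mulChart conjChart
    rw [κ.left_inv hb]
    change κ (κ.symm a * κ.symm b) = κ (κ.symm a * κ.symm b * (κ.symm a)⁻¹ * κ.symm a)
    rw [inv_mul_cancel_right]
  have := (h10.congr_of_eventuallyEq hev).unique h8
  exact (DFunLike.congr_fun this v).symm

/-- The derivative of the adjoint action is the adjoint representation of the Lie algebra. -/
theorem vd_AdL (x y : EG) :
    vd (fun g : G => AdL g y) 1 x = Bracket.bracket (L := Lie EG G) (M := Lie EG G) x y := by
  set κ := extChartAt 𝓘(ℝ, EG) (1 : G) with hκdef
  have ht1 := mem_extChartAt_target (I := 𝓘(ℝ, EG)) (1 : G)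
  have hcd : ContDiffAt ℝ ∞ (mulChart (EG := EG) G) (κ 1, κ 1) :=
    contDiffAt_mulChart ht1 ht1 (by
      rw [extChartAt_to_inv, mul_one]; exact mem_chart_source EG (1 : G))
  have hsymm := hcd.isSymmSndFDerivAt (by
    rw [minSmoothness_of_isRCLikeNormedField]; exact two_le_infty)
  have hd : DifferentiableAt ℝ (fderiv ℝ (mulChart (EG := EG) G)) (κ 1, κ 1) :=
    (hcd.fderiv_right (m := ∞) (by norm_num)).differentiableAt (by norm_num)
  set H := fderiv ℝ (fderiv ℝ (mulChart (EG := EG) G)) (κ 1, κ 1) with hH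
  have hfield : ∀ v : EG, HasFDerivAt
      (fun a => fderiv ℝ (mulChart G) (a, κ 1) ((0 : EG), v))
      ((H.flip ((0 : EG), v)).comp (ContinuousLinearMap.inl ℝ EG EG)) (κ 1) := by
    intro v
    have h1 : HasFDerivAt (fun z => fderiv ℝ (mulChart (EG := EG) G) z ((0 : EG), v))
        (H.flip ((0 : EG), v)) (κ 1, κ 1) := by
      have := hd.hasFDerivAt.clm_apply (hasFDerivAt_const ((0 : EG), v) (κ 1, κ 1))
      simpa using this
    exact HasFDerivAt.comp (g := fun z => fderiv ℝ (mulChart (EG := EG) G) z ((0 : EG), v))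
      (f := fun a => (a, κ 1)) (κ 1) h1 (hasFDerivAt_prodMk_left (κ 1) (κ 1))
  -- The bracket of two left invariant fields is the antisymmetrized mixed second derivative `H` of
  -- the multiplication.
  have hbr : (Bracket.bracket (L := Lie EG G) (M := Lie EG G) x y : EG) =
      H ((x : EG), (0 : EG)) ((0 : EG), (y : EG)) - H ((y : EG), (0 : EG)) ((0 : EG), (x : EG)) := by
    have h1 := mlieBracket_eq_lieBracket (1 : G) (mulInvariantVectorField (I := 𝓘(ℝ, EG)) x)
      (mulInvariantVectorField (I := 𝓘(ℝ, EG)) y)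
    have hev : ∀ v : Lie EG G, chartField (1 : G) (mulInvariantVectorField (I := 𝓘(ℝ, EG)) v)
        =ᶠ[𝓝 (κ 1)] fun a => fderiv ℝ (mulChart G) (a, κ 1) ((0 : EG), (v : EG)) := by
      intro v
      filter_upwards [eventually_mem_extChartAt_target (1 : G)] with a ha
      exact chartField_mulInvariantVectorField v ha
    have hone : ∀ v : Lie EG G, chartField (1 : G) (mulInvariantVectorField (I := 𝓘(ℝ, EG)) v) (κ 1)
        = (v : EG) := by
      intro v
      rw [chartField_self]
      have h : (fun z : G => 1 * z) = id := by ext z; simp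
      unfold mulInvariantVectorField
      rw [h, mfderiv_id]
      rfl
    refine (GroupLieAlgebra.bracket_def (I := 𝓘(ℝ, EG)) (G := G) x y).trans (h1.trans ?_)
    have hterm : ∀ v w : Lie EG G,
        fderiv ℝ (chartField (1 : G) (mulInvariantVectorField (I := 𝓘(ℝ, EG)) w)) (κ 1)
          (chartField (1 : G) (mulInvariantVectorField (I := 𝓘(ℝ, EG)) v) (κ 1)) =
        H ((v : EG), (0 : EG)) ((0 : EG), (w : EG)) := by
      intro v w
      rw [hone, (hev w).fderiv_eq]
      exact DFunLike.congr_fun (hfield w).fderiv v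
    exact congrArg₂ (fun p q : EG => p - q) (hterm x y) (hterm y x)
  have hAd : MDifferentiableAt 𝓘(ℝ, EG) 𝓘(ℝ, EG) (fun g : G => AdL g (y : EG)) 1 := by
    have h1 : MDifferentiableAt 𝓘(ℝ, EG) 𝓘(ℝ, EG →L[ℝ] EG) (AdL : G → EG →L[ℝ] EG) 1 :=
      contMDiff_AdL.contMDiffAt.mdifferentiableAt (by norm_num)
    exact h1.clm_apply mdifferentiableAt_const
  have hA := differentiableAt_comp_extChartAt_symm hAd
  refine (vd_eq_fderiv_self hAd x).trans (Eq.trans ?_ hbr.symm)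
  set A : EG → EG := (fun g : G => AdL g (y : EG)) ∘ κ.symm with hAdef
  have hA1 : A (κ 1) = (y : EG) := by
    simp only [hAdef, Function.comp_apply]
    rw [extChartAt_to_inv, AdL_one]
    rfl
  have hR : HasFDerivAt (fun a => fderiv ℝ (mulChart (EG := EG) G) (κ 1, a) (A a, (0 : EG)))
      ((fderiv ℝ (mulChart (EG := EG) G) (κ 1, κ 1)).comp
          ((fderiv ℝ A (κ 1)).prod (0 : EG →L[ℝ] EG)) +
        (H.comp (ContinuousLinearMap.inr ℝ EG EG)).flip (A (κ 1), (0 : EG))) (κ 1) := by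
    have h1 : HasFDerivAt (fun a => fderiv ℝ (mulChart (EG := EG) G) (κ 1, a))
        (H.comp (ContinuousLinearMap.inr ℝ EG EG)) (κ 1) :=
      HasFDerivAt.comp (κ 1) hd.hasFDerivAt (hasFDerivAt_prodMk_right (κ 1) (κ 1))
    exact h1.clm_apply (hA.hasFDerivAt.prodMk (hasFDerivAt_const (0 : EG) (κ 1)))
  -- A left translate is a right translate after `Ad`. Differentiating this identity in `a` at the
  -- unit in the direction `x` produces the derivative of `Ad` plus a mixed second derivative on one
  -- side and another mixed second derivative on the other.
  have hLR : (fun a => fderiv ℝ (mulChart (EG := EG) G) (κ 1, a) (A a, (0 : EG))) =ᶠ[𝓝 (κ 1)]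
      fun a => fderiv ℝ (mulChart G) (a, κ 1) ((0 : EG), (y : EG)) := by
    filter_upwards [eventually_mem_extChartAt_target (1 : G)] with a ha
    exact (fderiv_mulChart_conj (G := G) y ha).symm
  have heq := DFunLike.congr_fun (hR.unique ((hfield y).congr_of_eventuallyEq hLR)) (x : EG)
  have hid : ∀ v : EG, fderiv ℝ (mulChart (EG := EG) G) (κ 1, κ 1) (v, (0 : EG)) = v := by
    intro v
    have h1 : HasFDerivAt (fun a => mulChart (EG := EG) G (a, κ 1))
        ((fderiv ℝ (mulChart (EG := EG) G) (κ 1, κ 1)).comp (ContinuousLinearMap.inl ℝ EG EG))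
        (κ 1) :=
      HasFDerivAt.comp (g := mulChart (EG := EG) G) (f := fun a => (a, κ 1)) (κ 1)
        (hcd.differentiableAt (by norm_num)).hasFDerivAt
        (hasFDerivAt_prodMk_left (κ 1) (κ 1))
    have h2 : (fun a => mulChart (EG := EG) G (a, κ 1)) =ᶠ[𝓝 (κ 1)] id := by
      filter_upwards [eventually_mem_extChartAt_target (1 : G)] with a ha
      exact mulChart_left ha
    exact DFunLike.congr_fun (h1.unique ((hasFDerivAt_id (κ 1)).congr_of_eventuallyEq h2)) v
  have heq' : fderiv ℝ (mulChart (EG := EG) G) (κ 1, κ 1) (fderiv ℝ A (κ 1) (x : EG), (0 : EG)) +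
      H ((0 : EG), (x : EG)) (A (κ 1), (0 : EG)) = H ((x : EG), (0 : EG)) ((0 : EG), (y : EG)) := heq
  -- Symmetry of `H` turns `H (0, x) (y, 0)` into `H (y, 0) (0, x)`, the second term of the bracket.
  rw [hid, hA1, hsymm.eq] at heq'
  exact eq_sub_of_add_eq heq'

end AdjointDerivative

/-! ### Maps between subquotients -/

section Subquotients

variable {V V' V'' : Type*} [AddCommGroup V] [Module ℝ V] [AddCommGroup V'] [Module ℝ V']
  [AddCommGroup V''] [Module ℝ V'']
  {A B : Submodule ℝ V} {A' B' : Submodule ℝ V'} {A'' B'' : Submodule ℝ V''}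

/-- The two hypotheses exclude the default value `0` of `grMap`. -/
theorem grMap_mk {f : V →ₗ[ℝ] V'} (h1 : ∀ x ∈ A, f x ∈ A') (h2 : ∀ x ∈ B, f x ∈ B') (x : A) :
    grMap f A B A' B' (Submodule.Quotient.mk x) = Submodule.Quotient.mk ⟨f x, h1 x x.2⟩ := by
  rw [grMap, dif_pos ⟨h1, h2⟩]
  rfl

theorem gr_mk_eq_mk_iff {x y : A} :
    (Submodule.Quotient.mk x : Gr A B) = Submodule.Quotient.mk y ↔ (x : V) - y ∈ B := by
  rw [Submodule.Quotient.eq]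
  rfl

theorem gr_mk_surjective (t : Gr A B) : ∃ x : A, Submodule.Quotient.mk x = t :=
  Submodule.Quotient.mk_surjective _ t

theorem grMap_grMap {f : V →ₗ[ℝ] V'} {g : V' →ₗ[ℝ] V''} (h1 : ∀ x ∈ A, f x ∈ A')
    (h2 : ∀ x ∈ B, f x ∈ B') (h1' : ∀ x ∈ A', g x ∈ A'') (h2' : ∀ x ∈ B', g x ∈ B'') (t : Gr A B) :
    grMap g A' B' A'' B'' (grMap f A B A' B' t) = grMap (g ∘ₗ f) A B A'' B'' t := by
  obtain ⟨x, rfl⟩ := gr_mk_surjective t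
  rw [grMap_mk h1 h2, grMap_mk h1' h2',
    grMap_mk (f := g ∘ₗ f) (fun x hx => h1' _ (h1 x hx)) (fun x hx => h2' _ (h2 x hx))]
  rfl

theorem grMap_congr {f f' : V →ₗ[ℝ] V'} (h1 : ∀ x ∈ A, f x ∈ A') (h2 : ∀ x ∈ B, f x ∈ B')
    (h1' : ∀ x ∈ A, f' x ∈ A') (h2' : ∀ x ∈ B, f' x ∈ B')
    (h : ∀ x ∈ A, f' x - f x ∈ B') : grMap f' A B A' B' = grMap f A B A' B' := by
  refine LinearMap.ext fun t => ?_
  obtain ⟨x, rfl⟩ := gr_mk_surjective t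
  rw [grMap_mk h1 h2, grMap_mk h1' h2', gr_mk_eq_mk_iff]
  exact h x x.2

theorem grMap_id {f : V →ₗ[ℝ] V} (h1 : ∀ x ∈ A, f x ∈ A) (h2 : ∀ x ∈ B, f x ∈ B)
    (h : ∀ x ∈ A, f x - x ∈ B) : grMap f A B A B = LinearMap.id := by
  refine LinearMap.ext fun t => ?_
  obtain ⟨x, rfl⟩ := gr_mk_surjective t
  rw [grMap_mk h1 h2, LinearMap.id_apply, gr_mk_eq_mk_iff]
  exact h x x.2

theorem grMap_bijective {f : V →ₗ[ℝ] V'} (h1 : A.map f = A') (h2 : ∀ x ∈ B, f x ∈ B')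
    (h3 : ∀ x ∈ A, f x ∈ B' → x ∈ B) : Function.Bijective (grMap f A B A' B') := by
  have h1' : ∀ x ∈ A, f x ∈ A' := fun x hx => h1 ▸ Submodule.mem_map_of_mem hx
  constructor
  · rw [← LinearMap.ker_eq_bot, LinearMap.ker_eq_bot']
    intro t ht
    obtain ⟨x, rfl⟩ := gr_mk_surjective t
    rw [grMap_mk h1' h2] at ht
    have ht' : f x ∈ B' := (Submodule.Quotient.mk_eq_zero (p := B'.submoduleOf A') ).1 ht
    exact (Submodule.Quotient.mk_eq_zero (p := B.submoduleOf A)).2 (h3 x x.2 ht')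
  · intro t
    obtain ⟨⟨y, hy⟩, rfl⟩ := gr_mk_surjective t
    obtain ⟨x, hx, rfl⟩ : y ∈ A.map f := h1 ▸ hy
    exact ⟨Submodule.Quotient.mk ⟨x, hx⟩, grMap_mk h1' h2 _⟩

variable (A B A' B') in
/-- The induced maps on subquotients depend linearly on the map. -/
theorem exists_linear_grMap : ∃ Φ : (V →ₗ[ℝ] V') →ₗ[ℝ] (Gr A B →ₗ[ℝ] Gr A' B'),
    ∀ f : V →ₗ[ℝ] V', (∀ x ∈ A, f x ∈ A') → (∀ x ∈ B, f x ∈ B') → grMap f A B A' B' = Φ f := by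
  -- A linear section `σ` of the quotient map and a linear retraction `r` onto `A'` give a formula
  -- that makes sense, and is linear, for all `f`, with the right value on those `f` that respect
  -- the subspaces.
  obtain ⟨σ, hσ⟩ := (B.submoduleOf A).mkQ.exists_rightInverse_of_surjective
    (Submodule.range_mkQ _)
  obtain ⟨r, hr⟩ := A'.subtype.exists_leftInverse_of_injective (Submodule.ker_subtype A')
  refine ⟨{ toFun := fun f => (B'.submoduleOf A').mkQ ∘ₗ r ∘ₗ f ∘ₗ A.subtype ∘ₗ σ
            map_add' := fun f g => by ext; simp
            map_smul' := fun c f => by ext; simp }, fun f h1 h2 => ?_⟩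
  refine LinearMap.ext fun t => ?_
  have ht : Submodule.Quotient.mk (σ t) = t := DFunLike.congr_fun hσ t
  conv_lhs => rw [← ht, grMap_mk h1 h2]
  have h3 : r (f (σ t)) = ⟨f (σ t), h1 _ (σ t).2⟩ :=
    DFunLike.congr_fun hr (⟨f (σ t), h1 _ (σ t).2⟩ : A')
  rw [← h3]
  rfl

end Subquotients

/-- Every subspace of a finite-dimensional normed space is the kernel of a continuous projection. -/
theorem exists_clm_ker_eq {E : Type*} [NormedAddCommGroup E] [NormedSpace ℝ E]
    [FiniteDimensional ℝ E] (K : Submodule ℝ E) : ∃ p : E →L[ℝ] E, ∀ x, p x = 0 ↔ x ∈ K := by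
  obtain ⟨K', hK⟩ := K.exists_isCompl
  refine ⟨LinearMap.toContinuousLinearMap (K'.projection K hK.symm), fun x => ?_⟩
  rw [LinearMap.coe_toContinuousLinearMap', ← LinearMap.mem_ker, Submodule.ker_projection]

/-- A curve whose derivative lies in a subspace stays in a translate of this subspace. -/
theorem sub_mem_of_hasDerivAt_mem {E : Type*} [NormedAddCommGroup E] [NormedSpace ℝ E]
    [FiniteDimensional ℝ E] (K : Submodule ℝ E) {c c' : ℝ → E} (h : ∀ t, HasDerivAt c (c' t) t)
    (h' : ∀ t, c' t ∈ K) (s t : ℝ) : c t - c s ∈ K := by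
  obtain ⟨p, hp⟩ := exists_clm_ker_eq K
  have h1 : ∀ t, HasDerivAt (fun t => p (c t)) 0 t := by
    intro t
    have := p.hasFDerivAt.comp_hasDerivAt t (h t)
    rwa [(hp _).2 (h' t)] at this
  have h2 := is_const_of_deriv_eq_zero (fun t => (h1 t).differentiableAt) (fun t => (h1 t).deriv) t s
  rw [← hp, map_sub, sub_eq_zero]
  exact h2

/-! ### Trivial action of `exp(𝔭_+)` on the graded pieces -/

section ParabolicSubgroup

variable {EG : Type*} [NormedAddCommGroup EG] [NormedSpace ℝ EG] [FiniteDimensional ℝ EG]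
  {G : Type*} [TopologicalSpace G] [ChartedSpace EG G] [Group G] [LieGroup 𝓘(ℝ, EG) ∞ G]
  {EP : Type*} [NormedAddCommGroup EP] [NormedSpace ℝ EP] [FiniteDimensional ℝ EP]
  {P : Type*} [TopologicalSpace P] [ChartedSpace EP P] [Group P] [LieGroup 𝓘(ℝ, EP) ∞ P]
  {EQ : Type*} [NormedAddCommGroup EQ] [NormedSpace ℝ EQ] [FiniteDimensional ℝ EQ]
  {Q : Type*} [TopologicalSpace Q] [ChartedSpace EQ Q] [Group Q] [LieGroup 𝓘(ℝ, EQ) ∞ Q]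

instance : FiniteDimensional ℝ (Lie EG G) := inferInstanceAs (FiniteDimensional ℝ EG)

/-- The Lie bracket of the Lie algebra of `G`, on the model space. -/
noncomputable def lieB (G : Type*) [TopologicalSpace G] [ChartedSpace EG G] [Group G] [LieGroup 𝓘(ℝ, EG) ∞ G]
    (x y : EG) : EG := Bracket.bracket (L := Lie EG G) (M := Lie EG G) x y

/-- At `t = 0` this is `vd_AdL`; the homomorphism property `γ r = γ t * γ (r - t)` moves it to any
`t`. -/
theorem hasDerivAt_AdL_oneParameter {γ : ℝ → G} (hγ : ContMDiff 𝓘(ℝ, ℝ) 𝓘(ℝ, EG) ∞ γ)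
    (hadd : ∀ s t, γ (s + t) = γ s * γ t) {x : EG}
    (hx : x = (mfderiv 𝓘(ℝ, ℝ) 𝓘(ℝ, EG) γ 0 (1 : ℝ) : EG)) (y : EG) (t : ℝ) :
    HasDerivAt (fun t => AdL (γ t) y) (AdL (γ t) (lieB G x y)) t := by
  have h0 : γ 0 = 1 := by simpa using hadd 0 0
  have hd : MDifferentiableAt 𝓘(ℝ, EG) 𝓘(ℝ, EG) (fun g : G => AdL g y) (γ 0) := by
    have h1 : MDifferentiableAt 𝓘(ℝ, EG) 𝓘(ℝ, EG →L[ℝ] EG) (AdL : G → EG →L[ℝ] EG) (γ 0) :=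
      contMDiff_AdL.contMDiffAt.mdifferentiableAt (by norm_num)
    exact h1.clm_apply mdifferentiableAt_const
  have hγd : MDifferentiableAt 𝓘(ℝ, ℝ) 𝓘(ℝ, EG) γ 0 :=
    hγ.contMDiffAt.mdifferentiableAt (by norm_num)
  have hcd : DifferentiableAt ℝ (fun t => AdL (γ t) y) 0 :=
    (hd.comp (0 : ℝ) hγd).differentiableAt
  have hval : deriv (fun t => AdL (γ t) y) 0 = lieB G x y := by
    rw [← fderiv_apply_one_eq_deriv, ← mfderiv_eq_fderiv]
    have h1 := DFunLike.congr_fun (mfderiv_comp (I' := 𝓘(ℝ, EG)) (0 : ℝ) hd hγd) (1 : ℝ)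
    refine h1.trans ?_
    have h2 : ∀ g : G, g = 1 → ∀ v : EG, (vd (fun g : G => AdL g y) g v : EG) =
        vd (fun g : G => AdL g y) 1 v := by
      rintro g rfl v; rfl
    refine (h2 (γ 0) h0 _).trans ((vd_AdL (G := G) _ y).trans ?_)
    rw [hx]
    rfl
  have hcd' : HasDerivAt (fun t => AdL (γ t) y) (lieB G x y) (t - t) := by
    rw [sub_self, ← hval]
    exact hcd.hasDerivAt
  have h3 : HasDerivAt (fun r => AdL (γ (r - t)) y) (lieB G x y) t := by
    simpa using hcd'.comp_sub_const t t
  have h4 := (AdL (γ t) : EG →L[ℝ] EG).hasFDerivAt.comp_hasDerivAt t h3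
  refine h4.congr_of_eventuallyEq (Filter.Eventually.of_forall fun r => ?_)
  have : γ r = γ t * γ (r - t) := by rw [← hadd]; congr 1; ring
  simp only [this, AdL_mul]
  rfl

variable {D : NestedParabolics (Lie EG G)}

/-- Descending induction on the degree: the derivative of `Ad(γ t) y` is `Ad(γ t) [x, y]` with `[x,
y]` one degree higher, and by induction `Ad(γ t)` keeps it there. A curve with derivative in a
subspace stays in a translate of it. -/
theorem AdL_oneParameter_sub_mem {γ : ℝ → G} (hγ : ContMDiff 𝓘(ℝ, ℝ) 𝓘(ℝ, EG) ∞ γ)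
    (hadd : ∀ s t, γ (s + t) = γ s * γ t) {x : EG}
    (hx : x = (mfderiv 𝓘(ℝ, ℝ) 𝓘(ℝ, EG) γ 0 (1 : ℝ) : EG)) (hxp : (x : Lie EG G) ∈ D.𝔭plus)
    (i : ℤ) (y : EG) (hy : (y : Lie EG G) ∈ D.fil i) (t : ℝ) :
    ((AdL (γ t) y - y : EG) : Lie EG G) ∈ D.fil (i + 1) := by
  obtain ⟨m, hm⟩ := D.exists_fil_eq_bot
  have key : ∀ n : ℕ, ∀ i : ℤ, m ≤ i + n → ∀ y : EG, (y : Lie EG G) ∈ D.fil i → ∀ t,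
      ((AdL (γ t) y - y : EG) : Lie EG G) ∈ D.fil (i + 1) := by
    intro n
    induction n with
    | zero =>
      intro i hi y hy t
      have h0 : y = 0 := by
        rw [hm i (by simpa using hi)] at hy
        exact (Submodule.mem_bot ℝ).1 hy
      rw [h0, map_zero, sub_zero]
      exact Submodule.zero_mem _
    | succ n ih =>
      intro i hi y hy t
      have h1 : ((lieB G x y : EG) : Lie EG G) ∈ D.fil (i + 1) :=
        D.lie_mem_fil_of_le (by omega) hxp hy
      have h2 : ∀ t, ((AdL (γ t) (lieB G x y) : EG) : Lie EG G) ∈ D.fil (i + 1) := by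
        intro t
        have h3 := D.fil_antitone (show i + 1 ≤ i + 1 + 1 by omega)
          (ih (i + 1) (by push_cast at hi; omega) _ h1 t)
        have h4 := Submodule.add_mem _ h3 h1
        exact (congrArg (fun z : EG => (z : Lie EG G) ∈ D.fil (i + 1))
          (sub_add_cancel (AdL (γ t) (lieB G x y)) (lieB G x y))).mp h4
      have h5 := sub_mem_of_hasDerivAt_mem (E := EG) (D.fil (i + 1))
        (fun t => hasDerivAt_AdL_oneParameter hγ hadd hx y t) h2 0 t
      have h0 : γ 0 = 1 := by simpa using hadd 0 0
      simp only [h0, AdL_one] at h5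
      exact h5
  exact key (m + i.natAbs) i (by omega) y hy t

theorem adVV_eq_id_of_mem_expImage {g : G} (hg : g ∈ expImage D.𝔭plus) (i : ℤ) :
    adVV D g i = LinearMap.id := by
  obtain ⟨γ, hγ, hadd, ⟨x, hxp, hx⟩, rfl⟩ := hg
  have key : ∀ i, ∀ y ∈ D.fil i, Ad (γ 1) y - y ∈ D.fil (i + 1) := fun i y hy =>
    AdL_oneParameter_sub_mem hγ hadd hx hxp i y hy 1
  have key' : ∀ i, ∀ y ∈ D.fil i, Ad (γ 1) y ∈ D.fil i := by
    intro i y hy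
    have := Submodule.add_mem _ (D.fil_antitone (show i ≤ i + 1 by omega) (key i y hy)) hy
    rwa [sub_add_cancel] at this
  exact grMap_id (key' i) (key' (i + 1)) (key i)

end ParabolicSubgroup

/-! ### Tensorial constructions as representations -/

namespace TensorialConstruction

variable {ι : Type*} [Fintype ι] {n : ι → ℕ} {W : Type*} [NormedAddCommGroup W] [NormedSpace ℝ W]
  (F : TensorialConstruction n W)

theorem isOpen_isUnit :
    IsOpen {A : ∀ i, (Fin (n i) → ℝ) →L[ℝ] (Fin (n i) → ℝ) | IsUnit A} := Units.isOpen

theorem contDiffAt_rep {A : ∀ i, (Fin (n i) → ℝ) →L[ℝ] (Fin (n i) → ℝ)} (hA : IsUnit A) :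
    ContDiffAt ℝ ∞ F.rep A :=
  F.smooth.contDiffAt (isOpen_isUnit.mem_nhds hA)

theorem rep_mul_apply {A A' : ∀ i, (Fin (n i) → ℝ) →L[ℝ] (Fin (n i) → ℝ)} (hA : IsUnit A)
    (hA' : IsUnit A') (w : W) : F.rep (A * A') w = F.rep A (F.rep A' w) := by
  rw [F.rep_mul _ _ hA hA']
  rfl

theorem rep_bijective {A : ∀ i, (Fin (n i) → ℝ) →L[ℝ] (Fin (n i) → ℝ)} (hA : IsUnit A) :
    Function.Bijective (F.rep A) := by
  obtain ⟨A, rfl⟩ := hA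
  refine Function.bijective_iff_has_inverse.2 ⟨F.rep ↑A⁻¹, fun w => ?_, fun w => ?_⟩
  · rw [← F.rep_mul_apply A⁻¹.isUnit A.isUnit, Units.inv_mul, F.rep_one]
    rfl
  · rw [← F.rep_mul_apply A.isUnit A⁻¹.isUnit, Units.mul_inv, F.rep_one]
    rfl

/-- The derivative of a representation is determined by its derivative at the identity. -/
theorem fderiv_rep_mul {A : ∀ i, (Fin (n i) → ℝ) →L[ℝ] (Fin (n i) → ℝ)} (hA : IsUnit A)
    (C : ∀ i, (Fin (n i) → ℝ) →L[ℝ] (Fin (n i) → ℝ)) :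
    fderiv ℝ F.rep A (A * C) = F.rep A ∘L fderiv ℝ F.rep 1 C := by
  have h1 : HasFDerivAt F.rep (fderiv ℝ F.rep 1) 1 :=
    ((F.contDiffAt_rep isUnit_one).differentiableAt (by norm_num)).hasFDerivAt
  have hA' : HasFDerivAt F.rep (fderiv ℝ F.rep A) (A * 1) := by
    rw [mul_one]
    exact ((F.contDiffAt_rep hA).differentiableAt (by norm_num)).hasFDerivAt
  have h2 : HasFDerivAt (fun X => F.rep (A * X)) _ 1 :=
    HasFDerivAt.comp (g := F.rep) (f := fun X => A * X) 1 hA'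
      (ContinuousLinearMap.mul ℝ _ A).hasFDerivAt
  have h3 : HasFDerivAt (fun X => F.rep A ∘L F.rep X) _ 1 :=
    HasFDerivAt.comp (g := fun T => F.rep A ∘L T) 1
      (ContinuousLinearMap.compL ℝ W W W (F.rep A)).hasFDerivAt h1
  have h4 : (fun X => F.rep (A * X)) =ᶠ[𝓝 1] fun X => F.rep A ∘L F.rep X := by
    filter_upwards [isOpen_isUnit.mem_nhds isUnit_one] with X hX
    exact F.rep_mul A X hA hX
  exact DFunLike.congr_fun (h2.unique (h3.congr_of_eventuallyEq h4)) C

theorem isUnit_of_bijective {A : ∀ i, (Fin (n i) → ℝ) →L[ℝ] (Fin (n i) → ℝ)}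
    (h : ∀ i, Function.Bijective (A i)) : IsUnit A :=
  Pi.isUnit_iff.2 fun i => ContinuousLinearMap.isUnit_iff_bijective.2 (h i)

theorem bijective_of_isUnit {A : ∀ i, (Fin (n i) → ℝ) →L[ℝ] (Fin (n i) → ℝ)} (h : IsUnit A)
    (i : ι) : Function.Bijective (A i) :=
  ContinuousLinearMap.isUnit_iff_bijective.1 (Pi.isUnit_iff.1 h i)

end TensorialConstruction

/-! ### The representation of `P` induced by a tensorial construction -/

section ParabolicSubgroup

variable {EG : Type*} [NormedAddCommGroup EG] [NormedSpace ℝ EG] [FiniteDimensional ℝ EG]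
  {G : Type*} [TopologicalSpace G] [ChartedSpace EG G] [Group G] [LieGroup 𝓘(ℝ, EG) ∞ G]
  {EP : Type*} [NormedAddCommGroup EP] [NormedSpace ℝ EP] [FiniteDimensional ℝ EP]
  {P : Type*} [TopologicalSpace P] [ChartedSpace EP P] [Group P] [LieGroup 𝓘(ℝ, EP) ∞ P]
  {EQ : Type*} [NormedAddCommGroup EQ] [NormedSpace ℝ EQ] [FiniteDimensional ℝ EQ]
  {Q : Type*} [TopologicalSpace Q] [ChartedSpace EQ Q] [Group Q] [LieGroup 𝓘(ℝ, EQ) ∞ Q]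
  {D : NestedParabolics (Lie EG G)}
  {ι : Type*} [Fintype ι] {n : ι → ℕ} {W : Type*} [NormedAddCommGroup W] [NormedSpace ℝ W]
  {k : ι → ℤ} (b : ∀ i, (Fin (n i) → ℝ) ≃ₗ[ℝ] D.VV (k i))

/-- The matrices of the endomorphisms of `𝕍_(k i)` induced by `f`. -/
noncomputable def grMat (f : Lie EG G →ₗ[ℝ] Lie EG G) (i : ι) :
    (Fin (n i) → ℝ) →L[ℝ] (Fin (n i) → ℝ) :=
  LinearMap.toContinuousLinearMap ((b i).symm.toLinearMap ∘ₗ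
    grMap f (D.fil (k i)) (D.fil (k i + 1)) (D.fil (k i)) (D.fil (k i + 1)) ∘ₗ (b i).toLinearMap)

theorem grMat_apply (f : Lie EG G →ₗ[ℝ] Lie EG G) (i : ι) (e : Fin (n i) → ℝ) :
    grMat b f i e = (b i).symm (grMap f (D.fil (k i)) (D.fil (k i + 1)) (D.fil (k i))
      (D.fil (k i + 1)) (b i e)) := rfl

variable (D) in
/-- The linear map `f` preserves the non-positive filtration components. -/
def PreservesFil (f : Lie EG G →ₗ[ℝ] Lie EG G) : Prop :=
  ∀ i ≤ 0, ∀ x ∈ D.fil i, f x ∈ D.fil i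

theorem PreservesFil.comp {f g : Lie EG G →ₗ[ℝ] Lie EG G} (hf : PreservesFil D f)
    (hg : PreservesFil D g) : PreservesFil D (f ∘ₗ g) :=
  fun i hi x hx => hf i hi _ (hg i hi x hx)

theorem grMat_comp (hk : ∀ i, k i < 0) {f g : Lie EG G →ₗ[ℝ] Lie EG G} (hf : PreservesFil D f)
    (hg : PreservesFil D g) : grMat b (f ∘ₗ g) = grMat b f * grMat b g := by
  funext i
  refine ContinuousLinearMap.ext fun e => ?_
  have h1 : k i ≤ 0 := (hk i).le
  -- Both degrees of the subquotient must be non-positive, since `PreservesFil` controls only these;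
  -- this is where `k i < 0` is used.
  have h2 : k i + 1 ≤ 0 := by have := hk i; omega
  change _ = grMat b f i (grMat b g i e)
  rw [grMat_apply, grMat_apply, grMat_apply,
    LinearEquiv.apply_symm_apply, grMap_grMap (hg _ h1) (hg _ h2) (hf _ h1) (hf _ h2)]

theorem grMat_eq_one (hk : ∀ i, k i < 0) {f : Lie EG G →ₗ[ℝ] Lie EG G} (hf : PreservesFil D f)
    (h : ∀ i, ∀ x ∈ D.fil (k i), f x - x ∈ D.fil (k i + 1)) : grMat b f = 1 := by
  funext i
  refine ContinuousLinearMap.ext fun e => ?_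
  have h1 : k i ≤ 0 := (hk i).le
  have h2 : k i + 1 ≤ 0 := by have := hk i; omega
  rw [grMat_apply, grMap_id (hf _ h1) (hf _ h2) (h i)]
  simp

/-- `grMat` is defined by cases. Replacing it by a continuous linear map on filtration-preserving
maps makes smoothness and derivatives in `f` immediate. -/
theorem exists_clm_grMat (hk : ∀ i, k i < 0) :
    ∃ Φ : (EG →L[ℝ] EG) →L[ℝ] (∀ i, (Fin (n i) → ℝ) →L[ℝ] (Fin (n i) → ℝ)),
      ∀ f : Lie EG G →ₗ[ℝ] Lie EG G, PreservesFil D f →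
        grMat b f = Φ (LinearMap.toContinuousLinearMap (E := EG) (F' := EG) f) := by
  choose Φ hΦ using fun i => exists_linear_grMap (D.fil (k i)) (D.fil (k i + 1)) (D.fil (k i))
    (D.fil (k i + 1))
  let Ψ : ∀ i, (EG →L[ℝ] EG) →ₗ[ℝ] ((Fin (n i) → ℝ) →L[ℝ] (Fin (n i) → ℝ)) := fun i =>
    { toFun := fun f => LinearMap.toContinuousLinearMap ((b i).symm.toLinearMap ∘ₗ
        Φ i (f.toLinearMap : EG →ₗ[ℝ] EG) ∘ₗ (b i).toLinearMap)
      map_add' := fun f g => by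
        have h : Φ i ((f + g).toLinearMap : EG →ₗ[ℝ] EG) = Φ i (f.toLinearMap : EG →ₗ[ℝ] EG) +
          Φ i (g.toLinearMap : EG →ₗ[ℝ] EG) := (Φ i).map_add _ _
        refine ContinuousLinearMap.ext fun e => ?_
        change (b i).symm (Φ i _ (b i e)) = (b i).symm (Φ i _ (b i e)) + (b i).symm (Φ i _ (b i e))
        rw [h, LinearMap.add_apply, map_add]
      map_smul' := fun c f => by
        have h : Φ i ((c • f).toLinearMap : EG →ₗ[ℝ] EG) = c • Φ i (f.toLinearMap : EG →ₗ[ℝ] EG) :=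
          (Φ i).map_smul _ _
        refine ContinuousLinearMap.ext fun e => ?_
        change (b i).symm (Φ i _ (b i e)) = c • (b i).symm (Φ i _ (b i e))
        rw [h, LinearMap.smul_apply, map_smul] }
  refine ⟨ContinuousLinearMap.pi fun i => LinearMap.toContinuousLinearMap (Ψ i), fun f hf => ?_⟩
  funext i
  refine ContinuousLinearMap.ext fun e => ?_
  have h1 : k i ≤ 0 := (hk i).le
  have h2 : k i + 1 ≤ 0 := by have := hk i; omega
  rw [grMat_apply, hΦ i f (hf _ h1) (hf _ h2)]
  rfl

variable (H : NestedGroups D EP P EQ Q)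

/-- Elements of `P` normalize `𝔭 = fil 0` by assumption, and `Ad` acts by automorphisms, so the
purely algebraic result applies. -/
theorem map_Ad_fil [LieAlgebra.IsSemisimple ℝ (Lie EG G)] (p : P) (i : ℤ) :
    (D.fil i).map (Ad (H.jP p)) = D.fil i := by
  have h0 : (D.fil 0).map (AdEquiv (EG := EG) (H.jP p) : Lie EG G →ₗ[ℝ] Lie EG G) = D.fil 0 := by
    rw [D.fil_zero]
    exact H.hP.range_subset (Set.mem_range_self p)
  exact D.map_fil_of_map_fil_zero (AdEquiv (H.jP p)) h0 i

theorem Ad_mem_fil_iff [LieAlgebra.IsSemisimple ℝ (Lie EG G)] (p : P) (i : ℤ) (x : Lie EG G) :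
    Ad (H.jP p) x ∈ D.fil i ↔ x ∈ D.fil i := by
  constructor
  · intro h
    have h1 : Ad (H.jP p⁻¹) (Ad (H.jP p) x) ∈ (D.fil i).map (Ad (H.jP p⁻¹)) :=
      Submodule.mem_map_of_mem h
    rwa [map_Ad_fil, map_inv, Ad_inv_Ad] at h1
  · intro h
    have := Submodule.mem_map_of_mem (f := Ad (EG := EG) (H.jP p)) h
    rwa [map_Ad_fil] at this

theorem preservesFil_Ad [LieAlgebra.IsSemisimple ℝ (Lie EG G)] (p : P) :
    PreservesFil D (Ad (H.jP p)) := fun i _ x hx => (Ad_mem_fil_iff H p i x).2 hx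

theorem dHom_comp_apply (Z : Lie EQ Q) :
    dHom (EG := EG) (H.jP.comp H.jQ) Z = dHom (EP := EP) H.jP (mfderiv 𝓘(ℝ, EQ) 𝓘(ℝ, EP) H.jQ 1 Z : EP) := by
  have hQ : MDifferentiableAt 𝓘(ℝ, EQ) 𝓘(ℝ, EP) H.jQ 1 :=
    H.smooth_jQ.contMDiffAt.mdifferentiableAt (by norm_num)
  have hP : MDifferentiableAt 𝓘(ℝ, EP) 𝓘(ℝ, EG) H.jP (H.jQ 1) :=
    H.hP.smooth.contMDiffAt.mdifferentiableAt (by norm_num)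
  have h1 := DFunLike.congr_fun (mfderiv_comp (I' := 𝓘(ℝ, EP)) (1 : Q) hP hQ) Z
  have h2 : ∀ p : P, p = 1 → ∀ v : EP, (mfderiv 𝓘(ℝ, EP) 𝓘(ℝ, EG) H.jP p v : EG) =
      mfderiv 𝓘(ℝ, EP) 𝓘(ℝ, EG) H.jP 1 v := by
    rintro p rfl v; rfl
  exact h1.trans (h2 _ (map_one H.jQ) _)

theorem range_dHom_jP : LinearMap.range (dHom H.jP : Lie EP P →ₗ[ℝ] Lie EG G) = D.fil 0 := by
  rw [D.fil_zero, H.hP.range_dHom]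

/-- Obtained from the groups: the inclusion of `Q` in `G` factors through `P`. -/
theorem 𝔮_le_fil_zero (H : NestedGroups D EP P EQ Q) : D.𝔮 ≤ D.fil 0 := by
  rw [← H.hQ.range_dHom, ← range_dHom_jP H]
  rintro _ ⟨Z, rfl⟩
  exact ⟨_, (dHom_comp_apply H Z).symm⟩

/-- The adjoint action of the Lie algebra of `G`, on the model space. -/
noncomputable def adL (G : Type*) [TopologicalSpace G] [ChartedSpace EG G] [Group G]
    [LieGroup 𝓘(ℝ, EG) ∞ G] (x : EG) : EG →L[ℝ] EG :=
  LinearMap.toContinuousLinearMap (E := EG) (F' := EG) (LieAlgebra.ad ℝ (Lie EG G) (x : Lie EG G))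

theorem preservesFil_adL {x : Lie EG G} (hx : x ∈ D.fil 0) :
    PreservesFil D (LieAlgebra.ad ℝ (Lie EG G) x) :=
  fun _ _ _ hy => D.lie_mem_fil_of_le (by omega) hx hy

theorem contMDiff_AdL_jP : ContMDiff 𝓘(ℝ, EP) 𝓘(ℝ, EG →L[ℝ] EG) ∞
    (fun p : P => (AdL (H.jP p) : EG →L[ℝ] EG)) := contMDiff_AdL.comp H.hP.smooth

theorem vd_AdL_jP (Z : Lie EP P) :
    vd (fun p : P => (AdL (H.jP p) : EG →L[ℝ] EG)) 1 Z = adL (EG := EG) G (dHom H.jP Z) := by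
  have hA : ∀ p, MDifferentiableAt 𝓘(ℝ, EP) 𝓘(ℝ, EG →L[ℝ] EG)
      (fun p : P => (AdL (H.jP p) : EG →L[ℝ] EG)) p :=
    fun p => (contMDiff_AdL_jP H).contMDiffAt.mdifferentiableAt (by norm_num)
  refine ContinuousLinearMap.ext fun y => ?_
  have h1 := vd_clm_apply (hA 1) (mdifferentiableAt_const (c := y)) Z
  have h2 : vd (fun _ : P => y) 1 Z = 0 := by
    unfold vd
    rw [mfderiv_const]
    rfl
  rw [h2, map_zero, zero_add] at h1
  rw [← h1]
  have hd : MDifferentiableAt 𝓘(ℝ, EG) 𝓘(ℝ, EG) (fun g : G => AdL g y) (H.jP 1) := by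
    have h1 : MDifferentiableAt 𝓘(ℝ, EG) 𝓘(ℝ, EG →L[ℝ] EG) (AdL : G → EG →L[ℝ] EG) (H.jP 1) :=
      contMDiff_AdL.contMDiffAt.mdifferentiableAt (by norm_num)
    exact h1.clm_apply mdifferentiableAt_const
  have hP : MDifferentiableAt 𝓘(ℝ, EP) 𝓘(ℝ, EG) H.jP 1 :=
    H.hP.smooth.contMDiffAt.mdifferentiableAt (by norm_num)
  have h3 := DFunLike.congr_fun (mfderiv_comp (I' := 𝓘(ℝ, EG)) (1 : P) hd hP) Z
  have h4 : ∀ g : G, g = 1 → ∀ v : EG, (vd (fun g : G => AdL g y) g v : EG) =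
      vd (fun g : G => AdL g y) 1 v := by
    rintro g rfl v; rfl
  exact h3.trans ((h4 _ (map_one H.jP) _).trans (vd_AdL (G := G) _ y))

variable (F : TensorialConstruction n W)

theorem tensorRep_eq (p : P) :
    ParabolicGeometry.tensorRep H F k b p = F.rep (grMat b (Ad (H.jP p))) := rfl

variable [LieAlgebra.IsSemisimple ℝ (Lie EG G)]

theorem grMat_Ad_mul (hk : ∀ i, k i < 0) (p p' : P) : grMat b (Ad (H.jP (p * p'))) =
    grMat b (Ad (H.jP p)) * grMat b (Ad (H.jP p')) := by
  rw [← grMat_comp b hk (preservesFil_Ad H p) (preservesFil_Ad H p')]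
  congr 1
  refine LinearMap.ext fun x => ?_
  rw [map_mul, Ad_mul]
  rfl

theorem grMat_Ad_one (hk : ∀ i, k i < 0) : grMat b (Ad (H.jP 1)) = 1 := by
  refine grMat_eq_one b hk (preservesFil_Ad H 1) fun i x _ => ?_
  rw [map_one, Ad_one, sub_self]
  exact Submodule.zero_mem _

theorem isUnit_grMat_Ad (hk : ∀ i, k i < 0) (p : P) : IsUnit (grMat b (Ad (H.jP p))) := by
  refine isUnit_iff_exists.2 ⟨grMat b (Ad (H.jP p⁻¹)), ?_, ?_⟩
  · rw [← grMat_Ad_mul b H hk, mul_inv_cancel, grMat_Ad_one b H hk]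
  · rw [← grMat_Ad_mul b H hk, inv_mul_cancel, grMat_Ad_one b H hk]

theorem contMDiff_grMat_Ad (hk : ∀ i, k i < 0) :
    ContMDiff 𝓘(ℝ, EP) 𝓘(ℝ, ∀ i, (Fin (n i) → ℝ) →L[ℝ] (Fin (n i) → ℝ)) ∞
      (fun p : P => grMat b (Ad (H.jP p))) := by
  obtain ⟨Φ, hΦ⟩ := exists_clm_grMat b hk
  have h1 : (fun p : P => grMat b (Ad (H.jP p))) = fun p => Φ (AdL (H.jP p)) := by
    funext p
    exact hΦ _ (preservesFil_Ad H p)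
  rw [h1]
  exact Φ.contDiff.contMDiff.comp (contMDiff_AdL_jP H)

theorem isRelTractorRep_tensorRep (hk : ∀ i, k i < 0) :
    ParabolicGeometry.IsRelTractorRep H (ParabolicGeometry.tensorRep H F k b) where
  smooth := by
    intro p
    exact ContMDiffAt.comp (I' := 𝓘(ℝ, ∀ i, (Fin (n i) → ℝ) →L[ℝ] (Fin (n i) → ℝ)))
      (g := F.rep) p (F.contDiffAt_rep (isUnit_grMat_Ad b H hk p)).contMDiffAt
      (contMDiff_grMat_Ad b H hk p)
  map_one := by rw [tensorRep_eq, grMat_Ad_one b H hk, F.rep_one]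
  map_mul p p' := by
    rw [tensorRep_eq, grMat_Ad_mul b H hk,
      F.rep_mul _ _ (isUnit_grMat_Ad b H hk p) (isUnit_grMat_Ad b H hk p')]
    rfl
  trivial p hp := by
    rw [tensorRep_eq, ← F.rep_one]
    congr 1
    funext i
    refine ContinuousLinearMap.ext fun e => ?_
    have h := adVV_eq_id_of_mem_expImage hp (k i)
    unfold adVV at h
    rw [grMat_apply, h]
    simp

/-- This makes the algebraic term of the relative tractor connection explicit: the derivative of
`F.rep` at the identity applied to the matrices of `ad`. -/
theorem vd_tensorRep (hk : ∀ i, k i < 0) (Z : Lie EP P) :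
    vd (ParabolicGeometry.tensorRep H F k b) 1 Z =
      fderiv ℝ F.rep 1 (grMat b (LieAlgebra.ad ℝ (Lie EG G) (dHom H.jP Z))) := by
  obtain ⟨Φ, hΦ⟩ := exists_clm_grMat b hk
  have h1 : (ParabolicGeometry.tensorRep H F k b) = fun p => F.rep (Φ (AdL (H.jP p))) := by
    funext p
    rw [tensorRep_eq, hΦ _ (preservesFil_Ad H p)]
    rfl
  have hA : MDifferentiableAt 𝓘(ℝ, EP) 𝓘(ℝ, EG →L[ℝ] EG)
      (fun p : P => (AdL (H.jP p) : EG →L[ℝ] EG)) 1 :=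
    (contMDiff_AdL_jP H).contMDiffAt.mdifferentiableAt (by norm_num)
  have h2 : Φ (AdL (H.jP 1)) = 1 := by
    rw [← grMat_Ad_one b H hk, hΦ _ (preservesFil_Ad H 1)]
    rfl
  have hrep : DifferentiableAt ℝ F.rep (Φ (AdL (H.jP 1))) := by
    rw [h2]
    exact (F.contDiffAt_rep isUnit_one).differentiableAt (by norm_num)
  have hZ : dHom (EG := EG) H.jP Z ∈ D.fil 0 := by
    rw [← range_dHom_jP H]
    exact LinearMap.mem_range_self _ Z
  rw [h1, vd_comp (F := fun p => Φ (AdL (H.jP p))) hrep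
    (Φ.differentiableAt.mdifferentiableAt.comp (I' := 𝓘(ℝ, EG →L[ℝ] EG)) (1 : P) hA), h2,
    vd_clm Φ hA, vd_AdL_jP, hΦ _ (preservesFil_adL hZ)]
  rfl

end ParabolicSubgroup

/-! ### Smoothness of vector fields along maps -/

section TangentSmoothness

variable {EX : Type*} [NormedAddCommGroup EX] [NormedSpace ℝ EX]
  {X : Type*} [TopologicalSpace X] [ChartedSpace EX X]
  {EY : Type*} [NormedAddCommGroup EY] [NormedSpace ℝ EY]
  {Y : Type*} [TopologicalSpace Y] [ChartedSpace EY Y] [IsManifold 𝓘(ℝ, EY) ∞ Y]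

/-- The trivialization of the tangent bundle at `y₀` is given by the derivative of the chart, so
smoothness in the tangent bundle can be tested on `chartCoord`. -/
theorem trivializationAt_tangent_snd {y₀ y : Y} (hy : y ∈ (chartAt EY y₀).source)
    (v : TangentSpace 𝓘(ℝ, EY) y) :
    (trivializationAt EY (TangentSpace 𝓘(ℝ, EY) : Y → Type _) y₀
      (⟨y, v⟩ : TangentBundle 𝓘(ℝ, EY) Y)).2 = chartCoord y₀ y v := by
  have := isManifold_one (E := EY) (M := Y)
  have h1 := TangentBundle.continuousLinearMapAt_trivializationAt (I := 𝓘(ℝ, EY)) hy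
  have h2 : (trivializationAt EY (TangentSpace 𝓘(ℝ, EY) : Y → Type _) y₀).continuousLinearMapAt ℝ y v =
      (trivializationAt EY (TangentSpace 𝓘(ℝ, EY) : Y → Type _) y₀
        (⟨y, v⟩ : TangentBundle 𝓘(ℝ, EY) Y)).2 := by
    rw [Bundle.Trivialization.continuousLinearMapAt_apply,
      Bundle.Trivialization.coe_linearMapAt_of_mem]
    exact hy
  rw [← h2, h1]
  rfl

/-- Smoothness of a vector field along a map, in terms of coordinates. -/
theorem contMDiffWithinAt_tangent_iff {g : X → Y} {η : ∀ x, TangentSpace 𝓘(ℝ, EY) (g x)}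
    {s : Set X} {x₀ : X} :
    ContMDiffWithinAt 𝓘(ℝ, EX) 𝓘(ℝ, EY).tangent ∞
      (fun x => (⟨g x, η x⟩ : TangentBundle 𝓘(ℝ, EY) Y)) s x₀ ↔
    ContMDiffWithinAt 𝓘(ℝ, EX) 𝓘(ℝ, EY) ∞ g s x₀ ∧
    ContMDiffWithinAt 𝓘(ℝ, EX) 𝓘(ℝ, EY) ∞ (fun x => chartCoord (g x₀) (g x) (η x)) s x₀ := by
  have := isManifold_one (E := EY) (M := Y)
  refine (Bundle.contMDiffWithinAt_totalSpace (IB := 𝓘(ℝ, EY))).trans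
    (and_congr_right fun hg => ?_)
  have hev : ∀ᶠ x in 𝓝[s] x₀, g x ∈ (chartAt EY (g x₀)).source :=
    hg.continuousWithinAt (chart_source_mem_nhds EY (g x₀))
  refine Filter.EventuallyEq.contMDiffWithinAt_iff ?_ ?_
  · filter_upwards [hev] with x hx
    exact trivializationAt_tangent_snd hx (η x)
  · exact trivializationAt_tangent_snd (mem_chart_source EY _) (η x₀)

theorem contMDiffAt_tangent_iff {g : X → Y} {η : ∀ x, TangentSpace 𝓘(ℝ, EY) (g x)} {x₀ : X} :
    ContMDiffAt 𝓘(ℝ, EX) 𝓘(ℝ, EY).tangent ∞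
      (fun x => (⟨g x, η x⟩ : TangentBundle 𝓘(ℝ, EY) Y)) x₀ ↔
    ContMDiffAt 𝓘(ℝ, EX) 𝓘(ℝ, EY) ∞ g x₀ ∧
    ContMDiffAt 𝓘(ℝ, EX) 𝓘(ℝ, EY) ∞ (fun x => chartCoord (g x₀) (g x) (η x)) x₀ := by
  simp only [← contMDiffWithinAt_univ]
  exact contMDiffWithinAt_tangent_iff

variable {W W' : Type*} [NormedAddCommGroup W] [NormedSpace ℝ W] [NormedAddCommGroup W']
  [NormedSpace ℝ W']

/-- In a basis of `W` the operator is a finite sum of rank one operators whose vectors are the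
images of the basis. -/
theorem contMDiffAt_clm_of_apply [FiniteDimensional ℝ W] {A : X → W →L[ℝ] W'} {x₀ : X}
    (h : ∀ w, ContMDiffAt 𝓘(ℝ, EX) 𝓘(ℝ, W') ∞ (fun x => A x w) x₀) :
    ContMDiffAt 𝓘(ℝ, EX) 𝓘(ℝ, W →L[ℝ] W') ∞ A x₀ := by
  let b := Module.finBasis ℝ W
  let c : ∀ i, W →L[ℝ] ℝ := fun i => LinearMap.toContinuousLinearMap (b.coord i)
  have h1 : A = fun x => ∑ i, ContinuousLinearMap.smulRightL ℝ W W' (c i) (A x (b i)) := by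
    funext x
    refine ContinuousLinearMap.ext fun w => ?_
    conv_lhs => rw [← b.sum_repr w, map_sum]
    rw [sum_apply]
    refine Finset.sum_congr rfl fun i _ => ?_
    rw [map_smul]
    rfl
  rw [h1]
  refine contMDiffAt_finsetSum fun i _ => ?_
  exact ContMDiffAt.comp (I' := 𝓘(ℝ, W')) x₀
    (ContinuousLinearMap.smulRightL ℝ W W' (c i)).contDiff.contMDiff.contMDiffAt (h (b i))

end TangentSmoothness

section VectorFields

variable {E : Type*} [NormedAddCommGroup E] [NormedSpace ℝ E] [CompleteSpace E]
  {M : Type*} [TopologicalSpace M] [ChartedSpace E M] [IsManifold 𝓘(ℝ, E) ∞ M]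
  {W : Type*} [NormedAddCommGroup W] [NormedSpace ℝ W]

theorem contMDiffAt_vd_field {F : M → W} {x : M} (hF : ContMDiffAt 𝓘(ℝ, E) 𝓘(ℝ, W) ∞ F x)
    {V : ∀ y : M, TangentSpace 𝓘(ℝ, E) y}
    (hV : ContMDiffAt 𝓘(ℝ, E) 𝓘(ℝ, E).tangent ∞
      (fun y => (⟨y, V y⟩ : TangentBundle 𝓘(ℝ, E) M)) x) :
    ContMDiffAt 𝓘(ℝ, E) 𝓘(ℝ, W) ∞ (fun y => vd F y (V y)) x := by
  have h1 := (contMDiffAt_tangent_iff (g := fun y : M => y).1 hV).2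
  have h2 : ContDiffAt ℝ ∞ (chartField x V) (extChartAt 𝓘(ℝ, E) x x) :=
    contDiffAt_comp_extChartAt_symm (mem_chart_source E x) h1
  have h3 := contDiffAt_comp_extChartAt_symm (mem_chart_source E x) hF
  have h4 : ContDiffAt ℝ ∞
      (fun a => fderiv ℝ (F ∘ (extChartAt 𝓘(ℝ, E) x).symm) a (chartField x V a))
      (extChartAt 𝓘(ℝ, E) x x) := (h3.fderiv_right (m := ∞) (by norm_num)).clm_apply h2
  refine ContMDiffAt.congr_of_eventuallyEq ?_ (vd_field_eventuallyEq hF V)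
  exact ContMDiffAt.comp (I' := 𝓘(ℝ, E)) x h4.contMDiffAt contMDiffAt_extChartAt

end VectorFields

/-! ### Constant vector fields of a parallelism -/

section Parallelism

variable {EB : Type*} [NormedAddCommGroup EB] [NormedSpace ℝ EB] [FiniteDimensional ℝ EB]
  {B : Type*} [TopologicalSpace B] [ChartedSpace EB B] [IsManifold 𝓘(ℝ, EB) ∞ B]
  {V : Type*} [NormedAddCommGroup V] [NormedSpace ℝ V] [FiniteDimensional ℝ V]
  {W : Type*} [NormedAddCommGroup W] [NormedSpace ℝ W]
  (θ : ∀ u : B, TangentSpace 𝓘(ℝ, EB) u ≃L[ℝ] V)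

/-- The derivative of a function in the directions of the constant vector fields of a
parallelism. -/
noncomputable def fd (F : B → W) (u : B) : V →L[ℝ] W :=
  (vd F u : EB →L[ℝ] W) ∘L ((θ u).symm.toContinuousLinearMap : V →L[ℝ] EB)

theorem fd_apply (F : B → W) (u : B) (X : V) : fd θ F u X = vd F u ((θ u).symm X) := rfl

/-- The bracket of constant vector fields of a parallelism. -/
noncomputable def parBr (u : B) (X Y : V) : V :=
  θ u (VectorField.mlieBracket 𝓘(ℝ, EB) (fun v => (θ v).symm X) (fun v => (θ v).symm Y) u)

variable {θ}

variable (θ) in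
/-- Smoothness of a parallelism. -/
def IsSmoothPar : Prop :=
  ContMDiff (M' := V) 𝓘(ℝ, EB).tangent 𝓘(ℝ, V) ∞ (fun v : TangentBundle 𝓘(ℝ, EB) B => θ v.1 v.2)

/-- In a chart `θ` is a smooth family of invertible operators, and inversion is smooth. -/
theorem contMDiffAt_constField
    (hθ : IsSmoothPar θ) (X : V) (u : B) :
    ContMDiffAt 𝓘(ℝ, EB) 𝓘(ℝ, EB).tangent ∞
      (fun u => (⟨u, (θ u).symm X⟩ : TangentBundle 𝓘(ℝ, EB) B)) u := by
  let A : B → EB →L[ℝ] V := fun v => ((θ v).toContinuousLinearMap : EB →L[ℝ] V) ∘L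
    ((chartCoord u v).inverse : EB →L[ℝ] EB)
  have hA : ContMDiffAt 𝓘(ℝ, EB) 𝓘(ℝ, EB →L[ℝ] V) ∞ A u := by
    refine contMDiffAt_clm_of_apply fun w => ?_
    have h1 : ContMDiffAt 𝓘(ℝ, EB) 𝓘(ℝ, EB).tangent ∞
        (fun v => (⟨v, (chartCoord u v).inverse w⟩ : TangentBundle 𝓘(ℝ, EB) B)) u := by
      refine contMDiffAt_tangent_iff.2 ⟨contMDiffAt_id, ?_⟩
      refine (contMDiffAt_const (c := w)).congr_of_eventuallyEq ?_
      filter_upwards [chart_source_mem_nhds EB u] with v hv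
      exact (chartCoord_isInvertible hv).self_apply_inverse w
    exact ContMDiffAt.comp (I' := 𝓘(ℝ, EB).tangent) u (ContMDiff.contMDiffAt hθ) h1
  have hAe : ∀ v ∈ (chartAt EB u).source, ∃ e : EB ≃L[ℝ] V, (e : EB →L[ℝ] V) = A v ∧
      ∀ X, e.symm X = chartCoord u v ((θ v).symm X) := by
    intro v hv
    obtain ⟨e, he⟩ := chartCoord_isInvertible hv
    refine ⟨(e.symm.trans (θ v) : EB ≃L[ℝ] V), ?_, fun X => ?_⟩
    · simp only [A, ← he, ContinuousLinearMap.inverse_equiv]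
      rfl
    · rw [← he]
      rfl
  refine contMDiffAt_tangent_iff.2 ⟨contMDiffAt_id, ?_⟩
  obtain ⟨e, he, -⟩ := hAe u (mem_chart_source EB u)
  have h2 : ContDiffAt ℝ ∞ (ContinuousLinearMap.inverse : (EB →L[ℝ] V) → V →L[ℝ] EB) (A u) := by
    rw [← he]
    exact contDiffAt_map_inverse e
  have h3 : ContMDiffAt 𝓘(ℝ, EB) 𝓘(ℝ, V →L[ℝ] EB) ∞ (fun v => (A v).inverse) u :=
    ContMDiffAt.comp (I' := 𝓘(ℝ, EB →L[ℝ] V)) u h2.contMDiffAt hA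
  refine (h3.clm_apply (contMDiffAt_const (c := X))).congr_of_eventuallyEq ?_
  filter_upwards [chart_source_mem_nhds EB u] with v hv
  obtain ⟨e, he, he'⟩ := hAe v hv
  rw [← he, ContinuousLinearMap.inverse_equiv]
  exact (he' X).symm

theorem contMDiffAt_fd (hθ : IsSmoothPar θ) {F : B → W} {u : B} (hF : ContMDiffAt 𝓘(ℝ, EB) 𝓘(ℝ, W) ∞ F u) :
    ContMDiffAt 𝓘(ℝ, EB) 𝓘(ℝ, V →L[ℝ] W) ∞ (fd θ F) u :=
  contMDiffAt_clm_of_apply fun X => contMDiffAt_vd_field hF (contMDiffAt_constField hθ X u)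

/-- The key differential identity. Whenever `fd θ F · X` vanishes near `u`, the last term drops out
and the derivative of `fd θ F · Y` in the direction `X` is determined by the bracket. -/
theorem fd_parBr (hθ : IsSmoothPar θ) {F : B → W} {u : B} (hF : ContMDiffAt 𝓘(ℝ, EB) 𝓘(ℝ, W) ∞ F u) (X Y : V) :
    fd θ F u (parBr θ u X Y) = fd θ (fd θ F) u X Y - fd θ (fd θ F) u Y X := by
  have h1 := vd_mlieBracket hF
    ((contMDiffAt_constField hθ X u).mdifferentiableAt (by norm_num))
    ((contMDiffAt_constField hθ Y u).mdifferentiableAt (by norm_num))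
  have h2 : ∀ Z Z' : V, fd θ (fd θ F) u Z Z' =
      vd (fun y => vd F y ((θ y).symm Z')) u ((θ u).symm Z) := by
    intro Z Z'
    have h3 := vd_clm (ContinuousLinearMap.apply ℝ W Z')
      ((contMDiffAt_fd hθ hF).mdifferentiableAt (by norm_num)) ((θ u).symm Z)
    exact h3.symm
  rw [h2, h2, ← h1, fd_apply, parBr, ContinuousLinearEquiv.symm_apply_apply]

end Parallelism

/-! ### Submersions and functions constant along their fibres -/

section VectorSpaces

variable {E E' : Type*} [NormedAddCommGroup E] [NormedSpace ℝ E] [FiniteDimensional ℝ E]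
  [NormedAddCommGroup E'] [NormedSpace ℝ E'] [FiniteDimensional ℝ E']

/-- A smooth map with surjective derivative at a point is a projection in suitable coordinates. -/
theorem exists_openPartialHomeomorph_of_surjective {F : E → E'} {Ω : Set E} (hΩ : IsOpen Ω) {a : E}
    (ha : a ∈ Ω) (hF : ContDiffOn ℝ ∞ F Ω) (hs : Function.Surjective (fderiv ℝ F a)) :
    ∃ (K : Submodule ℝ E) (e : OpenPartialHomeomorph E (E' × K)), a ∈ e.source ∧ e.source ⊆ Ω ∧
      (∀ x ∈ e.source, (e x).1 = F x) ∧ ContDiffOn ℝ ∞ e e.source ∧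
      ContDiffOn ℝ ∞ e.symm e.target := by
  -- Pairing `F` with a projection onto the kernel of its derivative gives a map with invertible
  -- derivative at `a`.
  let K : Submodule ℝ E := LinearMap.ker (fderiv ℝ F a).toLinearMap
  obtain ⟨q₀, hq₀⟩ := K.subtype.exists_leftInverse_of_injective (Submodule.ker_subtype K)
  let q : E →L[ℝ] K := LinearMap.toContinuousLinearMap q₀
  have hq : ∀ x : K, q x = x := fun x => DFunLike.congr_fun hq₀ x
  let Φ : E → E' × K := fun x => (F x, q x)
  have hΦ : ContDiffOn ℝ ∞ Φ Ω := hF.prodMk q.contDiff.contDiffOn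
  have hd : HasFDerivAt Φ ((fderiv ℝ F a).prod q) a :=
    ((hF.contDiffAt (hΩ.mem_nhds ha)).differentiableAt (by norm_num)).hasFDerivAt.prodMk
      q.hasFDerivAt
  have hinj : Function.Injective ((fderiv ℝ F a).prod q) := by
    refine (injective_iff_map_eq_zero _).2 fun x hx => ?_
    have h1 : fderiv ℝ F a x = 0 := congrArg Prod.fst hx
    have h2 : q x = 0 := congrArg Prod.snd hx
    have h3 := hq ⟨x, h1⟩
    rw [h2] at h3
    exact (congrArg Subtype.val h3).symm
  have hsurj : Function.Surjective ((fderiv ℝ F a).prod q) := by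
    rintro ⟨y, k⟩
    obtain ⟨x, rfl⟩ := hs y
    refine ⟨x - q x + k, Prod.ext ?_ ?_⟩
    · have h1 : fderiv ℝ F a (q x) = 0 := (q x).2
      have h2 : fderiv ℝ F a k = 0 := k.2
      change fderiv ℝ F a (x - q x + k) = fderiv ℝ F a x
      rw [map_add, map_sub, h1, h2, sub_zero, add_zero]
    · change q (x - q x + k) = k
      rw [map_add, map_sub, hq, hq, sub_self, zero_add]
  let eq : E ≃L[ℝ] E' × K :=
    (LinearEquiv.ofBijective ((fderiv ℝ F a).prod q).toLinearMap
      ⟨hinj, hsurj⟩).toContinuousLinearEquiv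
  have heq : (eq : E →L[ℝ] E' × K) = (fderiv ℝ F a).prod q := rfl
  have hd' : HasFDerivAt Φ (eq : E →L[ℝ] E' × K) a := hd
  have hΦa : ContDiffAt ℝ ∞ Φ a := hΦ.contDiffAt (hΩ.mem_nhds ha)
  let e₀ := hΦa.toOpenPartialHomeomorph Φ hd' (by norm_num)
  -- Restricting to the open set where the derivative is invertible makes the inverse smooth on the
  -- whole target and not only at the image of `a`.
  let S : Set E := Ω ∩ fderiv ℝ Φ ⁻¹' Set.range ((↑) : (E ≃L[ℝ] E' × K) → E →L[ℝ] E' × K)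
  have hS : IsOpen S :=
    (hΦ.continuousOn_fderiv_of_isOpen hΩ (by norm_num)).isOpen_inter_preimage hΩ
      ContinuousLinearEquiv.isOpen
  let e := e₀.restrOpen S hS
  have hes : ∀ x, x ∈ e.source ↔ x ∈ e₀.source ∧ x ∈ S := fun x => by
    rw [OpenPartialHomeomorph.restrOpen_source]; rfl
  have hcoe : ∀ x, e x = Φ x := fun x => rfl
  have hsub : e.source ⊆ Ω := fun x hx => ((hes x).1 hx).2.1
  refine ⟨K, e, (hes a).2 ⟨hΦa.mem_toOpenPartialHomeomorph_source hd' (by norm_num), ha, eq, ?_⟩,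
    hsub, fun x _ => rfl, hΦ.mono hsub, fun y hy => ?_⟩
  · exact hd'.fderiv.symm
  · have hx := e.map_target hy
    obtain ⟨eq', he'⟩ := ((hes _).1 hx).2.2
    have hda : ContDiffAt ℝ ∞ e (e.symm y) := hΦ.contDiffAt (hΩ.mem_nhds (hsub hx))
    refine (e.contDiffAt_symm hy (f₀' := eq') ?_ hda).contDiffWithinAt
    rw [he']
    exact (hda.differentiableAt (by norm_num)).hasFDerivAt

end VectorSpaces

section Submersions

variable {EB : Type*} [NormedAddCommGroup EB] [NormedSpace ℝ EB] [FiniteDimensional ℝ EB]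
  {B : Type*} [TopologicalSpace B] [ChartedSpace EB B] [IsManifold 𝓘(ℝ, EB) ∞ B]
  {EY : Type*} [NormedAddCommGroup EY] [NormedSpace ℝ EY] [FiniteDimensional ℝ EY]
  {Y : Type*} [TopologicalSpace Y] [ChartedSpace EY Y] [IsManifold 𝓘(ℝ, EY) ∞ Y]
  {W : Type*} [NormedAddCommGroup W] [NormedSpace ℝ W]

variable (EB EY) in
/-- Local coordinates near `u₀` in which `Ψ` is a projection. -/
structure SubmersionChart (Ψ : B → Y) (Ω : Set B) (u₀ : B) where
  K : Submodule ℝ EB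
  α : EY × K → B
  β : B → EY × K
  O : Set B
  T : Set (EY × K)
  isOpen_O : IsOpen O
  isOpen_T : IsOpen T
  mem : u₀ ∈ O
  subset : O ⊆ Ω
  mapsTo_source : ∀ u ∈ O, Ψ u ∈ (chartAt EY (Ψ u₀)).source
  β_mem : ∀ u ∈ O, β u ∈ T
  α_mem : ∀ t ∈ T, α t ∈ O
  α_β : ∀ u ∈ O, α (β u) = u
  β_α : ∀ t ∈ T, β (α t) = t
  β_fst : ∀ u ∈ O, (β u).1 = extChartAt 𝓘(ℝ, EY) (Ψ u₀) (Ψ u)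
  smooth_α : ContMDiffOn 𝓘(ℝ, EY × K) 𝓘(ℝ, EB) ∞ α T
  smooth_β : ContMDiffOn 𝓘(ℝ, EB) 𝓘(ℝ, EY × K) ∞ β O

theorem nonempty_submersionChart {Ψ : B → Y} {Ω : Set B} (hΩ : IsOpen Ω) {u₀ : B} (hu₀ : u₀ ∈ Ω)
    (hΨ : ContMDiffOn 𝓘(ℝ, EB) 𝓘(ℝ, EY) ∞ Ψ Ω)
    (hs : Function.Surjective (mfderiv 𝓘(ℝ, EB) 𝓘(ℝ, EY) Ψ u₀)) :
    Nonempty (SubmersionChart EB EY Ψ Ω u₀) := by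
  have := isManifold_one (E := EB) (M := B)
  have := isManifold_one (E := EY) (M := Y)
  set κ := extChartAt 𝓘(ℝ, EB) u₀ with hκ
  set κ' := extChartAt 𝓘(ℝ, EY) (Ψ u₀) with hκ'
  let Ω₁ : Set B := Ω ∩ Ψ ⁻¹' (chartAt EY (Ψ u₀)).source
  have hΩ₁ : IsOpen Ω₁ := hΨ.continuousOn.isOpen_inter_preimage hΩ (chartAt EY (Ψ u₀)).open_source
  have hu₁ : u₀ ∈ Ω₁ := ⟨hu₀, mem_chart_source EY (Ψ u₀)⟩
  have hFm : ∀ u ∈ Ω₁, ContMDiffAt 𝓘(ℝ, EB) 𝓘(ℝ, EY) ∞ (fun u => κ' (Ψ u)) u := fun u hu =>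
    ContMDiffAt.comp (I' := 𝓘(ℝ, EY)) u (contMDiffAt_extChartAt' hu.2)
      (hΨ.contMDiffAt (hΩ.mem_nhds hu.1))
  let Ωc : Set EB := κ.target ∩ κ.symm ⁻¹' Ω₁
  have hΩc : IsOpen Ωc :=
    (continuousOn_extChartAt_symm u₀).isOpen_inter_preimage (isOpen_extChartAt_target u₀) hΩ₁
  have hac : κ u₀ ∈ Ωc := by
    refine ⟨mem_extChartAt_target u₀, ?_⟩
    rw [Set.mem_preimage, extChartAt_to_inv]
    exact hu₁
  have hsrc : ∀ a ∈ κ.target, κ.symm a ∈ (chartAt EB u₀).source := fun a ha => by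
    have := κ.map_target ha
    rwa [hκ, extChartAt_source] at this
  have hF : ContDiffOn ℝ ∞ ((fun u => κ' (Ψ u)) ∘ κ.symm) Ωc := by
    intro a ha
    have h1 := contDiffAt_comp_extChartAt_symm (hsrc a ha.1) (hFm _ ha.2)
    rw [κ.right_inv ha.1] at h1
    exact h1.contDiffWithinAt
  have hsurj : Function.Surjective (fderiv ℝ ((fun u => κ' (Ψ u)) ∘ κ.symm) (κ u₀)) := by
    intro y
    obtain ⟨w, hw⟩ := (chartCoord_bijective (mem_chart_source EY (Ψ u₀))).2 y
    obtain ⟨v, rfl⟩ := hs w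
    refine ⟨v, ?_⟩
    have h1 := vd_eq_fderiv_self ((hFm u₀ hu₁).mdifferentiableAt (by norm_num)) v
    refine h1.symm.trans (Eq.trans ?_ hw)
    exact DFunLike.congr_fun (mfderiv_comp (I' := 𝓘(ℝ, EY)) u₀
      (mdifferentiableAt_extChartAt (mem_chart_source EY (Ψ u₀)))
      ((hΨ.contMDiffAt (hΩ.mem_nhds hu₀)).mdifferentiableAt (by norm_num))) v
  obtain ⟨K, e, hae, heΩ, he1, he, hes⟩ :=
    exists_openPartialHomeomorph_of_surjective hΩc hac hF hsurj
  have hO : IsOpen ((chartAt EB u₀).source ∩ κ ⁻¹' e.source) := by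
    have := (continuousOn_extChartAt (I := 𝓘(ℝ, EB)) u₀).isOpen_inter_preimage
      (isOpen_extChartAt_source u₀) e.open_source
    rwa [extChartAt_source] at this
  have hleft : ∀ u ∈ (chartAt EB u₀).source, κ.symm (κ u) = u := fun u hu =>
    κ.left_inv (by rw [hκ, extChartAt_source]; exact hu)
  exact ⟨{
    K := K
    α := fun t => κ.symm (e.symm t)
    β := fun u => e (κ u)
    O := (chartAt EB u₀).source ∩ κ ⁻¹' e.source
    T := e.target
    isOpen_O := hO
    isOpen_T := e.open_target
    mem := ⟨mem_chart_source EB u₀, hae⟩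
    subset := fun u hu => by
      have := (heΩ hu.2).2.1
      rwa [hleft u hu.1] at this
    mapsTo_source := fun u hu => by
      have := (heΩ hu.2).2.2
      rwa [hleft u hu.1] at this
    β_mem := fun u hu => e.map_source hu.2
    α_mem := fun t ht => by
      have h1 := (heΩ (e.map_target ht)).1
      refine ⟨hsrc _ h1, ?_⟩
      rw [Set.mem_preimage, κ.right_inv h1]
      exact e.map_target ht
    α_β := fun u hu => by
      rw [e.left_inv hu.2, hleft u hu.1]
    β_α := fun t ht => by
      rw [κ.right_inv (heΩ (e.map_target ht)).1, e.right_inv ht]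
    β_fst := fun u hu => by
      rw [he1 _ hu.2, Function.comp_apply, hleft u hu.1]
    smooth_α := fun t ht => by
      have h1 := (heΩ (e.map_target ht)).1
      have h2 : ContMDiffAt 𝓘(ℝ, EB) 𝓘(ℝ, EB) ∞ κ.symm (e.symm t) :=
        (contMDiffOn_extChartAt_symm u₀).contMDiffAt (extChartAt_target_mem_nhds' h1)
      exact (ContMDiffAt.comp (I' := 𝓘(ℝ, EB)) t h2
        (hes.contDiffAt (e.open_target.mem_nhds ht)).contMDiffAt).contMDiffWithinAt
    smooth_β := fun u hu =>
      (ContMDiffAt.comp (I' := 𝓘(ℝ, EB)) u (he.contDiffAt (e.open_source.mem_nhds hu.2)).contMDiffAt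
        (contMDiffAt_extChartAt' hu.1)).contMDiffWithinAt }⟩

variable {Ψ : B → Y} {Ω : Set B} {u₀ : B}

/-- A submersion has local sections through every point. -/
theorem exists_local_section (hΩ : IsOpen Ω) (hu₀ : u₀ ∈ Ω)
    (hΨ : ContMDiffOn 𝓘(ℝ, EB) 𝓘(ℝ, EY) ∞ Ψ Ω)
    (hs : Function.Surjective (mfderiv 𝓘(ℝ, EB) 𝓘(ℝ, EY) Ψ u₀)) :
    ∃ (s : Y → B) (O : Set Y), IsOpen O ∧ Ψ u₀ ∈ O ∧ ContMDiffOn 𝓘(ℝ, EY) 𝓘(ℝ, EB) ∞ s O ∧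
      s (Ψ u₀) = u₀ ∧ ∀ z ∈ O, s z ∈ Ω ∧ Ψ (s z) = z := by
  obtain ⟨c⟩ := nonempty_submersionChart hΩ hu₀ hΨ hs
  set κ' := extChartAt 𝓘(ℝ, EY) (Ψ u₀) with hκ'
  -- The local section keeps the fibre coordinate of `u₀` fixed.
  let j : Y → EY × c.K := fun z => (κ' z, (c.β u₀).2)
  have hj : ContMDiffOn 𝓘(ℝ, EY) 𝓘(ℝ, EY × c.K) ∞ j (chartAt EY (Ψ u₀)).source :=
    contMDiffOn_extChartAt.prodMk_space contMDiffOn_const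
  have hO : IsOpen ((chartAt EY (Ψ u₀)).source ∩ j ⁻¹' c.T) :=
    hj.continuousOn.isOpen_inter_preimage (chartAt EY (Ψ u₀)).open_source c.isOpen_T
  have hj0 : j (Ψ u₀) = c.β u₀ := Prod.ext (c.β_fst u₀ c.mem).symm rfl
  refine ⟨fun z => c.α (j z), _, hO, ⟨mem_chart_source EY (Ψ u₀), ?_⟩, ?_, ?_, fun z hz => ?_⟩
  · rw [Set.mem_preimage, hj0]
    exact c.β_mem u₀ c.mem
  · exact c.smooth_α.comp (hj.mono Set.inter_subset_left) fun z hz => hz.2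
  · simp only [hj0, c.α_β u₀ c.mem]
  · have h1 := c.α_mem _ hz.2
    refine ⟨c.subset h1, ?_⟩
    have h2 := c.β_fst _ h1
    rw [c.β_α _ hz.2] at h2
    have h3 := c.mapsTo_source _ h1
    refine κ'.injOn (by rw [hκ', extChartAt_source]; exact h3)
      (by rw [hκ', extChartAt_source]; exact hz.1) h2.symm

/-- In the coordinates `α` the map `Ψ` is the first projection, so moving in `K` does not change its
value. -/
theorem SubmersionChart.mfderiv_α_mem_ker (c : SubmersionChart EB EY Ψ Ω u₀) (hΩ : IsOpen Ω)
    (hΨ : ContMDiffOn 𝓘(ℝ, EB) 𝓘(ℝ, EY) ∞ Ψ Ω) {t : EY × c.K} (ht : t ∈ c.T) (k : c.K) :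
    mfderiv 𝓘(ℝ, EB) 𝓘(ℝ, EY) Ψ (c.α t)
      (mfderiv 𝓘(ℝ, EY × c.K) 𝓘(ℝ, EB) c.α t ((0 : EY), k) : EB) = 0 := by
  have := isManifold_one (E := EY) (M := Y)
  have hO := c.α_mem t ht
  refine (chartCoord_bijective (c.mapsTo_source _ hO)).1 ?_
  rw [map_zero]
  have hα : MDifferentiableAt 𝓘(ℝ, EY × c.K) 𝓘(ℝ, EB) c.α t :=
    (c.smooth_α.contMDiffAt (c.isOpen_T.mem_nhds ht)).mdifferentiableAt (by norm_num)
  have hΨ' : MDifferentiableAt 𝓘(ℝ, EB) 𝓘(ℝ, EY) Ψ (c.α t) :=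
    (hΨ.contMDiffAt (hΩ.mem_nhds (c.subset hO))).mdifferentiableAt (by norm_num)
  have hκ : MDifferentiableAt 𝓘(ℝ, EY) 𝓘(ℝ, EY) (extChartAt 𝓘(ℝ, EY) (Ψ u₀)) (Ψ (c.α t)) :=
    mdifferentiableAt_extChartAt (c.mapsTo_source _ hO)
  have h1 := DFunLike.congr_fun (mfderiv_comp (I' := 𝓘(ℝ, EB)) t
    (MDifferentiableAt.comp (I' := 𝓘(ℝ, EY)) (c.α t) hκ hΨ') hα) (((0 : EY), k) : EY × c.K)
  have h2 := DFunLike.congr_fun (mfderiv_comp (I' := 𝓘(ℝ, EY)) (c.α t) hκ hΨ')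
    (mfderiv 𝓘(ℝ, EY × c.K) 𝓘(ℝ, EB) c.α t ((0 : EY), k) : EB)
  refine h2.symm.trans (h1.symm.trans ?_)
  have h3 : ((extChartAt 𝓘(ℝ, EY) (Ψ u₀) ∘ Ψ) ∘ c.α) =ᶠ[𝓝 t] Prod.fst := by
    filter_upwards [c.isOpen_T.mem_nhds ht] with r hr
    have := c.β_fst _ (c.α_mem r hr)
    rw [c.β_α r hr] at this
    exact this.symm
  have h4 := DFunLike.congr_fun (h3.mfderiv_eq (I := 𝓘(ℝ, EY × c.K)) (I' := 𝓘(ℝ, EY)))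
    (((0 : EY), k) : EY × c.K)
  refine h4.trans ?_
  rw [mfderiv_eq_fderiv, fderiv_fst]
  rfl

theorem SubmersionChart.fderiv_comp_α (c : SubmersionChart EB EY Ψ Ω u₀) {g : B → W} {t : EY × c.K}
    (ht : t ∈ c.T) (hg : MDifferentiableAt 𝓘(ℝ, EB) 𝓘(ℝ, W) g (c.α t)) :
    DifferentiableAt ℝ (g ∘ c.α) t ∧ ∀ w : EY × c.K, fderiv ℝ (g ∘ c.α) t w =
      vd g (c.α t) (mfderiv 𝓘(ℝ, EY × c.K) 𝓘(ℝ, EB) c.α t w : EB) := by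
  have hα : MDifferentiableAt 𝓘(ℝ, EY × c.K) 𝓘(ℝ, EB) c.α t :=
    (c.smooth_α.contMDiffAt (c.isOpen_T.mem_nhds ht)).mdifferentiableAt (by norm_num)
  refine ⟨(MDifferentiableAt.comp (I' := 𝓘(ℝ, EB)) t hg hα).differentiableAt, fun w => ?_⟩
  rw [← mfderiv_eq_fderiv]
  exact DFunLike.congr_fun (mfderiv_comp (I' := 𝓘(ℝ, EB)) t hg hα) w

/-- A function whose derivative vanishes in the direction of the fibres of a submersion is locally
constant along the fibres. -/
theorem eventually_eq_of_vd_eq_zero (hΩ : IsOpen Ω) (hu₀ : u₀ ∈ Ω)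
    (hΨ : ContMDiffOn 𝓘(ℝ, EB) 𝓘(ℝ, EY) ∞ Ψ Ω)
    (hs : Function.Surjective (mfderiv 𝓘(ℝ, EB) 𝓘(ℝ, EY) Ψ u₀)) {g : B → W}
    (hg : ∀ᶠ u in 𝓝 u₀, Ψ u = Ψ u₀ → MDifferentiableAt 𝓘(ℝ, EB) 𝓘(ℝ, W) g u ∧
      ∀ v, mfderiv 𝓘(ℝ, EB) 𝓘(ℝ, EY) Ψ u v = 0 → vd g u v = 0) :
    ∀ᶠ u in 𝓝 u₀, Ψ u = Ψ u₀ → g u = g u₀ := by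
  obtain ⟨c⟩ := nonempty_submersionChart hΩ hu₀ hΨ hs
  obtain ⟨y₀, k₀, hβ⟩ : ∃ y₀ k₀, c.β u₀ = (y₀, k₀) := ⟨_, _, rfl⟩
  have ht₀ : (y₀, k₀) ∈ c.T := hβ ▸ c.β_mem u₀ c.mem
  have hα₀ : c.α (y₀, k₀) = u₀ := hβ ▸ c.α_β u₀ c.mem
  have hfib : ∀ u ∈ c.O, Ψ u = Ψ u₀ → (c.β u).1 = y₀ := by
    intro u hu h
    rw [c.β_fst u hu, h, ← c.β_fst u₀ c.mem, hβ]
  have hfib' : ∀ k, (y₀, k) ∈ c.T → Ψ (c.α (y₀, k)) = Ψ u₀ := by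
    intro k hk
    have h1 := c.β_fst _ (c.α_mem _ hk)
    rw [c.β_α _ hk] at h1
    have h2 := c.β_fst _ c.mem
    rw [hβ] at h2
    exact (extChartAt 𝓘(ℝ, EY) (Ψ u₀)).injOn
      (by rw [extChartAt_source]; exact c.mapsTo_source _ (c.α_mem _ hk))
      (by rw [extChartAt_source]; exact mem_chart_source EY _) (h1.symm.trans h2)
  have hcα : ContinuousAt (fun k : c.K => c.α (y₀, k)) k₀ :=
    ContinuousAt.comp (g := c.α) (f := fun k : c.K => (y₀, k))
      (c.smooth_α.contMDiffAt (c.isOpen_T.mem_nhds ht₀)).continuousAt (by fun_prop)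
  have hev : ∀ᶠ k in 𝓝 k₀, (y₀, k) ∈ c.T ∧ (Ψ (c.α (y₀, k)) = Ψ u₀ →
      MDifferentiableAt 𝓘(ℝ, EB) 𝓘(ℝ, W) g (c.α (y₀, k)) ∧
      ∀ v, mfderiv 𝓘(ℝ, EB) 𝓘(ℝ, EY) Ψ (c.α (y₀, k)) v = 0 → vd g (c.α (y₀, k)) v = 0) := by
    refine Filter.Eventually.and ?_ ?_
    · have : ContinuousAt (fun k : c.K => ((y₀, k) : EY × c.K)) k₀ := by fun_prop
      exact this (c.isOpen_T.mem_nhds ht₀)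
    · have h1 : Filter.Tendsto (fun k : c.K => c.α (y₀, k)) (𝓝 k₀) (𝓝 u₀) := by
        have h2 := hcα.tendsto
        simp only [hα₀] at h2
        exact h2
      exact h1.eventually hg
  -- A ball in the fibre coordinate is convex, so a function on it with zero derivative is constant.
  -- Only the slice over `y₀` is used, hence the hypothesis on `g` is needed on the fibre alone.
  obtain ⟨ε, hε, hball⟩ := Metric.eventually_nhds_iff_ball.1 hev
  have hconst : ∀ k ∈ Metric.ball k₀ ε, g (c.α (y₀, k)) = g u₀ := by
    intro k hk
    have hder : ∀ k ∈ Metric.ball k₀ ε,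
        HasFDerivAt (fun k => (g ∘ c.α) (y₀, k)) (0 : c.K →L[ℝ] W) k := by
      intro k hk
      obtain ⟨h1, h2⟩ := hball k hk
      obtain ⟨h3, h4⟩ := h2 (hfib' k h1)
      obtain ⟨h5, h6⟩ := c.fderiv_comp_α h1 h3
      have h7 := HasFDerivAt.comp (g := g ∘ c.α) (f := fun k => (y₀, k)) k h5.hasFDerivAt
        (hasFDerivAt_prodMk_right y₀ k)
      refine h7.congr_fderiv (ContinuousLinearMap.ext fun w => ?_)
      change fderiv ℝ (g ∘ c.α) (y₀, k) ((0 : EY), w) = 0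
      rw [h6]
      exact h4 _ (c.mfderiv_α_mem_ker hΩ hΨ h1 w)
    have h8 := (convex_ball k₀ ε).is_const_of_fderivWithin_eq_zero (𝕜 := ℝ)
      (f := fun k => (g ∘ c.α) (y₀, k))
      (fun k hk => (hder k hk).differentiableAt.differentiableWithinAt)
      (fun k hk => by
        rw [fderivWithin_of_isOpen Metric.isOpen_ball hk]
        exact (hder k hk).fderiv) hk (Metric.mem_ball_self hε)
    refine h8.trans ?_
    rw [Function.comp_apply, hα₀]
  have hcβ : ContinuousAt (fun u => (c.β u).2) u₀ :=
    continuous_snd.continuousAt.comp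
      (c.smooth_β.contMDiffAt (c.isOpen_O.mem_nhds c.mem)).continuousAt
  have hb : Metric.ball k₀ ε ∈ 𝓝 (c.β u₀).2 := by
    rw [hβ]
    exact Metric.ball_mem_nhds _ hε
  filter_upwards [c.isOpen_O.mem_nhds c.mem, hcβ hb] with u hu hub h
  have h1 := hconst _ hub
  have h2 : (y₀, (c.β u).2) = c.β u := Prod.ext (hfib u hu h).symm rfl
  rwa [h2, c.α_β u hu] at h1

/-- The derivative of a function that is constant along the fibres of a submersion vanishes in the
direction of the fibres. -/
theorem vd_eq_zero_of_eventually_eq (hΩ : IsOpen Ω) (hu₀ : u₀ ∈ Ω)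
    (hΨ : ContMDiffOn 𝓘(ℝ, EB) 𝓘(ℝ, EY) ∞ Ψ Ω)
    (hs : Function.Surjective (mfderiv 𝓘(ℝ, EB) 𝓘(ℝ, EY) Ψ u₀)) {g : B → W}
    (hg : MDifferentiableAt 𝓘(ℝ, EB) 𝓘(ℝ, W) g u₀)
    (hconst : ∀ᶠ u in 𝓝 u₀, Ψ u = Ψ u₀ → g u = g u₀) {v : TangentSpace 𝓘(ℝ, EB) u₀}
    (hv : mfderiv 𝓘(ℝ, EB) 𝓘(ℝ, EY) Ψ u₀ v = 0) : vd g u₀ v = 0 := by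
  have := isManifold_one (E := EY) (M := Y)
  obtain ⟨c⟩ := nonempty_submersionChart hΩ hu₀ hΨ hs
  have ht₀ := c.β_mem u₀ c.mem
  have hα₀ := c.α_β u₀ c.mem
  have hβd : MDifferentiableAt 𝓘(ℝ, EB) 𝓘(ℝ, EY × c.K) c.β u₀ :=
    (c.smooth_β.contMDiffAt (c.isOpen_O.mem_nhds c.mem)).mdifferentiableAt (by norm_num)
  have hΨd : MDifferentiableAt 𝓘(ℝ, EB) 𝓘(ℝ, EY) Ψ u₀ :=
    (hΨ.contMDiffAt (hΩ.mem_nhds hu₀)).mdifferentiableAt (by norm_num)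
  have hgd : MDifferentiableAt 𝓘(ℝ, EB) 𝓘(ℝ, W) g (c.α (c.β u₀)) := by rwa [hα₀]
  obtain ⟨h1, -⟩ := c.fderiv_comp_α ht₀ hgd
  have h2 : vd g u₀ v = fderiv ℝ (g ∘ c.α) (c.β u₀) (vd c.β u₀ v) := by
    rw [← vd_comp h1 hβd]
    refine vd_congr ?_ v
    filter_upwards [c.isOpen_O.mem_nhds c.mem] with u hu
    rw [Function.comp_apply, c.α_β u hu]
  have h3 : (vd c.β u₀ v).1 = 0 := by
    refine (vd_clm (ContinuousLinearMap.fst ℝ EY c.K) hβd v).symm.trans ?_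
    have h4 : (fun u => ContinuousLinearMap.fst ℝ EY c.K (c.β u)) =ᶠ[𝓝 u₀]
        fun u => extChartAt 𝓘(ℝ, EY) (Ψ u₀) (Ψ u) := by
      filter_upwards [c.isOpen_O.mem_nhds c.mem] with u hu
      exact c.β_fst u hu
    rw [vd_congr h4]
    refine (DFunLike.congr_fun (mfderiv_comp (I' := 𝓘(ℝ, EY)) u₀
      (mdifferentiableAt_extChartAt (mem_chart_source EY (Ψ u₀))) hΨd) v).trans ?_
    exact (congrArg (chartCoord (E := EY) (Ψ u₀) (Ψ u₀)) hv).trans (map_zero _)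
  obtain ⟨w, hw⟩ : ∃ w : c.K, vd c.β u₀ v = ((0 : EY), w) := ⟨_, Prod.ext h3 rfl⟩
  rw [h2, hw]
  clear hw h2 h3
  obtain ⟨y₀, k₀, hβ⟩ : ∃ y₀ k₀, c.β u₀ = (y₀, k₀) := ⟨_, _, rfl⟩
  rw [hβ] at h1 ht₀ ⊢
  have h5 := HasFDerivAt.comp (g := g ∘ c.α) (f := fun k => (y₀, k)) k₀ h1.hasFDerivAt
    (hasFDerivAt_prodMk_right y₀ k₀)
  have hfib' : ∀ k, (y₀, k) ∈ c.T → Ψ (c.α (y₀, k)) = Ψ u₀ := by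
    intro k hk
    have h1 := c.β_fst _ (c.α_mem _ hk)
    rw [c.β_α _ hk] at h1
    have h2 := c.β_fst _ c.mem
    rw [hβ] at h2
    exact (extChartAt 𝓘(ℝ, EY) (Ψ u₀)).injOn
      (by rw [extChartAt_source]; exact c.mapsTo_source _ (c.α_mem _ hk))
      (by rw [extChartAt_source]; exact mem_chart_source EY _) (h1.symm.trans h2)
  rw [hβ] at hα₀
  have hcα : Filter.Tendsto (fun k : c.K => c.α (y₀, k)) (𝓝 k₀) (𝓝 u₀) := by
    have h2 : ContinuousAt (fun k : c.K => c.α (y₀, k)) k₀ :=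
      ContinuousAt.comp (g := c.α) (f := fun k : c.K => (y₀, k))
        (c.smooth_α.contMDiffAt (c.isOpen_T.mem_nhds ht₀)).continuousAt (by fun_prop)
    have h3 := h2.tendsto
    simp only [hα₀] at h3
    exact h3
  have h6 : (fun k => (g ∘ c.α) (y₀, k)) =ᶠ[𝓝 k₀] fun _ => g u₀ := by
    have hT : ContinuousAt (fun k : c.K => ((y₀, k) : EY × c.K)) k₀ := by fun_prop
    filter_upwards [hcα.eventually hconst, hT (c.isOpen_T.mem_nhds ht₀)] with k hk hkT
    exact hk (hfib' k hkT)
  exact DFunLike.congr_fun (h5.unique ((hasFDerivAt_const (g u₀) k₀).congr_of_eventuallyEq h6)) w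

end Submersions

/-! ### The Cartan connection as a parallelism; torsion and filtration -/

section FrameMaps

variable {EB : Type*} [NormedAddCommGroup EB] [NormedSpace ℝ EB]
  {B : Type*} [TopologicalSpace B] [ChartedSpace EB B]
  {EY : Type*} [NormedAddCommGroup EY] [NormedSpace ℝ EY]
  {Y : Type*} [TopologicalSpace Y] [ChartedSpace EY Y]
  {V : Type*} [NormedAddCommGroup V] [NormedSpace ℝ V]
  (θ : ∀ u : B, TangentSpace 𝓘(ℝ, EB) u ≃L[ℝ] V)

variable (EY) in
/-- The derivative of a map between manifolds in the directions of the constant vector fields of a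
parallelism. -/
noncomputable def lam (Ψ : B → Y) (u : B) : V →L[ℝ] EY :=
  (mfderiv 𝓘(ℝ, EB) 𝓘(ℝ, EY) Ψ u : EB →L[ℝ] EY) ∘L
    ((θ u).symm.toContinuousLinearMap : V →L[ℝ] EB)

theorem lam_apply (Ψ : B → Y) (u : B) (X : V) :
    lam EY θ Ψ u X = (mfderiv 𝓘(ℝ, EB) 𝓘(ℝ, EY) Ψ u ((θ u).symm X) : EY) := rfl

end FrameMaps

namespace ParabolicGeometry

variable {EG : Type*} [NormedAddCommGroup EG] [NormedSpace ℝ EG] [FiniteDimensional ℝ EG]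
  {G : Type*} [TopologicalSpace G] [ChartedSpace EG G] [Group G] [LieGroup 𝓘(ℝ, EG) ∞ G]
  {EP : Type*} [NormedAddCommGroup EP] [NormedSpace ℝ EP] [FiniteDimensional ℝ EP]
  {P : Type*} [TopologicalSpace P] [ChartedSpace EP P] [Group P] [LieGroup 𝓘(ℝ, EP) ∞ P]
  {EQ : Type*} [NormedAddCommGroup EQ] [NormedSpace ℝ EQ] [FiniteDimensional ℝ EQ]
  {Q : Type*} [TopologicalSpace Q] [ChartedSpace EQ Q] [Group Q] [LieGroup 𝓘(ℝ, EQ) ∞ Q]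
  {EM : Type*} [NormedAddCommGroup EM] [NormedSpace ℝ EM] [FiniteDimensional ℝ EM]
  {M : Type*} [TopologicalSpace M] [ChartedSpace EM M] [IsManifold 𝓘(ℝ, EM) ∞ M]
  {EB : Type*} [NormedAddCommGroup EB] [NormedSpace ℝ EB] [FiniteDimensional ℝ EB]
  {B : Type*} [TopologicalSpace B] [ChartedSpace EB B] [IsManifold 𝓘(ℝ, EB) ∞ B]
  {D : NestedParabolics (Lie EG G)} {H : NestedGroups D EP P EQ Q}
  (C : ParabolicGeometry H EM M EB B)

/-- The Cartan connection as a parallelism with values in the model space of `G`. -/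
def par (u : B) : TangentSpace 𝓘(ℝ, EB) u ≃L[ℝ] EG := C.conn u

theorem isSmoothPar_par : IsSmoothPar C.par := C.smooth_conn

theorem mdifferentiableAt_π (u : B) : MDifferentiableAt 𝓘(ℝ, EB) 𝓘(ℝ, EM) C.π u :=
  C.smooth_π.contMDiffAt.mdifferentiableAt (by norm_num)

theorem exists_act_eq {u u' : B} (h : C.π u = C.π u') : ∃ q, C.act u q = u' := by
  obtain ⟨O, -, hxO, s, t, -, -, -, hst, -⟩ := C.locally_trivial (C.π u)
  have h1 := hst u hxO
  have h2 := hst u' (show C.π u' ∈ O from h ▸ hxO)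
  refine ⟨(t u)⁻¹ * t u', ?_⟩
  calc C.act u ((t u)⁻¹ * t u') = C.act (C.act (s (C.π u)) (t u)) ((t u)⁻¹ * t u') := by rw [h1]
    _ = u' := by rw [← C.act_mul, mul_inv_cancel_left, h, h2]

theorem exists_section_through (u : B) : ∃ (s : M → B) (O : Set M), IsOpen O ∧ C.π u ∈ O ∧
    ContMDiffOn 𝓘(ℝ, EM) 𝓘(ℝ, EB) ∞ s O ∧ s (C.π u) = u ∧ ∀ y ∈ O, C.π (s y) = y := by
  obtain ⟨O, hO, hxO, s, t, hs, -, hπ, hst, -⟩ := C.locally_trivial (C.π u)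
  refine ⟨fun y => C.act (s y) (t u), O, hO, hxO, ?_, hst u hxO, fun y hy => ?_⟩
  · have h1 : ContMDiffOn 𝓘(ℝ, EM) (𝓘(ℝ, EB).prod 𝓘(ℝ, EQ)) ∞ (fun y => (s y, t u)) O :=
      hs.prodMk contMDiffOn_const
    exact C.smooth_act.comp_contMDiffOn h1
  · rw [C.π_act, hπ y hy]

theorem π_surjective : Function.Surjective C.π := fun x => by
  obtain ⟨O, hO, hxO, s, t, hs, -, hπ, hst, -⟩ := C.locally_trivial x
  exact ⟨s x, hπ x hxO⟩

theorem mfderiv_π_surjective (u : B) : Function.Surjective (mfderiv 𝓘(ℝ, EB) 𝓘(ℝ, EM) C.π u) := by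
  obtain ⟨s, O, hO, hxO, hs, hsu, hπs⟩ := C.exists_section_through u
  intro v
  have hsd : MDifferentiableAt 𝓘(ℝ, EM) 𝓘(ℝ, EB) s (C.π u) :=
    (hs.contMDiffAt (hO.mem_nhds hxO)).mdifferentiableAt (by norm_num)
  refine ⟨(mfderiv 𝓘(ℝ, EM) 𝓘(ℝ, EB) s (C.π u) v : EB), ?_⟩
  have h1 := DFunLike.congr_fun (mfderiv_comp (I' := 𝓘(ℝ, EB)) (C.π u)
    (C.mdifferentiableAt_π (s (C.π u))) hsd) v
  have h2 : (C.π ∘ s) =ᶠ[𝓝 (C.π u)] id := by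
    filter_upwards [hO.mem_nhds hxO] with y hy
    exact hπs y hy
  have h3 := DFunLike.congr_fun (h2.mfderiv_eq (I := 𝓘(ℝ, EM)) (I' := 𝓘(ℝ, EM))) v
  have h4 := DFunLike.congr_fun (mfderiv_id (I := 𝓘(ℝ, EM)) (x := C.π u)) v
  have h5 : ∀ u', u' = u → ∀ w : EB, (mfderiv 𝓘(ℝ, EB) 𝓘(ℝ, EM) C.π u w : EM) =
      mfderiv 𝓘(ℝ, EB) 𝓘(ℝ, EM) C.π u' w := by
    rintro u' rfl w; rfl
  exact (h5 _ hsu _).trans (h1.symm.trans (h3.trans h4))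

/-- The vertical vectors are the fundamental ones. -/
theorem conn_mem_𝔮_of_mfderiv_π_eq_zero (u : B) (v : TangentSpace 𝓘(ℝ, EB) u)
    (hv : mfderiv 𝓘(ℝ, EB) 𝓘(ℝ, EM) C.π u v = 0) : C.conn u v ∈ D.𝔮 := by
  have := isManifold_one (E := EB) (M := B)
  obtain ⟨O, hO, hxO, s, t, -, ht, -, hst, -⟩ := C.locally_trivial (C.π u)
  have hOB : IsOpen (C.π ⁻¹' O) := hO.preimage C.smooth_π.continuous
  -- On the fibre through `u` one has `u' = u · c u'`. So the identity and `u' ↦ u · c u'` have the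
  -- same derivative on vertical vectors, which exhibits these as fundamental vectors.
  let c : B → Q := fun u' => (t u)⁻¹ * t u'
  have hc1 : c u = 1 := inv_mul_cancel _
  have hc : MDifferentiableAt 𝓘(ℝ, EB) 𝓘(ℝ, EQ) c u := by
    have h1 : ContMDiffAt 𝓘(ℝ, EB) 𝓘(ℝ, EQ) ∞ c u :=
      contMDiffAt_const.mul (ht.contMDiffAt (hOB.mem_nhds hxO))
    exact h1.mdifferentiableAt (by norm_num)
  have hact : ∀ q, MDifferentiableAt 𝓘(ℝ, EQ) 𝓘(ℝ, EB) (fun q => C.act u q) q := by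
    intro q
    have h1 : ContMDiffAt 𝓘(ℝ, EQ) 𝓘(ℝ, EB) ∞ (fun q => C.act u q) q :=
      C.smooth_act.contMDiffAt.comp q (contMDiffAt_const.prodMk contMDiffAt_id)
    exact h1.mdifferentiableAt (by norm_num)
  have hfib : ∀ u', C.π u' = C.π u → C.act u (c u') = u' := by
    intro u' h
    have h1 := hst u hxO
    have h2 := hst u' (show C.π u' ∈ O from h ▸ hxO)
    calc C.act u (c u') = C.act (C.act (s (C.π u)) (t u)) ((t u)⁻¹ * t u') := by rw [h1]
      _ = u' := by rw [← C.act_mul, mul_inv_cancel_left, ← h, h2]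
  set κ := extChartAt 𝓘(ℝ, EB) u
  have hκ : ∀ u', u' = u → MDifferentiableAt 𝓘(ℝ, EB) 𝓘(ℝ, EB) κ u' := by
    rintro u' rfl
    exact mdifferentiableAt_extChartAt (mem_chart_source EB u')
  have hcu : C.act u (c u) = u := hfib u rfl
  have hh : MDifferentiableAt 𝓘(ℝ, EB) 𝓘(ℝ, EB) (fun u' => C.act u (c u')) u :=
    MDifferentiableAt.comp (I' := 𝓘(ℝ, EQ)) u (hact _) hc
  have hκh : MDifferentiableAt 𝓘(ℝ, EB) 𝓘(ℝ, EB) (fun u' => κ (C.act u (c u'))) u :=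
    MDifferentiableAt.comp (I' := 𝓘(ℝ, EB)) u (hκ _ hcu) hh
  -- The two maps are subtracted after composition with the chart `κ`; the difference vanishes on
  -- the fibre.
  have h0 := vd_eq_zero_of_eventually_eq (Ω := Set.univ) isOpen_univ (Set.mem_univ u)
    C.smooth_π.contMDiffOn (C.mfderiv_π_surjective u) (g := fun u' => κ u' - κ (C.act u (c u')))
    ((hκ u rfl).sub hκh)
    (Filter.Eventually.of_forall fun u' h => by simp only [hfib u' h, hcu, sub_self]) hv
  have h1 : vd (fun u' => κ u' - κ (C.act u (c u'))) u v =
      vd κ u v - vd (fun u' => κ (C.act u (c u'))) u v :=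
    DFunLike.congr_fun (mfderiv_sub (hκ u rfl) hκh) v
  rw [h1, sub_eq_zero] at h0
  have h2 : (vd (fun u' => κ (C.act u (c u'))) u v : EB) =
      mfderiv 𝓘(ℝ, EB) 𝓘(ℝ, EB) (fun u' => C.act u (c u')) u v := by
    refine (DFunLike.congr_fun (mfderiv_comp (I' := 𝓘(ℝ, EB)) u (hκ _ hcu) hh) v).trans ?_
    exact chartCoord_of_eq (E := EB) hcu
      (mfderiv 𝓘(ℝ, EB) 𝓘(ℝ, EB) (fun u' => C.act u (c u')) u v : EB)
  have h3 : (v : EB) = mfderiv 𝓘(ℝ, EB) 𝓘(ℝ, EB) (fun u' => C.act u (c u')) u v :=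
    (chartCoord_self u v).symm.trans (h0.trans h2)
  have h4 := DFunLike.congr_fun (mfderiv_comp (I' := 𝓘(ℝ, EQ)) u (hact (c u)) hc) v
  have h5 : ∀ q : Q, q = 1 → ∀ w : EQ, (mfderiv 𝓘(ℝ, EQ) 𝓘(ℝ, EB) (fun q => C.act u q) q w : EB) =
      mfderiv 𝓘(ℝ, EQ) 𝓘(ℝ, EB) (fun q => C.act u q) 1 w := by
    rintro q rfl w; rfl
  have h6 := h3.trans (h4.trans (h5 _ hc1 _))
  have h7 := C.conn_fundamental u (mfderiv 𝓘(ℝ, EB) 𝓘(ℝ, EQ) c u v : EQ)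
  have h8 : ∀ u', u' = u → ∀ w : EB, (C.conn u w : EG) = C.conn u' w := by
    rintro u' rfl w; rfl
  have h9 : (C.conn u v : EG) =
      dHom (H.jP.comp H.jQ) (mfderiv 𝓘(ℝ, EB) 𝓘(ℝ, EQ) c u v : EQ) :=
    (congrArg (fun w : EB => (C.conn u w : EG)) h6).trans ((h8 _ (C.act_one u) _).trans h7)
  have h10 : dHom (H.jP.comp H.jQ) (mfderiv 𝓘(ℝ, EB) 𝓘(ℝ, EQ) c u v : EQ) ∈ D.𝔮 := by
    rw [← H.hQ.range_dHom]
    exact LinearMap.mem_range_self _ _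
  exact (congrArg (fun w : EG => (w : Lie EG G) ∈ D.𝔮) h9).mpr h10

theorem mem_fil_zero_of_toTangent_eq_zero {u : B} {X : Lie EG G} (h : C.toTangent u X = 0) :
    X ∈ D.fil 0 := by
  have h1 := C.conn_mem_𝔮_of_mfderiv_π_eq_zero u ((C.conn u).symm X) h
  rw [ContinuousLinearEquiv.apply_symm_apply] at h1
  exact 𝔮_le_fil_zero H h1

/-- The derivative of a map from the base in the constant directions is equivariant. -/
theorem lam_act {EY : Type*} [NormedAddCommGroup EY] [NormedSpace ℝ EY]
    {Y : Type*} [TopologicalSpace Y] [ChartedSpace EY Y] {g : M → Y} {u : B} (q : Q)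
    (hg : MDifferentiableAt 𝓘(ℝ, EM) 𝓘(ℝ, EY) g (C.π u)) (X : EG) :
    lam EY C.par (fun u => g (C.π u)) (C.act u q) X =
      lam EY C.par (fun u => g (C.π u)) u (AdL (H.jP (H.jQ q)) X) := by
  have hr : MDifferentiableAt 𝓘(ℝ, EB) 𝓘(ℝ, EB) (fun u => C.act u q) u := by
    have h1 : ContMDiffAt 𝓘(ℝ, EB) 𝓘(ℝ, EB) ∞ (fun u => C.act u q) u :=
      C.smooth_act.contMDiffAt.comp u (contMDiffAt_id.prodMk contMDiffAt_const)
    exact h1.mdifferentiableAt (by norm_num)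
  have hg' : MDifferentiableAt 𝓘(ℝ, EM) 𝓘(ℝ, EY) g (C.π (C.act u q)) := by rwa [C.π_act]
  have hgπ : MDifferentiableAt 𝓘(ℝ, EB) 𝓘(ℝ, EY) (fun u => g (C.π u)) (C.act u q) :=
    MDifferentiableAt.comp (I' := 𝓘(ℝ, EM)) _ hg' (C.mdifferentiableAt_π _)
  have h1 := DFunLike.congr_fun (mfderiv_comp (I' := 𝓘(ℝ, EB)) u hgπ hr)
    ((C.conn u).symm (Ad (H.jP (H.jQ q)) X))
  have h2 : (fun u => g (C.π u)) ∘ (fun u => C.act u q) = fun u => g (C.π u) := by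
    funext u
    simp only [Function.comp_apply, C.π_act]
  rw [h2] at h1
  have h3 := C.conn_equivariant u q ((C.conn u).symm (Ad (H.jP (H.jQ q)) X))
  rw [ContinuousLinearEquiv.apply_symm_apply] at h3
  have h4 := (ContinuousLinearEquiv.eq_symm_apply _).2 (h3.trans (Ad_inv_Ad (H.jP (H.jQ q)) X))
  refine Eq.trans ?_ h1.symm
  rw [lam_apply]
  exact congrArg (mfderiv 𝓘(ℝ, EB) 𝓘(ℝ, EY) (fun u => g (C.π u)) (C.act u q)) h4.symm

theorem toTangent_act (u : B) (q : Q) (X : EG) :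
    (C.toTangent (C.act u q) X : EM) = C.toTangent u (Ad (EG := EG) (H.jP (H.jQ q)) X) :=
  C.lam_act (EY := EM) (g := fun y => y) q mdifferentiableAt_id X

variable [LieAlgebra.IsSemisimple ℝ (Lie EG G)]

/-- The span over all points above `π u` is already the image at `u`, since these points differ by
elements of `Q` and `Ad` preserves `fil i`. -/
theorem tanFil_π (i : ℤ) (u : B) : C.tanFil i (C.π u) = (D.fil i).map (C.toTangent u) := by
  apply le_antisymm
  · refine Submodule.span_le.2 ?_
    rintro v ⟨u', Z, hZ, h⟩
    obtain ⟨h1, h2⟩ : C.π u = C.π u' ∧ (v : EM) = C.toTangent u' Z := by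
      have h1 := congrArg Bundle.TotalSpace.proj h
      refine ⟨h1, ?_⟩
      exact eq_of_heq ((Bundle.TotalSpace.mk.injEq _ _ _ _).mp h).2
    obtain ⟨q, rfl⟩ := C.exists_act_eq h1
    exact ⟨_, (Ad_mem_fil_iff H (H.jQ q) i Z).2 hZ, (h2.trans (C.toTangent_act u q Z)).symm⟩
  · rintro _ ⟨Z, hZ, rfl⟩
    exact Submodule.subset_span ⟨u, Z, hZ, rfl⟩

/-- For `i ≤ 0` the component `fil i` contains the kernel of `toTangent`, so nothing is lost in the
quotient. -/
theorem toTangent_mem_tanFil_iff {i : ℤ} (hi : i ≤ 0) (u : B) (X : Lie EG G) :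
    C.toTangent u X ∈ C.tanFil i (C.π u) ↔ X ∈ D.fil i := by
  rw [tanFil_π]
  constructor
  · rintro ⟨Z, hZ, h⟩
    have h1 : C.toTangent u (X - Z) = 0 := by rw [map_sub, h, sub_self]
    have h2 := Submodule.add_mem _ (D.fil_antitone hi (C.mem_fil_zero_of_toTangent_eq_zero h1)) hZ
    rwa [sub_add_cancel] at h2
  · exact Submodule.mem_map_of_mem

theorem relTangent_eq (x : M) : C.relTangent x = C.tanFil 0 x := by
  unfold relTangent tanFil
  rw [D.fil_zero]

/-- Torsion sees the curvature only modulo `𝔮`, but for `j ≤ 0` membership in `fil j` is insensitive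
to `𝔮`. -/
theorem curvature_mem_fil {i j : ℤ} (hi : i ≤ 0) (hj : j ≤ 0) (h : C.TorsionMapsTo i j) (u : B)
    {X Y : Lie EG G} (hX : X ∈ D.fil 0) (hY : Y ∈ D.fil i) : C.curvature u X Y ∈ D.fil j := by
  rw [← C.toTangent_mem_tanFil_iff hj]
  refine h u X Y ?_ ((C.toTangent_mem_tanFil_iff hi u Y).2 hY)
  rw [relTangent_eq]
  exact (C.toTangent_mem_tanFil_iff le_rfl u X).2 hX

/-- The bracket of constant fields is `[X, Y] - κ(X, Y)`, and both terms stay in `fil i`. -/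
theorem parBr_mem_fil {i : ℤ} (hi : i ≤ 0) (h : C.TorsionMapsTo i i) (u : B)
    {X Y : EG} (hX : (X : Lie EG G) ∈ D.fil 0) (hY : (Y : Lie EG G) ∈ D.fil i) :
    ((parBr C.par u X Y : EG) : Lie EG G) ∈ D.fil i := by
  have h1 := C.curvature_mem_fil hi hi h u hX hY
  have h2 : ((lieB G X Y : EG) : Lie EG G) ∈ D.fil i := D.lie_mem_fil_of_le (by omega) hX hY
  have h3 := Submodule.sub_mem _ h2 h1
  exact (congrArg (fun w : EG => (w : Lie EG G) ∈ D.fil i)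
    (sub_sub_cancel (lieB G X Y) (parBr C.par u X Y))).mp h3

/-- The difference is minus the curvature, so under the stronger torsion condition constant fields
bracket like Lie algebra elements on the graded pieces. -/
theorem parBr_sub_lie_mem_fil {i : ℤ} (hi : i < 0) (h : C.TorsionMapsTo i (i + 1)) (u : B)
    {X Y : EG} (hX : (X : Lie EG G) ∈ D.fil 0) (hY : (Y : Lie EG G) ∈ D.fil i) :
    ((parBr C.par u X Y - lieB G X Y : EG) : Lie EG G) ∈ D.fil (i + 1) := by
  have h1 := C.curvature_mem_fil hi.le (by omega) h u hX hY
  have h3 := Submodule.neg_mem _ h1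
  exact (congrArg (fun w : EG => (w : Lie EG G) ∈ D.fil (i + 1))
    (neg_sub (lieB G X Y) (parBr C.par u X Y))).mp h3

end ParabolicGeometry

/-! ### Evaluating tensorial constructions on frames -/

namespace TensorialConstruction

variable {ι : Type*} [Fintype ι] {n : ι → ℕ} {W : Type*} [NormedAddCommGroup W] [NormedSpace ℝ W]
  (F : TensorialConstruction n W) {E : ι → Type*} [∀ i, AddCommGroup (E i)] [∀ i, Module ℝ (E i)]

/-- The matrices of a family of maps with respect to frames. -/
noncomputable def matrixOf (φ : ∀ i, (Fin (n i) → ℝ) ≃ₗ[ℝ] E i)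
    (φ' : ∀ i, (Fin (n i) → ℝ) →ₗ[ℝ] E i) (i : ι) : (Fin (n i) → ℝ) →L[ℝ] (Fin (n i) → ℝ) :=
  LinearMap.toContinuousLinearMap ((φ i).symm.toLinearMap ∘ₗ φ' i)

theorem matrixOf_apply (φ : ∀ i, (Fin (n i) → ℝ) ≃ₗ[ℝ] E i)
    (φ' : ∀ i, (Fin (n i) → ℝ) →ₗ[ℝ] E i) (i : ι) (e : Fin (n i) → ℝ) :
    matrixOf φ φ' i e = (φ i).symm (φ' i e) := rfl

theorem comp_matrixOf (φ : ∀ i, (Fin (n i) → ℝ) ≃ₗ[ℝ] E i)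
    (φ' : ∀ i, (Fin (n i) → ℝ) →ₗ[ℝ] E i) :
    (fun i => (φ i).toLinearMap ∘ₗ (matrixOf φ φ' i).toLinearMap) = φ' := by
  funext i
  refine LinearMap.ext fun e => ?_
  simp [matrixOf_apply]

theorem isUnit_matrixOf (φ : ∀ i, (Fin (n i) → ℝ) ≃ₗ[ℝ] E i)
    {φ' : ∀ i, (Fin (n i) → ℝ) →ₗ[ℝ] E i} (h : ∀ i, Function.Bijective (φ' i)) :
    IsUnit (matrixOf φ φ') :=
  isUnit_of_bijective fun i => (φ i).symm.bijective.comp (h i)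

theorem rep_matrixOf (φ : ∀ i, (Fin (n i) → ℝ) ≃ₗ[ℝ] E i)
    {φ' : ∀ i, (Fin (n i) → ℝ) →ₗ[ℝ] E i} (h : ∀ i, Function.Bijective (φ' i)) (a : F.obj E) :
    F.rep (matrixOf φ φ') (a.1 φ') = a.1 fun i => (φ i).toLinearMap := by
  have := a.2.1 (fun i => (φ i).toLinearMap) (fun i => (φ i).bijective) (matrixOf φ φ')
    (isUnit_matrixOf φ h)
  rwa [comp_matrixOf] at this

/-- Elements of a tensorial construction are determined by their values on one frame. -/
theorem bijective_eval {φ : ∀ i, (Fin (n i) → ℝ) →ₗ[ℝ] E i} (hφ : ∀ i, Function.Bijective (φ i)) :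
    Function.Bijective (fun a : F.obj E => a.1 φ) := by
  classical
  let e : ∀ i, (Fin (n i) → ℝ) ≃ₗ[ℝ] E i := fun i => LinearEquiv.ofBijective (φ i) (hφ i)
  have he : (fun i => (e i).toLinearMap) = φ := rfl
  constructor
  · intro a a' h
    refine Subtype.ext (funext fun φ' => ?_)
    by_cases hφ' : ∀ i, Function.Bijective (φ' i)
    · refine (F.rep_bijective (isUnit_matrixOf e hφ')).1 ?_
      rw [F.rep_matrixOf e hφ', F.rep_matrixOf e hφ']
      exact h
    · rw [a.2.2 φ' hφ', a'.2.2 φ' hφ']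
  · intro w
    -- Equivariance forces the value on `φ'` once the value `w` on `φ` is prescribed; on tuples that
    -- are not frames `obj` requires zero.
    let s : (∀ i, (Fin (n i) → ℝ) →ₗ[ℝ] E i) → W := fun φ' =>
      if h : ∀ i, Function.Bijective (φ' i) then
        F.rep (matrixOf (fun i => LinearEquiv.ofBijective (φ' i) (h i)) φ) w else 0
    have hs : s ∈ F.obj E := by
      refine ⟨fun φ' hφ' A hA => ?_, fun φ' hφ' => dif_neg hφ'⟩
      have hφA : ∀ i, Function.Bijective (φ' i ∘ₗ (A i).toLinearMap) := fun i =>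
        (hφ' i).comp (bijective_of_isUnit hA i)
      simp only [s, dif_pos hφ']
      rw [dif_pos hφA, ← F.rep_mul_apply hA (isUnit_matrixOf _ hφ)]
      congr 2
      funext i
      refine ContinuousLinearMap.ext fun v => ?_
      refine (hφ' i).1 ?_
      have h1 : ∀ v, φ' i (matrixOf (fun i => LinearEquiv.ofBijective (φ' i) (hφ' i)) φ i v) =
          φ i v := fun v => (LinearEquiv.ofBijective (φ' i) (hφ' i)).apply_symm_apply (φ i v)
      rw [h1]
      exact (LinearEquiv.ofBijective _ (hφA i)).apply_symm_apply (φ i v)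
    refine ⟨⟨s, hs⟩, ?_⟩
    simp only [s, dif_pos hφ]
    have h1 : matrixOf (fun i => LinearEquiv.ofBijective (φ i) (hφ i)) φ = 1 := by
      funext i
      refine ContinuousLinearMap.ext fun v => ?_
      exact (LinearEquiv.ofBijective (φ i) (hφ i)).symm_apply_apply v
    rw [h1, F.rep_one]
    rfl

end TensorialConstruction

/-! ### Frames of filtered vector spaces -/

section Frames

variable {EG : Type*} [NormedAddCommGroup EG] [NormedSpace ℝ EG] [FiniteDimensional ℝ EG]
  {G : Type*} [TopologicalSpace G] [ChartedSpace EG G] [Group G] [LieGroup 𝓘(ℝ, EG) ∞ G]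
  {D : NestedParabolics (Lie EG G)} {E : Type*} [AddCommGroup E] [Module ℝ E]
  {S : ℤ → Submodule ℝ E} {T T' : Lie EG G →ₗ[ℝ] E}

variable (D S T) in
/-- The linear map `T` identifies the filtered space `E` with a quotient of the Lie algebra by a
subspace of `𝔭`. -/
structure IsFrame : Prop where
  surj : Function.Surjective T
  ker : ∀ X, T X = 0 → X ∈ D.fil 0
  map_eq : ∀ i ≤ 0, (D.fil i).map T = S i

variable (D S T) in
/-- The map between subquotients induced by `T`. -/
noncomputable def grOf (i : ℤ) : D.VV i →ₗ[ℝ] Gr (S i) (S (i + 1)) :=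
  grMap T (D.fil i) (D.fil (i + 1)) (S i) (S (i + 1))

theorem IsFrame.mem_iff (h : IsFrame D S T) {i : ℤ} (hi : i ≤ 0) {X : Lie EG G} :
    T X ∈ S i ↔ X ∈ D.fil i := by
  rw [← h.map_eq i hi]
  constructor
  · rintro ⟨Z, hZ, hZX⟩
    have h1 : T (X - Z) = 0 := by rw [map_sub, hZX, sub_self]
    have h2 := Submodule.add_mem _ (D.fil_antitone hi (h.ker _ h1)) hZ
    rwa [sub_add_cancel] at h2
  · exact Submodule.mem_map_of_mem

theorem IsFrame.grOf_mk (h : IsFrame D S T) {i : ℤ} (hi : i < 0) (X : D.fil i) :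
    grOf D S T i (Submodule.Quotient.mk X) =
      Submodule.Quotient.mk ⟨T X, (h.mem_iff hi.le).2 X.2⟩ :=
  grMap_mk (fun _ hx => (h.mem_iff hi.le).2 hx)
    (fun _ hx => (h.mem_iff (show i + 1 ≤ 0 by omega)).2 hx) X

theorem IsFrame.grOf_bijective (h : IsFrame D S T) {i : ℤ} (hi : i < 0) :
    Function.Bijective (grOf D S T i) :=
  grMap_bijective (h.map_eq i hi.le) (fun _ hx => (h.mem_iff (show i + 1 ≤ 0 by omega)).2 hx)
    fun _ _ hx => (h.mem_iff (show i + 1 ≤ 0 by omega)).1 hx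

variable {ι : Type*} [Fintype ι] {n : ι → ℕ} {k : ι → ℤ}
  (b : ∀ i, (Fin (n i) → ℝ) ≃ₗ[ℝ] D.VV (k i))

theorem IsFrame.bijective_grOf_comp (h : IsFrame D S T) (hk : ∀ i, k i < 0) (i : ι) :
    Function.Bijective (grOf D S T (k i) ∘ₗ (b i).toLinearMap) :=
  (h.grOf_bijective (hk i)).comp (b i).bijective

/-- Functoriality of subquotients: reparametrizing a frame by `f` changes the graded frames by the
matrices of `f`. It serves both for the action of `Q` and for parallel transport. -/
theorem IsFrame.grOf_comp (h : IsFrame D S T) (hk : ∀ i, k i < 0) {f : Lie EG G →ₗ[ℝ] Lie EG G}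
    (hf : PreservesFil D f) (i : ι) : grOf D S (T ∘ₗ f) (k i) ∘ₗ (b i).toLinearMap =
      (grOf D S T (k i) ∘ₗ (b i).toLinearMap) ∘ₗ (grMat b f i).toLinearMap := by
  have h1 : k i ≤ 0 := (hk i).le
  have h2 : k i + 1 ≤ 0 := by have := hk i; omega
  refine LinearMap.ext fun e => ?_
  have h3 := grMap_grMap (hf _ h1) (hf _ h2) (fun _ hx => (h.mem_iff h1).2 hx)
    (fun _ hx => (h.mem_iff h2).2 hx) (b i e)
  refine h3.symm.trans ?_
  change _ = grOf D S T (k i) (b i (grMat b f i e))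
  rw [grMat_apply, LinearEquiv.apply_symm_apply]
  rfl

/-- The comparison of two frames of the same filtered space. -/
theorem IsFrame.preservesFil_of_rightInverse (h : IsFrame D S T) (h' : IsFrame D S T')
    {R : E →ₗ[ℝ] Lie EG G} (hR : ∀ y, T (R y) = y) : PreservesFil D (R ∘ₗ T') := by
  intro i hi x hx
  rw [← h.mem_iff hi, LinearMap.comp_apply, hR]
  exact (h'.mem_iff hi).2 hx

theorem IsFrame.comp_rightInverse {R : E →ₗ[ℝ] Lie EG G} (hR : ∀ y, T (R y) = y) :
    T ∘ₗ (R ∘ₗ T') = T' := LinearMap.ext fun x => hR (T' x)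

/-- Although `f` itself need not be invertible, it compares two families of isomorphisms on the
graded pieces. -/
theorem IsFrame.bijective_grMat (h : IsFrame D S T) (h' : IsFrame D S T') (hk : ∀ i, k i < 0)
    {f : Lie EG G →ₗ[ℝ] Lie EG G} (hf : PreservesFil D f) (hfT : T ∘ₗ f = T') :
    IsUnit (grMat b f) := by
  refine TensorialConstruction.isUnit_of_bijective fun i => ?_
  have h1 := h.grOf_comp b hk hf i
  rw [hfT] at h1
  have h2 := h'.bijective_grOf_comp b hk i
  rw [h1] at h2
  exact (Function.Bijective.of_comp_iff' (h.bijective_grOf_comp b hk i) _).1 h2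

end Frames

/-! ### Submersions adapted to the filtration -/

namespace ParabolicGeometry

variable {EG : Type*} [NormedAddCommGroup EG] [NormedSpace ℝ EG] [FiniteDimensional ℝ EG]
  {G : Type*} [TopologicalSpace G] [ChartedSpace EG G] [Group G] [LieGroup 𝓘(ℝ, EG) ∞ G]
  {EP : Type*} [NormedAddCommGroup EP] [NormedSpace ℝ EP] [FiniteDimensional ℝ EP]
  {P : Type*} [TopologicalSpace P] [ChartedSpace EP P] [Group P] [LieGroup 𝓘(ℝ, EP) ∞ P]
  {EQ : Type*} [NormedAddCommGroup EQ] [NormedSpace ℝ EQ] [FiniteDimensional ℝ EQ]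
  {Q : Type*} [TopologicalSpace Q] [ChartedSpace EQ Q] [Group Q] [LieGroup 𝓘(ℝ, EQ) ∞ Q]
  {EM : Type*} [NormedAddCommGroup EM] [NormedSpace ℝ EM] [FiniteDimensional ℝ EM]
  {M : Type*} [TopologicalSpace M] [ChartedSpace EM M] [IsManifold 𝓘(ℝ, EM) ∞ M]
  {EB : Type*} [NormedAddCommGroup EB] [NormedSpace ℝ EB] [FiniteDimensional ℝ EB]
  {B : Type*} [TopologicalSpace B] [ChartedSpace EB B] [IsManifold 𝓘(ℝ, EB) ∞ B]
  {EY : Type*} [NormedAddCommGroup EY] [NormedSpace ℝ EY] [FiniteDimensional ℝ EY]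
  {Y : Type*} [TopologicalSpace Y] [ChartedSpace EY Y] [IsManifold 𝓘(ℝ, EY) ∞ Y]
  {D : NestedParabolics (Lie EG G)} {H : NestedGroups D EP P EQ Q}
  (C : ParabolicGeometry H EM M EB B)

/-- The map `X ↦ T(g ∘ π) (ω_u⁻¹ X)`, considered as a map to the tangent space at `y`, which is
supposed to be `g (π u)`. -/
noncomputable def frm (g : M → Y) (u : B) (y : Y) : Lie EG G →ₗ[ℝ] TangentSpace 𝓘(ℝ, EY) y :=
  ((lam EY C.par (fun u => g (C.π u)) u).toLinearMap : EG →ₗ[ℝ] EY)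

theorem frm_eq_comp {g : M → Y} {u : B} (hg : MDifferentiableAt 𝓘(ℝ, EM) 𝓘(ℝ, EY) g (C.π u)) :
    C.frm g u (g (C.π u)) = (mfderiv 𝓘(ℝ, EM) 𝓘(ℝ, EY) g (C.π u)).toLinearMap ∘ₗ C.toTangent u := by
  refine LinearMap.ext fun X => ?_
  exact DFunLike.congr_fun (mfderiv_comp (I' := 𝓘(ℝ, EM)) u hg (C.mdifferentiableAt_π u))
    ((C.conn u).symm X)

variable (EY) in
/-- The map `g` is a submersion on `U` whose fibres are tangent to `T_ρ M`. -/
structure IsRelSubmersion (U : Set M) (g : M → Y) : Prop where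
  isOpen : IsOpen U
  smooth : ContMDiffOn 𝓘(ℝ, EM) 𝓘(ℝ, EY) ∞ g U
  surj : ∀ y ∈ U, Function.Surjective (mfderiv 𝓘(ℝ, EM) 𝓘(ℝ, EY) g y)
  ker : ∀ y ∈ U, ∀ v, mfderiv 𝓘(ℝ, EM) 𝓘(ℝ, EY) g y v = 0 → v ∈ C.tanFil 0 y

/-- The submersion `g` maps the filtration of `TM` to the filtration `A` of `TY`. -/
structure IsAdapted (U : Set M) (g : M → Y)
    (A : ℤ → ∀ y : Y, Submodule ℝ (TangentSpace 𝓘(ℝ, EY) y)) : Prop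
    extends C.IsRelSubmersion EY U g where
  map_eq : ∀ i ≤ 0, ∀ y ∈ U,
    (C.tanFil i y).map (mfderiv 𝓘(ℝ, EM) 𝓘(ℝ, EY) g y).toLinearMap = A i (g y)

theorem toTangent_surjective (u : B) : Function.Surjective (C.toTangent u) :=
  (C.mfderiv_π_surjective u).comp (C.conn u).symm.surjective

variable {U : Set M} {g : M → Y} {A : ℤ → ∀ y : Y, Submodule ℝ (TangentSpace 𝓘(ℝ, EY) y)}
variable {C}

theorem IsRelSubmersion.mdifferentiableAt (h : C.IsRelSubmersion EY U g) {y : M} (hy : y ∈ U) :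
    MDifferentiableAt 𝓘(ℝ, EM) 𝓘(ℝ, EY) g y :=
  (h.smooth.contMDiffAt (h.isOpen.mem_nhds hy)).mdifferentiableAt (by norm_num)

variable [LieAlgebra.IsSemisimple ℝ (Lie EG G)]

theorem IsAdapted.isFrame (h : C.IsAdapted U g A) {u : B} (hu : C.π u ∈ U) :
    IsFrame D (fun i => A i (g (C.π u))) (C.frm g u (g (C.π u))) := by
  rw [C.frm_eq_comp (h.mdifferentiableAt hu)]
  refine ⟨(h.surj _ hu).comp (C.toTangent_surjective u), fun X hX => ?_, fun i hi => ?_⟩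
  · exact (C.toTangent_mem_tanFil_iff le_rfl u X).1 (h.ker _ hu _ hX)
  · rw [Submodule.map_comp, ← C.tanFil_π, h.map_eq i hi _ hu]

theorem IsAdapted.isFrame_of_eq (h : C.IsAdapted U g A) {u : B} (hu : C.π u ∈ U) {y : Y}
    (hy : g (C.π u) = y) : IsFrame D (fun i => A i y) (C.frm g u y) := by
  subst hy
  exact h.isFrame hu

theorem IsRelSubmersion.frm_act (h : C.IsRelSubmersion EY U g) {u : B} (hu : C.π u ∈ U) (q : Q) (y : Y) :
    C.frm (EY := EY) g (C.act u q) y = C.frm g u y ∘ₗ Ad (H.jP (H.jQ q)) :=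
  LinearMap.ext fun X => C.lam_act (EY := EY) q (h.mdifferentiableAt hu) X

variable {ι : Type*} [Fintype ι] {n : ι → ℕ} {k : ι → ℤ}
  (b : ∀ i, (Fin (n i) → ℝ) ≃ₗ[ℝ] D.VV (k i))
  {W : Type*} [NormedAddCommGroup W] [NormedSpace ℝ W] (F : TensorialConstruction n W)

variable (C g A) in
/-- The frames of the subquotients of the filtration `A` at `y` induced by `u`. -/
noncomputable def grFrame (u : B) (y : Y) (i : ι) :
    (Fin (n i) → ℝ) →ₗ[ℝ] Gr (A (k i) y) (A (k i + 1) y) :=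
  grOf D (fun i => A i y) (C.frm g u y) (k i) ∘ₗ (b i).toLinearMap

theorem IsAdapted.bijective_grFrame (h : C.IsAdapted U g A) (hk : ∀ i, k i < 0) {u : B}
    (hu : C.π u ∈ U) {y : Y} (hy : g (C.π u) = y) (i : ι) :
    Function.Bijective (C.grFrame g A b u y i) :=
  (h.isFrame_of_eq hu hy).bijective_grOf_comp b hk i

/-- The frame at `u · q` is the frame at `u` composed with `Ad`, and elements of a tensorial
construction are equivariant under changes of frame. -/
theorem IsAdapted.rep_grFrame_act (h : C.IsAdapted U g A) (hk : ∀ i, k i < 0) {u : B}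
    (hu : C.π u ∈ U) {y : Y} (hy : g (C.π u) = y) (q : Q)
    (a : F.obj fun i => Gr (A (k i) y) (A (k i + 1) y)) :
    tensorRep H F k b (H.jQ q) (a.1 (C.grFrame g A b (C.act u q) y)) = a.1 (C.grFrame g A b u y) := by
  rw [tensorRep_eq, ← a.2.1 (C.grFrame g A b u y) (h.bijective_grFrame b hk hu hy) _
    (isUnit_grMat_Ad b H hk (H.jQ q))]
  refine congrArg _ (congrArg a.1 (funext fun i => ?_))
  unfold grFrame
  rw [h.frm_act hu, (h.isFrame_of_eq hu hy).grOf_comp b hk (preservesFil_Ad H _)]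

end ParabolicGeometry

/-! ### Smooth sections as smooth functions on the Cartan bundle -/

namespace ParabolicGeometry

variable {EG : Type*} [NormedAddCommGroup EG] [NormedSpace ℝ EG] [FiniteDimensional ℝ EG]
  {G : Type*} [TopologicalSpace G] [ChartedSpace EG G] [Group G] [LieGroup 𝓘(ℝ, EG) ∞ G]
  {EP : Type*} [NormedAddCommGroup EP] [NormedSpace ℝ EP] [FiniteDimensional ℝ EP]
  {P : Type*} [TopologicalSpace P] [ChartedSpace EP P] [Group P] [LieGroup 𝓘(ℝ, EP) ∞ P]
  {EQ : Type*} [NormedAddCommGroup EQ] [NormedSpace ℝ EQ] [FiniteDimensional ℝ EQ]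
  {Q : Type*} [TopologicalSpace Q] [ChartedSpace EQ Q] [Group Q] [LieGroup 𝓘(ℝ, EQ) ∞ Q]
  {EM : Type*} [NormedAddCommGroup EM] [NormedSpace ℝ EM] [FiniteDimensional ℝ EM]
  {M : Type*} [TopologicalSpace M] [ChartedSpace EM M] [IsManifold 𝓘(ℝ, EM) ∞ M]
  {EB : Type*} [NormedAddCommGroup EB] [NormedSpace ℝ EB] [FiniteDimensional ℝ EB]
  {B : Type*} [TopologicalSpace B] [ChartedSpace EB B] [IsManifold 𝓘(ℝ, EB) ∞ B]
  {EY : Type*} [NormedAddCommGroup EY] [NormedSpace ℝ EY] [FiniteDimensional ℝ EY]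
  {Y : Type*} [TopologicalSpace Y] [ChartedSpace EY Y] [IsManifold 𝓘(ℝ, EY) ∞ Y]
  {D : NestedParabolics (Lie EG G)} {H : NestedGroups D EP P EQ Q}
  {C : ParabolicGeometry H EM M EB B}
  {U : Set M} {g : M → Y} {A : ℤ → ∀ y : Y, Submodule ℝ (TangentSpace 𝓘(ℝ, EY) y)}

theorem IsRelSubmersion.isOpen_preimage (h : C.IsRelSubmersion EY U g) : IsOpen (C.π ⁻¹' U) :=
  h.isOpen.preimage C.smooth_π.continuous

theorem IsRelSubmersion.contMDiffOn_comp (h : C.IsRelSubmersion EY U g) :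
    ContMDiffOn 𝓘(ℝ, EB) 𝓘(ℝ, EY) ∞ (fun u => g (C.π u)) (C.π ⁻¹' U) :=
  h.smooth.comp C.smooth_π.contMDiffOn fun _ hu => hu

theorem IsRelSubmersion.contMDiffAt_comp (h : C.IsRelSubmersion EY U g) {u : B} (hu : C.π u ∈ U) :
    ContMDiffAt 𝓘(ℝ, EB) 𝓘(ℝ, EY) ∞ (fun u => g (C.π u)) u :=
  h.contMDiffOn_comp.contMDiffAt (h.isOpen_preimage.mem_nhds hu)

theorem IsRelSubmersion.mfderiv_comp_surjective (h : C.IsRelSubmersion EY U g) {u : B} (hu : C.π u ∈ U) :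
    Function.Surjective (mfderiv 𝓘(ℝ, EB) 𝓘(ℝ, EY) (fun u => g (C.π u)) u) := by
  rw [show (fun u => g (C.π u)) = g ∘ C.π from rfl, mfderiv_comp (I' := 𝓘(ℝ, EM)) u
    (h.mdifferentiableAt hu) (C.mdifferentiableAt_π u)]
  exact (h.surj _ hu).comp (C.mfderiv_π_surjective u)

variable (g) in
/-- The map `g ∘ π` in the chart at `y₀`. -/
noncomputable def chartMap (C : ParabolicGeometry H EM M EB B) (y₀ : Y) (u : B) : EY :=
  extChartAt 𝓘(ℝ, EY) y₀ (g (C.π u))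

theorem IsRelSubmersion.contMDiffAt_chartMap (h : C.IsRelSubmersion EY U g) {y₀ : Y} {u : B} (hu : C.π u ∈ U)
    (hy : g (C.π u) ∈ (chartAt EY y₀).source) :
    ContMDiffAt 𝓘(ℝ, EB) 𝓘(ℝ, EY) ∞ (C.chartMap (EY := EY) g y₀) u := by
  have := isManifold_one (E := EY) (M := Y)
  exact ContMDiffAt.comp (I' := 𝓘(ℝ, EY)) u (contMDiffAt_extChartAt' hy) (h.contMDiffAt_comp hu)

/-- In a fixed chart of `Y` the frame map is the derivative of a vector-valued function, so that
`fd_parBr` applies to it. -/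
theorem IsRelSubmersion.chartCoord_frm (h : C.IsRelSubmersion EY U g) {y₀ : Y} {u : B} (hu : C.π u ∈ U)
    (hy : g (C.π u) ∈ (chartAt EY y₀).source) (X : EG) :
    chartCoord y₀ (g (C.π u)) (C.frm g u (g (C.π u)) X) = fd C.par (C.chartMap (EY := EY) g y₀) u X := by
  have := isManifold_one (E := EY) (M := Y)
  exact (DFunLike.congr_fun (mfderiv_comp (I' := 𝓘(ℝ, EY)) u (mdifferentiableAt_extChartAt hy)
    ((h.contMDiffAt_comp hu).mdifferentiableAt (by norm_num))) ((C.par u).symm X)).symm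

theorem IsRelSubmersion.eventually_mem (h : C.IsRelSubmersion EY U g) {u₀ : B} (hu₀ : C.π u₀ ∈ U) :
    ∀ᶠ u in 𝓝 u₀, C.π u ∈ U ∧ g (C.π u) ∈ (chartAt EY (g (C.π u₀))).source :=
  Filter.Eventually.and (h.isOpen_preimage.mem_nhds hu₀)
    ((h.contMDiffAt_comp hu₀).continuousAt (chart_source_mem_nhds EY _))

/-- The vector fields along `g ∘ π` induced by smooth functions are smooth. -/
theorem IsRelSubmersion.contMDiffAt_frm (h : C.IsRelSubmersion EY U g) {u₀ : B} (hu₀ : C.π u₀ ∈ U) {X : B → EG}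
    (hX : ContMDiffAt 𝓘(ℝ, EB) 𝓘(ℝ, EG) ∞ X u₀) :
    ContMDiffAt 𝓘(ℝ, EB) 𝓘(ℝ, EY).tangent ∞
      (fun u => (⟨g (C.π u), C.frm g u (g (C.π u)) (X u)⟩ : TangentBundle 𝓘(ℝ, EY) Y)) u₀ := by
  refine contMDiffAt_tangent_iff.2 ⟨h.contMDiffAt_comp hu₀, ?_⟩
  have h1 : ContMDiffAt 𝓘(ℝ, EB) 𝓘(ℝ, EG →L[ℝ] EY) ∞
      (fd C.par (C.chartMap (EY := EY) g (g (C.π u₀)))) u₀ :=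
    contMDiffAt_fd C.isSmoothPar_par (h.contMDiffAt_chartMap hu₀ (mem_chart_source EY _))
  refine (h1.clm_apply hX).congr_of_eventuallyEq ?_
  filter_upwards [h.eventually_mem hu₀] with u hu
  exact h.chartCoord_frm hu.1 hu.2 (X u)

/-- Every smooth vector field along `g ∘ π` is locally induced by a smooth function. -/
theorem IsRelSubmersion.exists_frm_eq (h : C.IsRelSubmersion EY U g) {u₀ : B} (hu₀ : C.π u₀ ∈ U)
    {η : ∀ u, TangentSpace 𝓘(ℝ, EY) (g (C.π u))}
    (hη : ContMDiffAt 𝓘(ℝ, EB) 𝓘(ℝ, EY).tangent ∞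
      (fun u => (⟨g (C.π u), η u⟩ : TangentBundle 𝓘(ℝ, EY) Y)) u₀) :
    ∃ X : B → EG, ContMDiffAt 𝓘(ℝ, EB) 𝓘(ℝ, EG) ∞ X u₀ ∧
      ∀ᶠ u in 𝓝 u₀, C.frm g u (g (C.π u)) (X u) = η u := by
  set y₀ := g (C.π u₀) with hy₀
  have h1 := (contMDiffAt_tangent_iff.1 hη).2
  let L : B → EG →L[ℝ] EY := fd C.par (C.chartMap (EY := EY) g y₀)
  have hL : ContMDiffAt 𝓘(ℝ, EB) 𝓘(ℝ, EG →L[ℝ] EY) ∞ L u₀ :=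
    contMDiffAt_fd C.isSmoothPar_par (h.contMDiffAt_chartMap hu₀ (mem_chart_source EY _))
  have hLs : Function.Surjective (L u₀) := by
    intro y
    obtain ⟨w, rfl⟩ := (chartCoord_bijective (mem_chart_source EY y₀)).2 y
    obtain ⟨v, rfl⟩ := h.mfderiv_comp_surjective hu₀ w
    refine ⟨C.par u₀ v, ?_⟩
    refine (h.chartCoord_frm hu₀ (mem_chart_source EY y₀) _).symm.trans ?_
    refine congrArg (chartCoord y₀ y₀) ?_
    exact congrArg (mfderiv 𝓘(ℝ, EB) 𝓘(ℝ, EY) (fun u => g (C.π u)) u₀)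
      ((C.par u₀).symm_apply_apply v)
  obtain ⟨R₀, hR₀⟩ := (L u₀).toLinearMap.exists_rightInverse_of_surjective
    (LinearMap.range_eq_top.2 hLs)
  let R : EY →L[ℝ] EG := LinearMap.toContinuousLinearMap R₀
  have hR : L u₀ ∘L R = ContinuousLinearMap.id ℝ EY :=
    ContinuousLinearMap.ext fun y => DFunLike.congr_fun hR₀ y
  -- `N` is the identity at `u₀`, hence invertible nearby, and `R ∘ N⁻¹` is a smooth right inverse
  -- of `L`.
  let N : B → EY →L[ℝ] EY := fun u => L u ∘L R
  have hN : ContMDiffAt 𝓘(ℝ, EB) 𝓘(ℝ, EY →L[ℝ] EY) ∞ N u₀ :=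
    hL.clm_comp contMDiffAt_const
  have hN₀ : N u₀ = ((ContinuousLinearEquiv.refl ℝ EY : EY ≃L[ℝ] EY) : EY →L[ℝ] EY) := hR
  have hinv : ContDiffAt ℝ ∞ (ContinuousLinearMap.inverse : (EY →L[ℝ] EY) → EY →L[ℝ] EY)
      (N u₀) := by
    rw [hN₀]
    exact contDiffAt_map_inverse _
  have hNi : ContMDiffAt 𝓘(ℝ, EB) 𝓘(ℝ, EY →L[ℝ] EY) ∞ (fun u => (N u).inverse) u₀ :=
    ContMDiffAt.comp (I' := 𝓘(ℝ, EY →L[ℝ] EY)) u₀ hinv.contMDiffAt hN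
  refine ⟨fun u => R ((N u).inverse (chartCoord y₀ (g (C.π u)) (η u))), ?_, ?_⟩
  · exact ContMDiffAt.comp (I' := 𝓘(ℝ, EY)) u₀ R.contDiff.contMDiff.contMDiffAt (hNi.clm_apply h1)
  · have hev : ∀ᶠ u in 𝓝 u₀, N u ∈ Set.range ((↑) : (EY ≃L[ℝ] EY) → EY →L[ℝ] EY) := by
      refine hN.continuousAt ?_
      rw [hN₀]
      exact ContinuousLinearEquiv.nhds _
    filter_upwards [h.eventually_mem hu₀, hev] with u hu hNu
    obtain ⟨e, he⟩ := hNu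
    refine (chartCoord_bijective hu.2).1 ?_
    refine (h.chartCoord_frm hu.1 hu.2 _).trans ?_
    change N u ((N u).inverse _) = _
    rw [← he, ContinuousLinearMap.inverse_equiv]
    exact e.apply_symm_apply _

theorem frm_mk_eq {u : B} {x : M} (hx : C.π u = x) (Z : Lie EG G) :
    (⟨g (C.π u), C.frm g u (g (C.π u)) Z⟩ : TangentBundle 𝓘(ℝ, EY) Y) =
      ⟨g x, C.frm g u (g x) Z⟩ := by
  subst hx
  rfl

variable [LieAlgebra.IsSemisimple ℝ (Lie EG G)]

/-- Smooth sections of subquotients of the pullback of the tangent bundle are represented by smooth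
functions on the Cartan bundle. -/
theorem IsAdapted.contMDiffOn_of_isSmoothGrSection (h : C.IsAdapted U g A) {i : ℤ} (hi : i < 0)
    {V : Set M} (hV : IsOpen V) (hVU : V ⊆ U) {t : ∀ x, Gr (A i (g x)) (A (i + 1) (g x))}
    (ht : IsSmoothGrSection EM g (A i) (A (i + 1)) V t) {m : ℕ} (e : (Fin m → ℝ) ≃ₗ[ℝ] D.VV i)
    {s : B → D.VV i} (hs : ∀ u, C.π u ∈ V →
      grOf D (fun i => A i (g (C.π u))) (C.frm g u (g (C.π u))) i (s u) = t (C.π u)) :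
    ContMDiffOn 𝓘(ℝ, EB) 𝓘(ℝ, Fin m → ℝ) ∞ (fun u => e.symm (s u)) (C.π ⁻¹' V) := by
  intro u₀ hu₀
  obtain ⟨O, hO, hu₀O, η, hη, hηt⟩ := ht _ hu₀
  have hOV : O ∩ V ∈ 𝓝 (C.π u₀) := (hO.inter hV).mem_nhds ⟨hu₀O, hu₀⟩
  have hη' : ContMDiffAt 𝓘(ℝ, EB) 𝓘(ℝ, EY).tangent ∞
      (fun u => (⟨g (C.π u), (η (C.π u) : TangentSpace 𝓘(ℝ, EY) (g (C.π u)))⟩ :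
        TangentBundle 𝓘(ℝ, EY) Y)) u₀ :=
    ContMDiffAt.comp (I' := 𝓘(ℝ, EM)) u₀ (hη.contMDiffAt hOV) C.smooth_π.contMDiffAt
  obtain ⟨X, hX, hXη⟩ := h.exists_frm_eq (hVU hu₀) hη'
  obtain ⟨r, hr⟩ := (D.fil i).subtype.exists_leftInverse_of_injective (Submodule.ker_subtype _)
  -- A linear extension to all of `𝔤` of the quotient map on `fil i`; it turns the smooth lift `X`
  -- into the coordinates of `s`.
  let p : Lie EG G →ₗ[ℝ] (Fin m → ℝ) :=
    e.symm.toLinearMap ∘ₗ ((D.fil (i + 1)).submoduleOf (D.fil i)).mkQ ∘ₗ r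
  let p' : EG →L[ℝ] (Fin m → ℝ) := LinearMap.toContinuousLinearMap (E := EG) p
  have hp : ContMDiffAt 𝓘(ℝ, EB) 𝓘(ℝ, Fin m → ℝ) ∞ (fun u => p' (X u)) u₀ :=
    ContMDiffAt.comp (I' := 𝓘(ℝ, EG)) u₀ p'.contDiff.contMDiff.contMDiffAt hX
  refine (hp.congr_of_eventuallyEq ?_).contMDiffWithinAt
  filter_upwards [hXη, C.smooth_π.continuous.continuousAt hOV] with u hu huOV
  have hfr := h.isFrame (hVU huOV.2)
  have hmem : (X u : Lie EG G) ∈ D.fil i :=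
    (hfr.mem_iff hi.le).1 (hu ▸ (η (C.π u)).2 : C.frm g u (g (C.π u)) (X u) ∈ A i (g (C.π u)))
  have h1 : s u = Submodule.Quotient.mk ⟨X u, hmem⟩ := by
    refine (hfr.grOf_bijective hi).1 ?_
    rw [hfr.grOf_mk hi, hs u huOV.2, ← hηt _ huOV]
    congr 1
    exact Subtype.ext hu.symm
  have h2 : r (X u) = ⟨X u, hmem⟩ := DFunLike.congr_fun hr (⟨X u, hmem⟩ : D.fil i)
  rw [h1, ← h2]
  rfl

/-- The function `s` is lifted by a linear section of `fil i → 𝕍_i`, and the resulting field is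
pulled back along a local section of the Cartan bundle. -/
theorem IsAdapted.isSmoothGrSection_of_contMDiffOn (h : C.IsAdapted U g A) {i : ℤ} (hi : i < 0)
    {V : Set M} (hV : IsOpen V) (hVU : V ⊆ U) {t : ∀ x, Gr (A i (g x)) (A (i + 1) (g x))}
    {m : ℕ} (e : (Fin m → ℝ) ≃ₗ[ℝ] D.VV i)
    {s : B → D.VV i} (hs : ∀ u, C.π u ∈ V →
      grOf D (fun i => A i (g (C.π u))) (C.frm g u (g (C.π u))) i (s u) = t (C.π u))
    (hsm : ContMDiffOn 𝓘(ℝ, EB) 𝓘(ℝ, Fin m → ℝ) ∞ (fun u => e.symm (s u)) (C.π ⁻¹' V)) :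
    IsSmoothGrSection EM g (A i) (A (i + 1)) V t := by
  classical
  intro x₀ hx₀
  obtain ⟨u₀, rfl⟩ := C.π_surjective x₀
  obtain ⟨q, O, hO, hxO, hq, hqu, hπq⟩ := C.exists_section_through u₀
  obtain ⟨σ, hσ⟩ := ((D.fil (i + 1)).submoduleOf (D.fil i)).mkQ.exists_rightInverse_of_surjective
    (Submodule.range_mkQ _)
  have hσ' : ∀ w, Submodule.Quotient.mk (σ w) = w := fun w => DFunLike.congr_fun hσ w
  have hs' : ∀ u x, C.π u = x → x ∈ V →
      grOf D (fun i => A i (g x)) (C.frm g u (g x)) i (s u) = t x := by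
    rintro u x rfl hx
    exact hs u hx
  have hfr : ∀ x ∈ O ∩ V, IsFrame D (fun i => A i (g x)) (C.frm g (q x) (g x)) := fun x hx =>
    h.isFrame_of_eq (by rw [hπq x hx.1]; exact hVU hx.2) (by rw [hπq x hx.1])
  let η : ∀ x, A i (g x) := fun x =>
    if hx : x ∈ O ∩ V then ⟨C.frm g (q x) (g x) (σ (s (q x))),
      ((hfr x hx).mem_iff hi.le).2 (σ (s (q x))).2⟩ else 0
  refine ⟨O, hO, hxO, η, ?_, fun x hx => ?_⟩
  · intro x hx
    have hqx : C.π (q x) ∈ V := by rw [hπq x hx.1]; exact hx.2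
    let X : B → EG := fun u => (σ (s u) : Lie EG G)
    let p : (Fin m → ℝ) →L[ℝ] EG :=
      LinearMap.toContinuousLinearMap (F' := EG) ((D.fil i).subtype ∘ₗ σ ∘ₗ e.toLinearMap)
    have hX : ContMDiffAt 𝓘(ℝ, EB) 𝓘(ℝ, EG) ∞ X (q x) := by
      have h1 : ContMDiffAt 𝓘(ℝ, EB) 𝓘(ℝ, EG) ∞ (fun u => p (e.symm (s u))) (q x) :=
        ContMDiffAt.comp (I' := 𝓘(ℝ, Fin m → ℝ)) (q x) p.contDiff.contMDiff.contMDiffAt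
          (hsm.contMDiffAt ((hV.preimage C.smooth_π.continuous).mem_nhds hqx))
      refine h1.congr_of_eventuallyEq (Filter.Eventually.of_forall fun u => ?_)
      change ((σ (s u) : Lie EG G) : EG) = ((σ (e (e.symm (s u))) : Lie EG G) : EG)
      rw [e.apply_symm_apply]
    have h2 := ContMDiffAt.comp (I' := 𝓘(ℝ, EB)) x (h.contMDiffAt_frm (hVU hqx) hX)
      (hq.contMDiffAt (hO.mem_nhds hx.1))
    refine (h2.congr_of_eventuallyEq ?_).contMDiffWithinAt
    filter_upwards [(hO.inter hV).mem_nhds hx] with x' hx'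
    refine Eq.trans ?_ (frm_mk_eq (hπq x' hx'.1) (σ (s (q x')))).symm
    simp only [η, dif_pos hx']
  · simp only [η, dif_pos hx]
    rw [← (hfr x hx).grOf_mk hi, hσ']
    exact hs' (q x) x (hπq x hx.1) hx.2

theorem IsAdapted.isSmoothGrSection_comp (h : C.IsAdapted U g A) {i : ℤ} {O : Set Y}
    {t : ∀ y, Gr (A i y) (A (i + 1) y)}
    (ht : IsSmoothGrSection EY (fun y : Y => y) (A i) (A (i + 1)) O t) :
    IsSmoothGrSection EM g (A i) (A (i + 1)) (U ∩ g ⁻¹' O) (fun x => t (g x)) := by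
  intro x₀ hx₀
  obtain ⟨O', hO', hxO', η, hη, hηt⟩ := ht (g x₀) hx₀.2
  refine ⟨U ∩ g ⁻¹' O', h.smooth.continuousOn.isOpen_inter_preimage h.isOpen hO', ⟨hx₀.1, hxO'⟩,
    fun x => η (g x), ?_, fun x hx => hηt (g x) ⟨hx.1.2, hx.2.2⟩⟩
  exact ContMDiffOn.comp (I' := 𝓘(ℝ, EY)) hη
    (h.smooth.mono (fun x hx => hx.1.1)) fun x hx => ⟨hx.1.2, hx.2.2⟩

end ParabolicGeometry

/-! ### Smooth subbundles and smooth frames on the target -/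

namespace ParabolicGeometry

variable {EG : Type*} [NormedAddCommGroup EG] [NormedSpace ℝ EG] [FiniteDimensional ℝ EG]
  {G : Type*} [TopologicalSpace G] [ChartedSpace EG G] [Group G] [LieGroup 𝓘(ℝ, EG) ∞ G]
  {EP : Type*} [NormedAddCommGroup EP] [NormedSpace ℝ EP] [FiniteDimensional ℝ EP]
  {P : Type*} [TopologicalSpace P] [ChartedSpace EP P] [Group P] [LieGroup 𝓘(ℝ, EP) ∞ P]
  {EQ : Type*} [NormedAddCommGroup EQ] [NormedSpace ℝ EQ] [FiniteDimensional ℝ EQ]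
  {Q : Type*} [TopologicalSpace Q] [ChartedSpace EQ Q] [Group Q] [LieGroup 𝓘(ℝ, EQ) ∞ Q]
  {EM : Type*} [NormedAddCommGroup EM] [NormedSpace ℝ EM] [FiniteDimensional ℝ EM]
  {M : Type*} [TopologicalSpace M] [ChartedSpace EM M] [IsManifold 𝓘(ℝ, EM) ∞ M]
  {EB : Type*} [NormedAddCommGroup EB] [NormedSpace ℝ EB] [FiniteDimensional ℝ EB]
  {B : Type*} [TopologicalSpace B] [ChartedSpace EB B] [IsManifold 𝓘(ℝ, EB) ∞ B]
  {EY : Type*} [NormedAddCommGroup EY] [NormedSpace ℝ EY] [FiniteDimensional ℝ EY]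
  {Y : Type*} [TopologicalSpace Y] [ChartedSpace EY Y] [IsManifold 𝓘(ℝ, EY) ∞ Y]
  {D : NestedParabolics (Lie EG G)} {H : NestedGroups D EP P EQ Q}
  {C : ParabolicGeometry H EM M EB B}
  {U : Set M} {g : M → Y} {A : ℤ → ∀ y : Y, Submodule ℝ (TangentSpace 𝓘(ℝ, EY) y)}

theorem frm_mk_eq_of_eq {u : B} {y : Y} (hy : g (C.π u) = y) (Z : Lie EG G) :
    (⟨g (C.π u), C.frm g u (g (C.π u)) Z⟩ : TangentBundle 𝓘(ℝ, EY) Y) = ⟨y, C.frm g u y Z⟩ := by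
  subst hy
  rfl

variable [LieAlgebra.IsSemisimple ℝ (Lie EG G)]

/-- Smoothness of vector fields on the target of an adapted submersion that are induced by
constant elements of the Lie algebra. -/
theorem IsRelSubmersion.contMDiffOn_frm_section (h : C.IsRelSubmersion EY U g) {s : Y → B} {O : Set Y}
    (hO : IsOpen O) (hs : ContMDiffOn 𝓘(ℝ, EY) 𝓘(ℝ, EB) ∞ s O)
    (hsU : ∀ y ∈ O, C.π (s y) ∈ U) (hsg : ∀ y ∈ O, g (C.π (s y)) = y) (X : EG) :
    ContMDiffOn 𝓘(ℝ, EY) 𝓘(ℝ, EY).tangent ∞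
      (fun y => (⟨y, C.frm g (s y) y X⟩ : TangentBundle 𝓘(ℝ, EY) Y)) O := by
  intro y hy
  have h2 := ContMDiffAt.comp (I' := 𝓘(ℝ, EB)) y
    (h.contMDiffAt_frm (hsU y hy) (contMDiffAt_const (c := X)))
    (hs.contMDiffAt (hO.mem_nhds hy))
  refine (h2.congr_of_eventuallyEq ?_).contMDiffWithinAt
  filter_upwards [hO.mem_nhds hy] with y' hy'
  exact (frm_mk_eq_of_eq (hsg y' hy') X).symm

theorem IsRelSubmersion.exists_local_section (h : C.IsRelSubmersion EY U g) {u₀ : B} (hu₀ : C.π u₀ ∈ U) :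
    ∃ (s : Y → B) (O : Set Y), IsOpen O ∧ g (C.π u₀) ∈ O ∧
      ContMDiffOn 𝓘(ℝ, EY) 𝓘(ℝ, EB) ∞ s O ∧ s (g (C.π u₀)) = u₀ ∧
      (∀ y ∈ O, C.π (s y) ∈ U) ∧ ∀ y ∈ O, g (C.π (s y)) = y := by
  obtain ⟨s, O, hO, hO₀, hs, hs₀, hsO⟩ := RelativeBGG.exists_local_section h.isOpen_preimage hu₀
    h.contMDiffOn_comp (h.mfderiv_comp_surjective hu₀)
  exact ⟨s, O, hO, hO₀, hs, hs₀, fun y hy => (hsO y hy).1, fun y hy => (hsO y hy).2⟩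

theorem exists_complement (K₁ K₂ : Submodule ℝ (Lie EG G)) :
    ∃ K : Submodule ℝ (Lie EG G), K ≤ K₁ ∧ (∀ x ∈ K, x ∈ K₂ → x = 0) ∧
      ∀ x ∈ K₁, ∃ y ∈ K₂, ∃ z ∈ K, y + z = x := by
  obtain ⟨K', hK'⟩ := exists_isCompl (K₂.submoduleOf K₁)
  refine ⟨K'.map K₁.subtype, Submodule.map_subtype_le _ _, ?_, fun x hx => ?_⟩
  · rintro _ ⟨x, hx, rfl⟩ hx0
    have h1 : x ∈ (K₂.submoduleOf K₁) ⊓ K' := ⟨hx0, hx⟩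
    rw [hK'.inf_eq_bot] at h1
    rw [(Submodule.mem_bot ℝ).1 h1]
    rfl
  · have h1 : (⟨x, hx⟩ : K₁) ∈ (K₂.submoduleOf K₁) ⊔ K' := by
      rw [hK'.sup_eq_top]
      trivial
    obtain ⟨y, hy, z, hz, hyz⟩ := Submodule.mem_sup.1 h1
    exact ⟨y, hy, z, ⟨z, hz, rfl⟩, congrArg Subtype.val hyz⟩

/-- The image filtration consists of smooth subbundles if the fibres of the submersion are exactly
the leaves. -/
theorem IsAdapted.isSmoothSubbundle (h : C.IsAdapted U g A) (hg : g '' U = Set.univ)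
    (hker : ∀ u, C.π u ∈ U → ∀ X ∈ D.fil 0, C.frm (EY := EY) g u (g (C.π u)) X = 0) {i : ℤ} (hi : i ≤ 0) :
    IsSmoothSubbundle (A i) := by
  intro y₀
  obtain ⟨x₀, hx₀, rfl⟩ : y₀ ∈ g '' U := hg ▸ Set.mem_univ y₀
  obtain ⟨u₀, rfl⟩ := C.π_surjective x₀
  obtain ⟨s, O, hO, hO₀, hs, -, hsU, hsg⟩ := h.exists_local_section hx₀
  -- The kernel of the frame map is `fil 0`, so a fixed complement of it in `fil i` is mapped
  -- isomorphically onto `A i` at every point, and a basis gives a frame.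
  obtain ⟨K, hKi, hK0, hKsup⟩ := exists_complement (D.fil i) (D.fil 0)
  let β := Module.finBasis ℝ K
  refine ⟨O, hO, hO₀, Module.finrank ℝ K, fun j y => C.frm (EY := EY) g (s y) y (β j), fun j => ?_,
    fun y hy => ?_⟩
  · exact h.contMDiffOn_frm_section hO hs hsU hsg (β j : Lie EG G)
  · have hfr := h.isFrame_of_eq (hsU y hy) (hsg y hy)
    have hker' : ∀ X ∈ D.fil 0, C.frm (EY := EY) g (s y) y X = 0 := by
      have h1 : ∀ u, ∀ y', C.π u ∈ U → g (C.π u) = y' → ∀ X ∈ D.fil 0, C.frm (EY := EY) g u y' X = 0 := by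
        rintro u _ hu rfl
        exact hker u hu
      exact h1 _ _ (hsU y hy) (hsg y hy)
    have hinj : LinearMap.ker (C.frm (EY := EY) g (s y) y ∘ₗ K.subtype) = ⊥ := by
      refine LinearMap.ker_eq_bot'.2 fun x hx => Subtype.ext ?_
      exact hK0 x x.2 (hfr.ker _ hx)
    refine ⟨β.linearIndependent.map' (C.frm (EY := EY) g (s y) y ∘ₗ K.subtype) hinj, ?_⟩
    have h1 : (fun j => C.frm (EY := EY) g (s y) y (β j)) = (C.frm (EY := EY) g (s y) y ∘ₗ K.subtype) ∘ β := rfl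
    rw [h1, Set.range_comp, ← Submodule.map_span, β.span_eq, ← hfr.map_eq i hi, Submodule.map_comp,
      Submodule.map_top, Submodule.range_subtype]
    apply le_antisymm
    · exact Submodule.map_mono hKi
    · rintro _ ⟨x, hx, rfl⟩
      obtain ⟨y', hy', z, hz, rfl⟩ := hKsup x hx
      refine ⟨z, hz, ?_⟩
      rw [map_add, hker' y' hy', zero_add]

variable {ι : Type*} [Fintype ι] {n : ι → ℕ} {k : ι → ℤ}
  (b : ∀ i, (Fin (n i) → ℝ) ≃ₗ[ℝ] D.VV (k i))
  {W : Type*} [NormedAddCommGroup W] [NormedSpace ℝ W] (F : TensorialConstruction n W)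

/-- The frames induced by a local section are smooth. -/
theorem IsAdapted.isSmoothGrSection_grFrame (h : C.IsAdapted U g A) (hk : ∀ i, k i < 0)
    {s : Y → B} {O : Set Y}
    (hO : IsOpen O) (hs : ContMDiffOn 𝓘(ℝ, EY) 𝓘(ℝ, EB) ∞ s O)
    (hsU : ∀ y ∈ O, C.π (s y) ∈ U) (hsg : ∀ y ∈ O, g (C.π (s y)) = y) (i : ι)
    (e : Fin (n i) → ℝ) :
    IsSmoothGrSection EY (fun y : Y => y) (A (k i)) (A (k i + 1)) O
      (fun y => C.grFrame g A b (s y) y i e) := by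
  classical
  intro y₀ hy₀
  obtain ⟨X, hX⟩ := Submodule.Quotient.mk_surjective _ (b i e)
  have hfr : ∀ y ∈ O, IsFrame D (fun i => A i y) (C.frm g (s y) y) := fun y hy =>
    h.isFrame_of_eq (hsU y hy) (hsg y hy)
  refine ⟨O, hO, hy₀, fun y => if hy : y ∈ O then ⟨C.frm g (s y) y X,
    ((hfr y hy).mem_iff (hk i).le).2 X.2⟩ else 0, ?_, fun y hy => ?_⟩
  · rw [Set.inter_self]
    refine (h.contMDiffOn_frm_section hO hs hsU hsg (X : Lie EG G)).congr fun y hy => ?_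
    simp only [dif_pos hy]
  · simp only [dif_pos hy.1]
    rw [← (hfr y hy.1).grOf_mk (hk i), hX]
    rfl

/-- Comparison of the frames induced by points of the Cartan bundle with smooth frames. -/
theorem IsAdapted.exists_smooth_matrix (h : C.IsAdapted U g A) (hk : ∀ i, k i < 0) {O : Set Y}
    (hO : IsOpen O) {φ : ∀ (y : Y) (i : ι), (Fin (n i) → ℝ) →ₗ[ℝ] Gr (A (k i) y) (A (k i + 1) y)}
    (hφ : ∀ y ∈ O, ∀ i, Function.Bijective (φ y i))
    (hφs : ∀ i e, IsSmoothGrSection EY (fun y : Y => y) (A (k i)) (A (k i + 1)) O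
      (fun y => φ y i e)) :
    ∃ T : B → ∀ i, (Fin (n i) → ℝ) →L[ℝ] (Fin (n i) → ℝ),
      ∀ u, C.π u ∈ U → g (C.π u) ∈ O → IsUnit (T u) ∧
        ContMDiffAt 𝓘(ℝ, EB) 𝓘(ℝ, ∀ i, (Fin (n i) → ℝ) →L[ℝ] (Fin (n i) → ℝ)) ∞ T u ∧
        ∀ a : F.obj (fun i => Gr (A (k i) (g (C.π u))) (A (k i + 1) (g (C.π u)))),
          F.rep (T u) (a.1 (φ (g (C.π u)))) = a.1 (C.grFrame g A b u (g (C.π u))) := by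
  classical
  let Fr : ∀ u, C.π u ∈ U → ∀ i, (Fin (n i) → ℝ) ≃ₗ[ℝ]
      Gr (A (k i) (g (C.π u))) (A (k i + 1) (g (C.π u))) := fun u hu i =>
    LinearEquiv.ofBijective _ (h.bijective_grFrame b hk hu rfl i)
  have hV : IsOpen (U ∩ g ⁻¹' O) := h.smooth.continuousOn.isOpen_inter_preimage h.isOpen hO
  let T : B → ∀ i, (Fin (n i) → ℝ) →L[ℝ] (Fin (n i) → ℝ) := fun u =>
    if hu : C.π u ∈ U then
      TensorialConstruction.matrixOf (Fr u hu) (φ (g (C.π u))) else 0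
  have hT : ∀ u (hu : C.π u ∈ U), T u =
      TensorialConstruction.matrixOf (Fr u hu) (φ (g (C.π u))) := fun u hu => dif_pos hu
  refine ⟨T, fun u hu huO => ⟨?_, ?_, fun a => ?_⟩⟩
  · rw [hT u hu]
    exact TensorialConstruction.isUnit_matrixOf _ (hφ _ huO)
  · refine contMDiffAt_pi_space.2 fun i => contMDiffAt_clm_of_apply fun e => ?_
    -- The columns of `T` are the coordinate functions of the given smooth frame sections, pulled
    -- back along `g`.
    have h1 := h.contMDiffOn_of_isSmoothGrSection (hk i) hV Set.inter_subset_left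
      (h.isSmoothGrSection_comp (hφs i e)) (b i) (s := fun u => b i (T u i e)) ?_
    · simp only [LinearEquiv.symm_apply_apply] at h1
      exact h1.contMDiffAt ((hV.preimage C.smooth_π.continuous).mem_nhds ⟨hu, huO⟩)
    · intro u hu
      rw [hT u hu.1]
      exact (Fr u hu.1 i).apply_symm_apply _
  · rw [hT u hu]
    exact F.rep_matrixOf (Fr u hu) (hφ _ huO) a

end ParabolicGeometry

/-! ### Relative tractor bundles as pullbacks of tensorial constructions -/

namespace ParabolicGeometry

variable {EG : Type*} [NormedAddCommGroup EG] [NormedSpace ℝ EG] [FiniteDimensional ℝ EG]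
  {G : Type*} [TopologicalSpace G] [ChartedSpace EG G] [Group G] [LieGroup 𝓘(ℝ, EG) ∞ G]
  {EP : Type*} [NormedAddCommGroup EP] [NormedSpace ℝ EP] [FiniteDimensional ℝ EP]
  {P : Type*} [TopologicalSpace P] [ChartedSpace EP P] [Group P] [LieGroup 𝓘(ℝ, EP) ∞ P]
  {EQ : Type*} [NormedAddCommGroup EQ] [NormedSpace ℝ EQ] [FiniteDimensional ℝ EQ]
  {Q : Type*} [TopologicalSpace Q] [ChartedSpace EQ Q] [Group Q] [LieGroup 𝓘(ℝ, EQ) ∞ Q]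
  {EM : Type*} [NormedAddCommGroup EM] [NormedSpace ℝ EM] [FiniteDimensional ℝ EM]
  {M : Type*} [TopologicalSpace M] [ChartedSpace EM M] [IsManifold 𝓘(ℝ, EM) ∞ M]
  {EB : Type*} [NormedAddCommGroup EB] [NormedSpace ℝ EB] [FiniteDimensional ℝ EB]
  {B : Type*} [TopologicalSpace B] [ChartedSpace EB B] [IsManifold 𝓘(ℝ, EB) ∞ B]
  {EY : Type*} [NormedAddCommGroup EY] [NormedSpace ℝ EY] [FiniteDimensional ℝ EY]
  {Y : Type*} [TopologicalSpace Y] [ChartedSpace EY Y] [IsManifold 𝓘(ℝ, EY) ∞ Y]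
  {D : NestedParabolics (Lie EG G)} {H : NestedGroups D EP P EQ Q}
  {C : ParabolicGeometry H EM M EB B}
  {U : Set M} {g : M → Y} {A : ℤ → ∀ y : Y, Submodule ℝ (TangentSpace 𝓘(ℝ, EY) y)}

variable [LieAlgebra.IsSemisimple ℝ (Lie EG G)]
variable {ι : Type*} [Fintype ι] {n : ι → ℕ} {k : ι → ℤ}
  (b : ∀ i, (Fin (n i) → ℝ) ≃ₗ[ℝ] D.VV (k i))
  {W : Type*} [NormedAddCommGroup W] [NormedSpace ℝ W] (F : TensorialConstruction n W)

theorem contMDiffAt_rep {T : B → ∀ i, (Fin (n i) → ℝ) →L[ℝ] (Fin (n i) → ℝ)} {u : B}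
    (hT : ContMDiffAt 𝓘(ℝ, EB) 𝓘(ℝ, ∀ i, (Fin (n i) → ℝ) →L[ℝ] (Fin (n i) → ℝ)) ∞ T u)
    (hu : IsUnit (T u)) :
    ContMDiffAt 𝓘(ℝ, EB) 𝓘(ℝ, W →L[ℝ] W) ∞ (fun u => F.rep (T u)) u :=
  ContMDiffAt.comp (I' := 𝓘(ℝ, ∀ i, (Fin (n i) → ℝ) →L[ℝ] (Fin (n i) → ℝ))) (g := F.rep) u
    (F.contDiffAt_rep hu).contMDiffAt hT

theorem contMDiffAt_ringInverse {T : B → ∀ i, (Fin (n i) → ℝ) →L[ℝ] (Fin (n i) → ℝ)} {u : B}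
    (hT : ContMDiffAt 𝓘(ℝ, EB) 𝓘(ℝ, ∀ i, (Fin (n i) → ℝ) →L[ℝ] (Fin (n i) → ℝ)) ∞ T u)
    (hu : IsUnit (T u)) :
    ContMDiffAt 𝓘(ℝ, EB) 𝓘(ℝ, ∀ i, (Fin (n i) → ℝ) →L[ℝ] (Fin (n i) → ℝ)) ∞
      (fun u => Ring.inverse (T u)) u := by
  obtain ⟨v, hv⟩ := hu
  have h1 : ContDiffAt ℝ ∞ Ring.inverse (T u) := by
    rw [← hv]
    exact contDiffAt_ringInverse ℝ v
  exact ContMDiffAt.comp (I' := 𝓘(ℝ, ∀ i, (Fin (n i) → ℝ) →L[ℝ] (Fin (n i) → ℝ)))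
    (g := Ring.inverse) u h1.contMDiffAt hT

/-- An adapted submersion identifies relative tractor bundles with pullbacks of tensorial
constructions. -/
theorem IsAdapted.identifiesBundles (h : C.IsAdapted U g A) (hk : ∀ i, k i < 0)
    {fr : ∀ u i, (Fin (n i) → ℝ) →ₗ[ℝ] Gr (A (k i) (g (C.π u))) (A (k i + 1) (g (C.π u)))}
    (hfr : ∀ u, C.π u ∈ U → fr u = C.grFrame g A b u (g (C.π u))) :
    C.IdentifiesBundles (tensorRep H F k b) F U g (fun i => A (k i)) (fun i => A (k i + 1)) fr where
  frame u hu := by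
    rw [hfr u hu]
    exact h.bijective_grFrame b hk hu rfl
  fiber u hu := by
    rw [hfr u hu]
    exact F.bijective_eval (h.bijective_grFrame b hk hu rfl)
  isSection σ := by
    intro u hu q
    have hu' : C.π (C.act u q) ∈ U := by rwa [C.π_act]
    have h1 : ∀ x, x = C.π u → (σ x).1 (C.grFrame g A b (C.act u q) (g x)) =
        (σ (C.π u)).1 (C.grFrame g A b (C.act u q) (g (C.π u))) := by
      rintro x rfl
      rfl
    unfold toFun
    rw [hfr u hu, hfr _ hu', h1 _ (C.π_act u q)]
    exact h.rep_grFrame_act b F hk hu rfl q _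
  exists_section f hf := by
    classical
    -- The value of the section at `x` is defined with one chosen point over `x`; equivariance of
    -- `f` extends the equation to the whole fibre.
    choose v hv using C.π_surjective
    have hv' : ∀ x ∈ U, ∀ i, Function.Bijective (C.grFrame g A b (v x) (g x) i) := fun x hx =>
      h.bijective_grFrame b hk (by rwa [hv]) (by rw [hv])
    choose a ha using fun x hx => (F.bijective_eval (hv' x hx)).2 (f (v x))
    refine ⟨fun x => if hx : x ∈ U then a x hx else 0, fun u hu => ?_⟩
    obtain ⟨q, hq⟩ := C.exists_act_eq (hv (C.π u))
    have hvu : C.π (v (C.π u)) ∈ U := by rwa [hv]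
    refine (F.rep_bijective (isUnit_grMat_Ad b H hk (H.jQ q))).1 ?_
    unfold toFun
    beta_reduce
    rw [hfr u hu, dif_pos hu]
    have h1 := h.rep_grFrame_act b F hk hvu (y := g (C.π u)) (by rw [hv]) q (a _ hu)
    have h2 := hf _ hvu q
    rw [hq] at h1 h2
    exact h1.trans ((ha _ hu).trans h2.symm)
  smooth_iff V hVU hV σ := by
    have hVB : IsOpen (C.π ⁻¹' V) := hV.preimage C.smooth_π.continuous
    constructor
    · intro hσ u₀ hu₀
      obtain ⟨O, hO, hO₀, φ, hφ, hφs, hsm⟩ := hσ _ hu₀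
      obtain ⟨T, hT⟩ := h.exists_smooth_matrix b F hk hO hφ hφs
      obtain ⟨h1, h2, -⟩ := hT u₀ (hVU hu₀) hO₀
      have hVO : IsOpen (V ∩ g ⁻¹' O) := (h.smooth.mono hVU).continuousOn.isOpen_inter_preimage hV hO
      have hmem : C.π ⁻¹' (V ∩ g ⁻¹' O) ∈ 𝓝 u₀ :=
        (hVO.preimage C.smooth_π.continuous).mem_nhds ⟨hu₀, hO₀⟩
      have h3 : ContMDiffAt 𝓘(ℝ, EB) 𝓘(ℝ, W) ∞
          (fun u => (σ (C.π u)).1 (φ (g (C.π u)))) u₀ :=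
        ContMDiffAt.comp (I' := 𝓘(ℝ, EM)) (g := fun x => (σ x).1 (φ (g x))) u₀
          (hsm.contMDiffAt (hVO.mem_nhds ⟨hu₀, hO₀⟩)) C.smooth_π.contMDiffAt
      refine ((((contMDiffAt_rep F h2 h1).clm_apply h3)).congr_of_eventuallyEq
        ?_).contMDiffWithinAt
      filter_upwards [hmem] with u hu
      unfold toFun
      rw [hfr u (hVU hu.1)]
      exact ((hT u (hVU hu.1) hu.2).2.2 (σ (C.π u))).symm
    · intro hσ x₀ hx₀
      obtain ⟨u₀, rfl⟩ := C.π_surjective x₀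
      obtain ⟨s, O, hO, hO₀, hs, -, hsU, hsg⟩ := h.exists_local_section (hVU hx₀)
      have hφ : ∀ y ∈ O, ∀ i, Function.Bijective (C.grFrame g A b (s y) y i) := fun y hy =>
        h.bijective_grFrame b hk (hsU y hy) (hsg y hy)
      have hφs := h.isSmoothGrSection_grFrame b hk hO hs hsU hsg
      -- The smooth frames on `Y` come from a local section through the Cartan bundle. The value of
      -- `σ` on them is recovered from the function on `B` with the inverse of `T`, restricted to a
      -- local section of `π`.
      refine ⟨O, hO, hO₀, fun y => C.grFrame g A b (s y) y, hφ, hφs, ?_⟩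
      obtain ⟨T, hT⟩ := h.exists_smooth_matrix b F hk hO hφ hφs
      have hVO : IsOpen (V ∩ g ⁻¹' O) := (h.smooth.mono hVU).continuousOn.isOpen_inter_preimage hV hO
      intro x₁ hx₁
      obtain ⟨u₁, rfl⟩ := C.π_surjective x₁
      obtain ⟨q, O', hO', hO₁, hq, hqu, hπq⟩ := C.exists_section_through u₁
      obtain ⟨h1, h2, -⟩ := hT u₁ (hVU hx₁.1) hx₁.2
      have h3 := contMDiffAt_ringInverse h2 h1
      have h4 : IsUnit (Ring.inverse (T u₁)) := by
        obtain ⟨v, hv⟩ := h1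
        rw [← hv, Ring.inverse_unit]
        exact v⁻¹.isUnit
      have h5 := (contMDiffAt_rep F h3 h4).clm_apply (hσ.contMDiffAt (hVB.mem_nhds hx₁.1))
      rw [← hqu] at h5
      have h6 := ContMDiffAt.comp (I' := 𝓘(ℝ, EB)) (C.π u₁) h5 (hq.contMDiffAt (hO'.mem_nhds hO₁))
      refine (h6.congr_of_eventuallyEq ?_).contMDiffWithinAt
      filter_upwards [hO'.mem_nhds hO₁, hVO.mem_nhds hx₁] with x hx hxV
      have hqU : C.π (q x) ∈ U := by rw [hπq x hx]; exact hVU hxV.1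
      have hqO : g (C.π (q x)) ∈ O := by rw [hπq x hx]; exact hxV.2
      obtain ⟨h7, -, h8⟩ := hT (q x) hqU hqO
      have h9 := h8 (σ (C.π (q x)))
      have h10 : ∀ x', x' = x → (σ x').1 (C.grFrame g A b (s (g x')) (g x')) =
          (σ x).1 (C.grFrame g A b (s (g x)) (g x)) := by
        rintro _ rfl
        rfl
      change (σ x).1 (C.grFrame g A b (s (g x)) (g x)) =
        F.rep (Ring.inverse (T (q x))) (C.toFun F g _ _ fr σ (q x))
      unfold toFun
      rw [hfr _ hqU, ← h9, h10 _ (hπq x hx)]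
      obtain ⟨v, hv⟩ := h7
      rw [← hv, Ring.inverse_unit, ← F.rep_mul_apply v⁻¹.isUnit v.isUnit, Units.inv_mul, F.rep_one]
      rfl

end ParabolicGeometry

/-! ### Local constancy of the filtration along the fibres -/

namespace ParabolicGeometry

variable {EG : Type*} [NormedAddCommGroup EG] [NormedSpace ℝ EG] [FiniteDimensional ℝ EG]
  {G : Type*} [TopologicalSpace G] [ChartedSpace EG G] [Group G] [LieGroup 𝓘(ℝ, EG) ∞ G]
  {EP : Type*} [NormedAddCommGroup EP] [NormedSpace ℝ EP] [FiniteDimensional ℝ EP]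
  {P : Type*} [TopologicalSpace P] [ChartedSpace EP P] [Group P] [LieGroup 𝓘(ℝ, EP) ∞ P]
  {EQ : Type*} [NormedAddCommGroup EQ] [NormedSpace ℝ EQ] [FiniteDimensional ℝ EQ]
  {Q : Type*} [TopologicalSpace Q] [ChartedSpace EQ Q] [Group Q] [LieGroup 𝓘(ℝ, EQ) ∞ Q]
  {EM : Type*} [NormedAddCommGroup EM] [NormedSpace ℝ EM] [FiniteDimensional ℝ EM]
  {M : Type*} [TopologicalSpace M] [ChartedSpace EM M] [IsManifold 𝓘(ℝ, EM) ∞ M]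
  {EB : Type*} [NormedAddCommGroup EB] [NormedSpace ℝ EB] [FiniteDimensional ℝ EB]
  {B : Type*} [TopologicalSpace B] [ChartedSpace EB B] [IsManifold 𝓘(ℝ, EB) ∞ B]
  {EY : Type*} [NormedAddCommGroup EY] [NormedSpace ℝ EY] [FiniteDimensional ℝ EY]
  {Y : Type*} [TopologicalSpace Y] [ChartedSpace EY Y] [IsManifold 𝓘(ℝ, EY) ∞ Y]
  {D : NestedParabolics (Lie EG G)} {H : NestedGroups D EP P EQ Q}
  {C : ParabolicGeometry H EM M EB B}
  {U : Set M} {g : M → Y}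

theorem IsRelSubmersion.chartCoord_frm_of_eq (h : C.IsRelSubmersion EY U g) {y₀ y : Y} {u : B}
    (hu : C.π u ∈ U) (hy : g (C.π u) = y) (hy₀ : y ∈ (chartAt EY y₀).source) (X : EG) :
    chartCoord y₀ y (C.frm (EY := EY) g u y X) = fd C.par (C.chartMap (EY := EY) g y₀) u X := by
  subst hy
  exact h.chartCoord_frm hu hy₀ X

theorem frm_par_eq_mfderiv (C : ParabolicGeometry H EM M EB B) {g : M → Y} (u : B)
    (v : TangentSpace 𝓘(ℝ, EB) u) :
    C.frm (EY := EY) g u (g (C.π u)) (C.par u v) =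
      mfderiv 𝓘(ℝ, EB) 𝓘(ℝ, EY) (fun u => g (C.π u)) u v :=
  congrArg (mfderiv 𝓘(ℝ, EB) 𝓘(ℝ, EY) (fun u => g (C.π u)) u) ((C.par u).symm_apply_apply v)

variable [LieAlgebra.IsSemisimple ℝ (Lie EG G)]

theorem IsRelSubmersion.mem_fil_zero (h : C.IsRelSubmersion EY U g) {u : B} (hu : C.π u ∈ U)
    {X : Lie EG G} (hX : C.frm (EY := EY) g u (g (C.π u)) X = 0) : X ∈ D.fil 0 := by
  rw [C.frm_eq_comp (h.mdifferentiableAt hu)] at hX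
  exact (C.toTangent_mem_tanFil_iff le_rfl u X).1 (h.ker _ hu _ hX)

/-- Along the fibres, the images of the filtration components are locally constant. -/
theorem IsRelSubmersion.eventually_map_frm_eq (h : C.IsRelSubmersion EY U g)
    (hker : ∀ u, C.π u ∈ U → ∀ X ∈ D.fil 0, C.frm (EY := EY) g u (g (C.π u)) X = 0)
    {i : ℤ} (hi : i ≤ 0) (hτ : C.TorsionMapsTo i i) {u₀ : B} (hu₀ : C.π u₀ ∈ U) :
    ∀ᶠ u in 𝓝 u₀, g (C.π u) = g (C.π u₀) →
      (D.fil i).map (C.frm (EY := EY) g u (g (C.π u₀))) =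
        (D.fil i).map (C.frm (EY := EY) g u₀ (g (C.π u₀))) := by
  set y₀ := g (C.π u₀) with hy₀
  have hy₀s := mem_chart_source EY y₀
  obtain ⟨K₀, hKi, hK0, hKsup⟩ := exists_complement (D.fil i) (D.fil 0)
  let K : Submodule ℝ EG := (K₀ : Submodule ℝ (Lie EG G))
  let F := C.chartMap (EY := EY) g y₀
  let L : B → EG →L[ℝ] EY := fd C.par F
  have hF : ∀ u, C.π u ∈ U ∧ g (C.π u) ∈ (chartAt EY y₀).source →
      ContMDiffAt 𝓘(ℝ, EB) 𝓘(ℝ, EY) ∞ F u := fun u hu => h.contMDiffAt_chartMap hu.1 hu.2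
  have hL : ∀ u, C.π u ∈ U ∧ g (C.π u) ∈ (chartAt EY y₀).source →
      ContMDiffAt 𝓘(ℝ, EB) 𝓘(ℝ, EG →L[ℝ] EY) ∞ L u := fun u hu =>
    contMDiffAt_fd C.isSmoothPar_par (hF u hu)
  have hev := h.eventually_mem hu₀
  rw [← hy₀] at hev
  have hL0 : ∀ u, C.π u ∈ U ∧ g (C.π u) ∈ (chartAt EY y₀).source → ∀ X : EG,
      (X : Lie EG G) ∈ D.fil 0 → L u X = 0 := by
    intro u hu X hX
    refine (h.chartCoord_frm hu.1 hu.2 X).symm.trans ?_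
    rw [hker u hu.1 X hX, map_zero]
  have hLi : ∀ u, C.π u ∈ U ∧ g (C.π u) ∈ (chartAt EY y₀).source → ∀ Z : EG,
      (Z : Lie EG G) ∈ D.fil i → ∃ z : K, L u Z = L u z := by
    intro u hu Z hZ
    obtain ⟨y, hy, z, hz, hyz⟩ := hKsup Z hZ
    refine ⟨⟨z, hz⟩, ?_⟩
    exact (congrArg (L u) hyz.symm).trans ((map_add (L u) (y : EG) (z : EG)).trans
      ((congrArg (· + L u z) (hL0 u hu _ hy)).trans (zero_add _)))
  have hLinj : LinearMap.ker ((L u₀).toLinearMap ∘ₗ K.subtype) = ⊥ := by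
    refine LinearMap.ker_eq_bot'.2 fun x hx => Subtype.ext ?_
    refine hK0 ((x : EG) : Lie EG G) x.2 (h.mem_fil_zero hu₀ ?_)
    refine (chartCoord_bijective hy₀s).1 ?_
    exact (h.chartCoord_frm hu₀ hy₀s _).trans (Eq.trans hx (map_zero _).symm)
  obtain ⟨P₀, hP₀⟩ := LinearMap.exists_leftInverse_of_injective _ hLinj
  let Pr : EY →L[ℝ] K := LinearMap.toContinuousLinearMap P₀
  let j : K →L[ℝ] EG := K.subtypeL
  let A : B → K →L[ℝ] EY := fun u => L u ∘L j
  let S : B → K →L[ℝ] K := fun u => Pr ∘L A u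
  -- Near `u₀` the image of `fil i` is the range of `A u`. `V u` is its parametrization normalized
  -- by `Pr ∘ V u = id`, so if `V` is constant along the fibre, then so is the image.
  let V : B → K →L[ℝ] EY := fun u => A u ∘L (S u).inverse
  have hA : ∀ u, C.π u ∈ U ∧ g (C.π u) ∈ (chartAt EY y₀).source →
      ContMDiffAt 𝓘(ℝ, EB) 𝓘(ℝ, K →L[ℝ] EY) ∞ A u := fun u hu =>
    (hL u hu).clm_comp contMDiffAt_const
  have hS : ∀ u, C.π u ∈ U ∧ g (C.π u) ∈ (chartAt EY y₀).source →
      ContMDiffAt 𝓘(ℝ, EB) 𝓘(ℝ, K →L[ℝ] K) ∞ S u := fun u hu =>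
    contMDiffAt_const.clm_comp (hA u hu)
  have hS₀ : S u₀ = ((ContinuousLinearEquiv.refl ℝ K : K ≃L[ℝ] K) : K →L[ℝ] K) :=
    ContinuousLinearMap.ext fun x => DFunLike.congr_fun hP₀ x
  have hSinv : ∀ᶠ u in 𝓝 u₀, S u ∈ Set.range ((↑) : (K ≃L[ℝ] K) → K →L[ℝ] K) := by
    refine (hS u₀ ⟨hu₀, hy₀s⟩).continuousAt ?_
    rw [hS₀]
    exact ContinuousLinearEquiv.nhds _
  have hVS : ∀ u, S u ∈ Set.range ((↑) : (K ≃L[ℝ] K) → K →L[ℝ] K) → ∀ x, V u (S u x) = A u x := by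
    rintro u ⟨e, he⟩ x
    change A u ((S u).inverse (S u x)) = _
    rw [← he, ContinuousLinearMap.inverse_equiv]
    exact congrArg (A u) (e.symm_apply_apply x)
  have hV : ∀ u, C.π u ∈ U ∧ g (C.π u) ∈ (chartAt EY y₀).source →
      S u ∈ Set.range ((↑) : (K ≃L[ℝ] K) → K →L[ℝ] K) →
      ContMDiffAt 𝓘(ℝ, EB) 𝓘(ℝ, K →L[ℝ] EY) ∞ V u := by
    rintro u hu ⟨e, he⟩
    have h1 : ContDiffAt ℝ ∞ (ContinuousLinearMap.inverse : (K →L[ℝ] K) → K →L[ℝ] K) (S u) := by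
      rw [← he]
      exact contDiffAt_map_inverse e
    exact (hA u hu).clm_comp
      (ContMDiffAt.comp (I' := 𝓘(ℝ, K →L[ℝ] K)) u h1.contMDiffAt (hS u hu))
  have hmain : ∀ᶠ u in 𝓝 u₀, g (C.π u) = g (C.π u₀) →
      MDifferentiableAt 𝓘(ℝ, EB) 𝓘(ℝ, K →L[ℝ] EY) V u ∧
      ∀ v, mfderiv 𝓘(ℝ, EB) 𝓘(ℝ, EY) (fun u => g (C.π u)) u v = 0 → vd V u v = 0 := by
    filter_upwards [hev.eventually_nhds, hSinv.eventually_nhds] with u hu hSu _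
    have hVd := (hV u hu.self_of_nhds hSu.self_of_nhds).mdifferentiableAt (n := ∞) (by norm_num)
    have hAd := (hA u hu.self_of_nhds).mdifferentiableAt (n := ∞) (by norm_num)
    have hSd := (hS u hu.self_of_nhds).mdifferentiableAt (n := ∞) (by norm_num)
    have hLd := (hL u hu.self_of_nhds).mdifferentiableAt (n := ∞) (by norm_num)
    refine ⟨hVd, fun v hv => ?_⟩
    have hX : ((C.par u v : EG) : Lie EG G) ∈ D.fil 0 :=
      h.mem_fil_zero hu.self_of_nhds.1 ((frm_par_eq_mfderiv C u v).trans hv)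
    refine ContinuousLinearMap.ext fun w => ?_
    obtain ⟨e, he⟩ := hSu.self_of_nhds
    obtain ⟨x, rfl⟩ : ∃ x, S u x = w := ⟨e.symm w, by rw [← he]; exact e.apply_symm_apply w⟩
    have hAx : MDifferentiableAt 𝓘(ℝ, EB) 𝓘(ℝ, EY) (fun u => A u x) u :=
      hAd.clm_apply mdifferentiableAt_const
    have hSx : MDifferentiableAt 𝓘(ℝ, EB) 𝓘(ℝ, K) (fun u => S u x) u :=
      hSd.clm_apply mdifferentiableAt_const
    -- the derivative of `A` along the fibre
    obtain ⟨z, hz⟩ : ∃ z : K, vd (fun u => A u x) u v = A u z := by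
      have h1 : vd (fun u => A u x) u v = fd C.par L u (C.par u v) x := by
        have h2 := vd_clm (ContinuousLinearMap.apply ℝ EY ((x : K) : EG)) hLd v
        refine h2.trans ?_
        rw [fd_apply, ContinuousLinearEquiv.symm_apply_apply]
        rfl
      -- `L · X` vanishes identically for `X ∈ fil 0`, so only the bracket term of the commutator
      -- formula survives.
      have h2 : fd C.par L u x (C.par u v) = 0 := by
        have h3 := vd_clm (ContinuousLinearMap.apply ℝ EY (C.par u v)) hLd ((C.par u).symm x)
        refine h3.symm.trans ?_
        have h4 : (fun u' => ContinuousLinearMap.apply ℝ EY (C.par u v) (L u')) =ᶠ[𝓝 u]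
            fun _ => (0 : EY) := by
          filter_upwards [hu] with u' hu'
          exact hL0 u' hu' _ hX
        rw [vd_congr h4]
        unfold vd
        rw [mfderiv_const]
        rfl
      have h3 := fd_parBr C.isSmoothPar_par (hF u hu.self_of_nhds) (C.par u v) (x : EG)
      -- The torsion hypothesis enters here: the bracket stays in `fil i`, and its image under `L`
      -- is that of an element of `K`.
      obtain ⟨z, hz⟩ := hLi u hu.self_of_nhds _
        (C.parBr_mem_fil hi hτ u hX (Y := (x : EG)) (hKi x.2))
      refine ⟨z, ?_⟩
      rw [h1]
      refine Eq.trans ?_ hz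
      refine Eq.trans ?_ h3.symm
      rw [show fd C.par (fd C.par F) = fd C.par L from rfl, h2, sub_zero]
    have h5 : vd (fun u => S u x) u v = Pr (vd (fun u => A u x) u v) := vd_clm Pr hAx v
    -- Differentiating `V (S x) = A x`: the derivative of `A x` is `A z` and that of `S x` is `Pr (A
    -- z)`. Since `V (Pr (A z)) = A z`, the derivative of `V` must vanish.
    have h6 := vd_clm_apply hVd hSx v
    have h7 : (fun u' => V u' (S u' x)) =ᶠ[𝓝 u] fun u' => A u' x := by
      filter_upwards [hSu] with u' hu'
      exact hVS u' hu' x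
    rw [vd_congr h7, h5, hz] at h6
    have h8 : V u (Pr (A u z)) = A u z := hVS u hSu.self_of_nhds z
    rw [h8] at h6
    exact (add_eq_left.1 h6.symm)
  have hconst := eventually_eq_of_vd_eq_zero h.isOpen_preimage hu₀ h.contMDiffOn_comp
    (h.mfderiv_comp_surjective hu₀) hmain
  have hmap : ∀ u, C.π u ∈ U → g (C.π u) = y₀ →
      S u ∈ Set.range ((↑) : (K ≃L[ℝ] K) → K →L[ℝ] K) →
      ((D.fil i).map (C.frm (EY := EY) g u y₀)).map (chartCoord y₀ y₀).toLinearMap =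
        LinearMap.range (V u).toLinearMap := by
    intro u hu hgu hSu
    have hu' : C.π u ∈ U ∧ g (C.π u) ∈ (chartAt EY y₀).source := ⟨hu, by rw [hgu]; exact hy₀s⟩
    have hc : ∀ X : EG, chartCoord y₀ y₀ (C.frm (EY := EY) g u y₀ X) = L u X :=
      h.chartCoord_frm_of_eq hu hgu hy₀s
    apply le_antisymm
    · rintro _ ⟨_, ⟨X, hX, rfl⟩, rfl⟩
      obtain ⟨z, hz⟩ := hLi u hu' X hX
      refine ⟨S u z, ?_⟩
      exact (hVS u hSu z).trans (hz.symm.trans (hc X).symm)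
    · rintro _ ⟨w, rfl⟩
      obtain ⟨e, he⟩ := id hSu
      refine ⟨C.frm (EY := EY) g u y₀ (((e.symm w : K) : EG) : Lie EG G),
        ⟨_, hKi (e.symm w).2, rfl⟩, ?_⟩
      refine (hc _).trans ((hVS u hSu (e.symm w)).symm.trans ?_)
      rw [← he]
      exact congrArg (V u) (e.apply_symm_apply w)
  filter_upwards [hconst, hev, hSinv] with u h1 h2 h3 hgu
  refine Submodule.map_injective_of_injective (f := (chartCoord y₀ y₀).toLinearMap)
    (chartCoord_bijective hy₀s).1 ?_
  rw [hmap u h2.1 hgu h3, hmap u₀ hu₀ rfl (hSinv.self_of_nhds), h1 hgu]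

end ParabolicGeometry

/-- Functions that are locally constant along a connected fibre are constant on it. -/
theorem eq_of_eventually_eq_of_isConnected {X Z α : Type*} [TopologicalSpace X] {U : Set X}
    {ψ : X → Z} {z : Z} (h : IsConnected (U ∩ ψ ⁻¹' {z})) {R : X → α}
    (hR : ∀ x ∈ U, ψ x = z → ∀ᶠ x' in 𝓝 x, ψ x' = z → R x' = R x) {x x' : X}
    (hx : x ∈ U) (hxz : ψ x = z) (hx' : x' ∈ U) (hxz' : ψ x' = z) : R x = R x' := by
  -- For the discrete topology, local constancy along the fibre is continuity on it.
  let _ : TopologicalSpace α := ⊥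
  have : DiscreteTopology α := ⟨rfl⟩
  refine h.isPreconnected.constant (f := R) (fun x hx => ?_) ⟨hx, hxz⟩ ⟨hx', hxz'⟩
  refine Filter.Tendsto.mono_right (y := pure (R x)) ?_ (pure_le_nhds _)
  rw [Filter.tendsto_pure]
  filter_upwards [mem_nhdsWithin_of_mem_nhds (hR x hx.1 hx.2), self_mem_nhdsWithin] with x' h1 h2
  exact h1 h2.2

/-! ### The filtration of the leaf space -/

namespace ParabolicGeometry

variable {EG : Type*} [NormedAddCommGroup EG] [NormedSpace ℝ EG] [FiniteDimensional ℝ EG]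
  {G : Type*} [TopologicalSpace G] [ChartedSpace EG G] [Group G] [LieGroup 𝓘(ℝ, EG) ∞ G]
  {EP : Type*} [NormedAddCommGroup EP] [NormedSpace ℝ EP] [FiniteDimensional ℝ EP]
  {P : Type*} [TopologicalSpace P] [ChartedSpace EP P] [Group P] [LieGroup 𝓘(ℝ, EP) ∞ P]
  {EQ : Type*} [NormedAddCommGroup EQ] [NormedSpace ℝ EQ] [FiniteDimensional ℝ EQ]
  {Q : Type*} [TopologicalSpace Q] [ChartedSpace EQ Q] [Group Q] [LieGroup 𝓘(ℝ, EQ) ∞ Q]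
  {EM : Type*} [NormedAddCommGroup EM] [NormedSpace ℝ EM] [FiniteDimensional ℝ EM]
  {M : Type*} [TopologicalSpace M] [ChartedSpace EM M] [IsManifold 𝓘(ℝ, EM) ∞ M]
  {EB : Type*} [NormedAddCommGroup EB] [NormedSpace ℝ EB] [FiniteDimensional ℝ EB]
  {B : Type*} [TopologicalSpace B] [ChartedSpace EB B] [IsManifold 𝓘(ℝ, EB) ∞ B]
  {EY : Type*} [NormedAddCommGroup EY] [NormedSpace ℝ EY] [FiniteDimensional ℝ EY]
  {Y : Type*} [TopologicalSpace Y] [ChartedSpace EY Y] [IsManifold 𝓘(ℝ, EY) ∞ Y]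
  {D : NestedParabolics (Lie EG G)} {H : NestedGroups D EP P EQ Q}
  {C : ParabolicGeometry H EM M EB B}
  {U : Set M} {ψ : M → Y}

variable [LieAlgebra.IsSemisimple ℝ (Lie EG G)]

/-- With the identity of `M` as a submersion, the statements about `𝒱_i M` become instances of those
about adapted submersions. -/
theorem isAdapted_id (C : ParabolicGeometry H EM M EB B) :
    C.IsAdapted Set.univ (fun y : M => y) C.tanFil where
  isOpen := isOpen_univ
  smooth := contMDiffOn_id
  surj y _ v := ⟨v, DFunLike.congr_fun (mfderiv_id (I := 𝓘(ℝ, EM)) (x := y)) v⟩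
  ker y _ v hv := by
    have h1 : v = 0 :=
      (DFunLike.congr_fun (mfderiv_id (I := 𝓘(ℝ, EM)) (x := y)) v).symm.trans hv
    rw [h1]
    exact Submodule.zero_mem _
  map_eq i _ y _ := by
    have h1 : ∀ v, mfderiv 𝓘(ℝ, EM) 𝓘(ℝ, EM) (fun y : M => y) y v = v :=
      DFunLike.congr_fun (mfderiv_id (I := 𝓘(ℝ, EM)) (x := y))
    apply le_antisymm
    · rintro _ ⟨v, hv, rfl⟩
      exact (h1 v).symm ▸ hv
    · exact fun v hv => ⟨v, hv, h1 v⟩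

theorem IsLeafSpace.isRelSubmersion (h : C.IsLeafSpace EY U ψ) : C.IsRelSubmersion EY U ψ where
  isOpen := h.isOpen
  smooth := h.smooth
  surj := h.submersion
  ker y hy v hv := by
    rw [← C.relTangent_eq, ← h.ker_eq y hy]
    exact hv

theorem IsLeafSpace.frm_eq_zero (h : C.IsLeafSpace EY U ψ) {u : B} (hu : C.π u ∈ U)
    {X : Lie EG G} (hX : X ∈ D.fil 0) : C.frm (EY := EY) ψ u (ψ (C.π u)) X = 0 := by
  rw [C.frm_eq_comp (h.isRelSubmersion.mdifferentiableAt hu)]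
  have h1 := (C.toTangent_mem_tanFil_iff le_rfl u X).2 hX
  rw [← C.relTangent_eq, ← h.ker_eq _ hu] at h1
  exact h1

theorem IsRelSubmersion.map_frm_act (h : C.IsRelSubmersion EY U ψ) {u : B} (hu : C.π u ∈ U)
    (q : Q) (i : ℤ) (y : Y) : (D.fil i).map (C.frm (EY := EY) ψ (C.act u q) y) =
      (D.fil i).map (C.frm (EY := EY) ψ u y) := by
  rw [h.frm_act hu, Submodule.map_comp, map_Ad_fil]

/-- The images of the filtration components are constant along the fibres. -/
theorem IsLeafSpace.map_frm_eq (h : C.IsLeafSpace EY U ψ) {i : ℤ} (hi : i ≤ 0)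
    (hτ : C.TorsionMapsTo i i) {z : Y} {u u' : B} (hu : C.π u ∈ U) (hz : ψ (C.π u) = z)
    (hu' : C.π u' ∈ U) (hz' : ψ (C.π u') = z) :
    (D.fil i).map (C.frm (EY := EY) ψ u z) = (D.fil i).map (C.frm (EY := EY) ψ u' z) := by
  choose v hv using C.π_surjective
  -- The image does not depend on the point over `y`, so it is a function on the fibre of `ψ`, where
  -- connectedness is available.
  have hv' : ∀ u, C.π u ∈ U → (D.fil i).map (C.frm (EY := EY) ψ (v (C.π u)) z) =
      (D.fil i).map (C.frm (EY := EY) ψ u z) := by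
    intro u hu
    obtain ⟨q, hq⟩ := C.exists_act_eq (hv (C.π u)).symm
    rw [← hq, h.isRelSubmersion.map_frm_act hu]
  rw [← hv' u hu, ← hv' u' hu']
  refine eq_of_eventually_eq_of_isConnected (h.connected_fibers z)
    (R := fun y => (D.fil i).map (C.frm (EY := EY) ψ (v y) z)) ?_ hu hz hu' hz'
  rintro y hy rfl
  obtain ⟨u, rfl⟩ := C.π_surjective y
  obtain ⟨s, O, hO, hyO, hs, hsu, hπs⟩ := C.exists_section_through u
  have h1 := h.isRelSubmersion.eventually_map_frm_eq
    (fun u hu X hX => h.frm_eq_zero hu hX) hi hτ hy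
  have h2 : Filter.Tendsto s (𝓝 (C.π u)) (𝓝 u) := by
    have h3 := (hs.continuousOn.continuousAt (hO.mem_nhds hyO))
    rwa [ContinuousAt, hsu] at h3
  filter_upwards [h2.eventually h1, hO.mem_nhds hyO, h.isOpen.mem_nhds hy] with y' h3 h4 h5 h6
  have h7 := hv' (s y') (by rw [hπs y' h4]; exact h5)
  rw [hπs y' h4] at h7
  rw [h7, hv' u hy]
  exact h3 (by rw [hπs y' h4]; exact h6)

/-- The span over the whole fibre of `ψ` is the image at any one point, since all these images
coincide. -/
theorem IsLeafSpace.tanFilN_eq (h : C.IsLeafSpace EY U ψ) {i : ℤ} (hi : i ≤ 0)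
    (hτ : C.TorsionMapsTo i i) {u : B} (hu : C.π u ∈ U) :
    C.tanFilN EY U ψ i (ψ (C.π u)) = (D.fil i).map (C.frm (EY := EY) ψ u (ψ (C.π u))) := by
  have hfrm : ∀ u, C.π u ∈ U → ∀ X, (C.frm (EY := EY) ψ u (ψ (C.π u)) X) =
      mfderiv 𝓘(ℝ, EM) 𝓘(ℝ, EY) ψ (C.π u) (C.toTangent u X) := fun u hu X =>
    DFunLike.congr_fun (C.frm_eq_comp (h.isRelSubmersion.mdifferentiableAt hu)) X
  apply le_antisymm
  · refine Submodule.span_le.2 ?_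
    rintro w ⟨y', hy', v, hv, hw⟩
    obtain ⟨u', rfl⟩ := C.π_surjective y'
    rw [C.tanFil_π] at hv
    obtain ⟨X, hX, rfl⟩ := hv
    have h1 : ψ (C.π u) = ψ (C.π u') := congrArg Bundle.TotalSpace.proj hw
    have h2 : (w : EY) = mfderiv 𝓘(ℝ, EM) 𝓘(ℝ, EY) ψ (C.π u') (C.toTangent u' X) :=
      eq_of_heq ((Bundle.TotalSpace.mk.injEq _ _ _ _).mp hw).2
    rw [h.map_frm_eq hi hτ hu rfl hy' h1.symm]
    exact ⟨X, hX, (hfrm u' hy' X).trans h2.symm⟩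
  · rintro _ ⟨X, hX, rfl⟩
    refine Submodule.subset_span ⟨C.π u, hu, C.toTangent u X, ?_, ?_⟩
    · rw [C.tanFil_π]
      exact ⟨X, hX, rfl⟩
    · rw [hfrm u hu]

theorem IsLeafSpace.isAdapted (h : C.IsLeafSpace EY U ψ)
    (hτ : ∀ i : ℤ, i ≤ 0 → C.TorsionMapsTo i i) : C.IsAdapted U ψ (C.tanFilN EY U ψ) where
  toIsRelSubmersion := h.isRelSubmersion
  map_eq i hi y hy := by
    obtain ⟨u, rfl⟩ := C.π_surjective y
    rw [h.tanFilN_eq hi (hτ i hi) hy, C.frm_eq_comp (h.isRelSubmersion.mdifferentiableAt hy),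
      C.tanFil_π, ← Submodule.map_comp]

theorem IsLeafSpace.comap_tanFilN (h : C.IsLeafSpace EY U ψ)
    (hτ : ∀ i : ℤ, i ≤ 0 → C.TorsionMapsTo i i) {i : ℤ} (hi : i ≤ 0) {y : M} (hy : y ∈ U) :
    (C.tanFilN EY U ψ i (ψ y)).comap (mfderiv 𝓘(ℝ, EM) 𝓘(ℝ, EY) ψ y).toLinearMap =
      C.tanFil i y := by
  obtain ⟨u, rfl⟩ := C.π_surjective y
  have h1 := (h.isAdapted hτ).isFrame hy
  ext v
  obtain ⟨X, rfl⟩ := C.toTangent_surjective u v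
  rw [C.toTangent_mem_tanFil_iff hi, ← h1.mem_iff hi,
    C.frm_eq_comp (h.isRelSubmersion.mdifferentiableAt hy)]
  rfl

theorem IsLeafSpace.tanFilN_zero (h : C.IsLeafSpace EY U ψ)
    (hτ : ∀ i : ℤ, i ≤ 0 → C.TorsionMapsTo i i) (z : Y) : C.tanFilN EY U ψ 0 z = ⊥ := by
  obtain ⟨y, hy, rfl⟩ : z ∈ ψ '' U := h.surjective ▸ Set.mem_univ z
  obtain ⟨u, rfl⟩ := C.π_surjective y
  rw [h.tanFilN_eq le_rfl (hτ 0 le_rfl) hy, eq_bot_iff]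
  rintro _ ⟨X, hX, rfl⟩
  exact h.frm_eq_zero hy hX

theorem IsLeafSpace.isSmoothSubbundle (h : C.IsLeafSpace EY U ψ)
    (hτ : ∀ i : ℤ, i ≤ 0 → C.TorsionMapsTo i i) {i : ℤ} (hi : i ≤ 0) :
    IsSmoothSubbundle (C.tanFilN EY U ψ i) :=
  (h.isAdapted hτ).isSmoothSubbundle h.surjective (fun _ hu _ hX => h.frm_eq_zero hu hX) hi

/-- Passing through `𝒱_i M` gives the same frames of `gr_i(TN)` as the frame map to `TN`. -/
theorem IsLeafSpace.grψ_toVBundle (h : C.IsLeafSpace EY U ψ)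
    (hτ : ∀ i : ℤ, i ≤ 0 → C.TorsionMapsTo i i) {i : ℤ} (hi : i < 0) {u : B} (hu : C.π u ∈ U)
    (w : D.VV i) : C.grψ EY U ψ (C.π u) i (C.toVBundle u i w) =
      grOf D (fun i => C.tanFilN EY U ψ i (ψ (C.π u))) (C.frm ψ u (ψ (C.π u))) i w := by
  have hi' : i + 1 ≤ 0 := by omega
  have h1 : ∀ j ≤ 0, ∀ x ∈ D.fil j, C.toTangent u x ∈ C.tanFil j (C.π u) := fun j hj x hx =>
    (C.toTangent_mem_tanFil_iff hj u x).2 hx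
  have h2 : ∀ j ≤ 0, ∀ v ∈ C.tanFil j (C.π u), mfderiv 𝓘(ℝ, EM) 𝓘(ℝ, EY) ψ (C.π u) v ∈
      C.tanFilN EY U ψ j (ψ (C.π u)) := by
    intro j hj v hv
    rw [← h.comap_tanFilN hτ hj hu] at hv
    exact hv
  unfold grOf
  rw [C.frm_eq_comp (h.isRelSubmersion.mdifferentiableAt hu)]
  exact grMap_grMap (h1 _ hi.le) (h1 _ hi') (h2 _ hi.le) (h2 _ hi') w

theorem IsLeafSpace.grψ_bijective (h : C.IsLeafSpace EY U ψ)
    (hτ : ∀ i : ℤ, i ≤ 0 → C.TorsionMapsTo i i) {i : ℤ} (hi : i < 0) {y : M} (hy : y ∈ U) :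
    Function.Bijective (C.grψ EY U ψ y i) := by
  have h1 := h.comap_tanFilN hτ (show i + 1 ≤ 0 by omega) hy
  refine grMap_bijective ((h.isAdapted hτ).map_eq i hi.le y hy) (fun v hv => ?_) fun v _ hv => ?_
  · rw [← h1] at hv
    exact hv
  · rw [← h1]
    exact hv

/-- The isomorphisms induced by `Tψ` are smooth. -/
theorem IsLeafSpace.isSmoothGrSection_iff (h : C.IsLeafSpace EY U ψ)
    (hτ : ∀ i : ℤ, i ≤ 0 → C.TorsionMapsTo i i) {i : ℤ} (hi : i < 0) {V : Set M} (hVU : V ⊆ U)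
    (hV : IsOpen V) (t : ∀ y, C.VBundle i y) :
    IsSmoothGrSection EM (fun y : M => y) (C.tanFil i) (C.tanFil (i + 1)) V t ↔
      IsSmoothGrSection EM ψ (C.tanFilN EY U ψ i) (C.tanFilN EY U ψ (i + 1)) V
        (fun y => C.grψ EY U ψ y i (t y)) := by
  let e : (Fin (Module.finrank ℝ (D.VV i)) → ℝ) ≃ₗ[ℝ] D.VV i :=
    (Module.finBasis ℝ (D.VV i)).equivFun.symm
  -- Both sections are represented by the same function `s` on the Cartan bundle, to which both
  -- smoothness statements are reduced.
  choose s hs using fun u => ((isAdapted_id C).isFrame (Set.mem_univ (C.π u))).grOf_bijective hi |>.2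
    (t (C.π u))
  have h1 : ∀ u, C.π u ∈ V → grOf D (fun i => C.tanFilN EY U ψ i (ψ (C.π u)))
      (C.frm ψ u (ψ (C.π u))) i (s u) = C.grψ EY U ψ (C.π u) i (t (C.π u)) := by
    intro u hu
    rw [← h.grψ_toVBundle hτ hi (hVU hu), ← hs u]
    rfl
  constructor
  · intro ht
    exact (h.isAdapted hτ).isSmoothGrSection_of_contMDiffOn hi hV hVU e h1
      ((isAdapted_id C).contMDiffOn_of_isSmoothGrSection hi hV (Set.subset_univ V) ht e
        fun u _ => hs u)
  · intro ht
    exact (isAdapted_id C).isSmoothGrSection_of_contMDiffOn hi hV (Set.subset_univ V) e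
      (fun u _ => hs u)
      ((h.isAdapted hτ).contMDiffOn_of_isSmoothGrSection hi hV hVU ht e h1)

end ParabolicGeometry

/-! ### Parallel transport along the fibres -/

namespace ParabolicGeometry

variable {EG : Type*} [NormedAddCommGroup EG] [NormedSpace ℝ EG] [FiniteDimensional ℝ EG]
  {G : Type*} [TopologicalSpace G] [ChartedSpace EG G] [Group G] [LieGroup 𝓘(ℝ, EG) ∞ G]
  {EP : Type*} [NormedAddCommGroup EP] [NormedSpace ℝ EP] [FiniteDimensional ℝ EP]
  {P : Type*} [TopologicalSpace P] [ChartedSpace EP P] [Group P] [LieGroup 𝓘(ℝ, EP) ∞ P]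
  {EQ : Type*} [NormedAddCommGroup EQ] [NormedSpace ℝ EQ] [FiniteDimensional ℝ EQ]
  {Q : Type*} [TopologicalSpace Q] [ChartedSpace EQ Q] [Group Q] [LieGroup 𝓘(ℝ, EQ) ∞ Q]
  {EM : Type*} [NormedAddCommGroup EM] [NormedSpace ℝ EM] [FiniteDimensional ℝ EM]
  {M : Type*} [TopologicalSpace M] [ChartedSpace EM M] [IsManifold 𝓘(ℝ, EM) ∞ M]
  {EB : Type*} [NormedAddCommGroup EB] [NormedSpace ℝ EB] [FiniteDimensional ℝ EB]
  {B : Type*} [TopologicalSpace B] [ChartedSpace EB B] [IsManifold 𝓘(ℝ, EB) ∞ B]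
  {EY : Type*} [NormedAddCommGroup EY] [NormedSpace ℝ EY] [FiniteDimensional ℝ EY]
  {Y : Type*} [TopologicalSpace Y] [ChartedSpace EY Y] [IsManifold 𝓘(ℝ, EY) ∞ Y]
  {D : NestedParabolics (Lie EG G)} {H : NestedGroups D EP P EQ Q}
  {C : ParabolicGeometry H EM M EB B}
  {U : Set M} {g : M → Y} {A : ℤ → ∀ y : Y, Submodule ℝ (TangentSpace 𝓘(ℝ, EY) y)}

variable [LieAlgebra.IsSemisimple ℝ (Lie EG G)]
variable {ι : Type*} [Fintype ι] {n : ι → ℕ} {k : ι → ℤ}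
  (b : ∀ i, (Fin (n i) → ℝ) ≃ₗ[ℝ] D.VV (k i))
  {W : Type*} [NormedAddCommGroup W] [NormedSpace ℝ W] (F : TensorialConstruction n W)

theorem mdifferentiableAt_rep_apply {T : B → ∀ i, (Fin (n i) → ℝ) →L[ℝ] (Fin (n i) → ℝ)} {u : B}
    (hT : MDifferentiableAt 𝓘(ℝ, EB) 𝓘(ℝ, ∀ i, (Fin (n i) → ℝ) →L[ℝ] (Fin (n i) → ℝ)) T u)
    (hu : IsUnit (T u)) {f : B → W} (hf : MDifferentiableAt 𝓘(ℝ, EB) 𝓘(ℝ, W) f u) :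
    MDifferentiableAt 𝓘(ℝ, EB) 𝓘(ℝ, W) (fun u => F.rep (T u) (f u)) u := by
  have h1 : DifferentiableAt ℝ F.rep (T u) := (F.contDiffAt_rep hu).differentiableAt (by norm_num)
  have h2 : MDifferentiableAt 𝓘(ℝ, EB) 𝓘(ℝ, W →L[ℝ] W) (fun u => F.rep (T u)) u :=
    MDifferentiableAt.comp (I' := 𝓘(ℝ, ∀ i, (Fin (n i) → ℝ) →L[ℝ] (Fin (n i) → ℝ)))
      (g := F.rep) u h1.mdifferentiableAt hT
  exact h2.clm_apply hf

/-- A solution of the equation defining parallel transport along the leaves intertwines the relative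
tractor connection with the derivative. -/
theorem vd_rep_apply_eq (hk : ∀ i, k i < 0)
    {T : B → ∀ i, (Fin (n i) → ℝ) →L[ℝ] (Fin (n i) → ℝ)} {u : B}
    (hT : MDifferentiableAt 𝓘(ℝ, EB) 𝓘(ℝ, ∀ i, (Fin (n i) → ℝ) →L[ℝ] (Fin (n i) → ℝ)) T u)
    (hu : IsUnit (T u)) {f : B → W} (hf : MDifferentiableAt 𝓘(ℝ, EB) 𝓘(ℝ, W) f u) (Z : Lie EP P)
    (hTZ : vd T u ((C.conn u).symm (dHom H.jP Z)) =
      T u * grMat b (LieAlgebra.ad ℝ (Lie EG G) (dHom H.jP Z))) :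
    vd (fun u => F.rep (T u) (f u)) u ((C.conn u).symm (dHom H.jP Z)) =
      F.rep (T u) (C.relTractorConnection (tensorRep H F k b) f u Z) := by
  have h1 : DifferentiableAt ℝ F.rep (T u) := (F.contDiffAt_rep hu).differentiableAt (by norm_num)
  have h2 : MDifferentiableAt 𝓘(ℝ, EB) 𝓘(ℝ, W →L[ℝ] W) (fun u => F.rep (T u)) u :=
    MDifferentiableAt.comp (I' := 𝓘(ℝ, ∀ i, (Fin (n i) → ℝ) →L[ℝ] (Fin (n i) → ℝ)))
      (g := F.rep) u h1.mdifferentiableAt hT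
  have h3 := vd_comp h1 hT ((C.conn u).symm (dHom H.jP Z))
  -- The equation for `T` makes the derivative of `F.rep (T u)` equal to `F.rep (T u)` composed with
  -- the infinitesimal representation, so the Leibniz rule yields the tractor connection.
  rw [hTZ, F.fderiv_rep_mul hu, ← vd_tensorRep b H F hk] at h3
  rw [vd_clm_apply h2 hf, h3]
  exact (map_add (F.rep (T u)) _ _).symm

/-- Local parallel transport along the fibres of an adapted submersion. -/
theorem IsAdapted.exists_transport (h : C.IsAdapted U g A)
    (hker : ∀ u, C.π u ∈ U → ∀ X ∈ D.fil 0, C.frm (EY := EY) g u (g (C.π u)) X = 0)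
    (hτ : ∀ i : ℤ, i ≤ 0 → C.TorsionMapsTo i i)
    (hτ' : ∀ i : ℤ, i < 0 → C.TorsionMapsTo i (i + 1)) (hk : ∀ i, k i < 0)
    {u₀ : B} (hu₀ : C.π u₀ ∈ U) :
    ∃ T : B → ∀ i, (Fin (n i) → ℝ) →L[ℝ] (Fin (n i) → ℝ),
      ∀ᶠ u in 𝓝 u₀, g (C.π u) = g (C.π u₀) → IsUnit (T u) ∧
        MDifferentiableAt 𝓘(ℝ, EB) 𝓘(ℝ, ∀ i, (Fin (n i) → ℝ) →L[ℝ] (Fin (n i) → ℝ)) T u ∧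
        (∀ a : F.obj (fun i => Gr (A (k i) (g (C.π u₀))) (A (k i + 1) (g (C.π u₀)))),
          F.rep (T u) (a.1 (C.grFrame g A b u (g (C.π u₀)))) =
            a.1 (C.grFrame g A b u₀ (g (C.π u₀)))) ∧
        ∀ X ∈ D.fil 0, vd T u ((C.conn u).symm X) =
          T u * grMat b (LieAlgebra.ad ℝ (Lie EG G) X) := by
  set y₀ := g (C.π u₀) with hy₀
  have hy₀s := mem_chart_source EY y₀
  let Fc := C.chartMap (EY := EY) g y₀
  let L : B → EG →L[ℝ] EY := fd C.par Fc
  have hF : ∀ u, C.π u ∈ U ∧ g (C.π u) ∈ (chartAt EY y₀).source →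
      ContMDiffAt 𝓘(ℝ, EB) 𝓘(ℝ, EY) ∞ Fc u := fun u hu => h.contMDiffAt_chartMap hu.1 hu.2
  have hLd : ∀ u, C.π u ∈ U ∧ g (C.π u) ∈ (chartAt EY y₀).source →
      MDifferentiableAt 𝓘(ℝ, EB) 𝓘(ℝ, EG →L[ℝ] EY) L u := fun u hu =>
    (contMDiffAt_fd C.isSmoothPar_par (hF u hu)).mdifferentiableAt (by norm_num)
  have hev := h.eventually_mem hu₀
  rw [← hy₀] at hev
  have hfr₀ := h.isFrame_of_eq hu₀ hy₀.symm
  have hc₀ : ∀ X : EG, chartCoord y₀ y₀ (C.frm (EY := EY) g u₀ y₀ X) = L u₀ X :=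
    h.chartCoord_frm_of_eq hu₀ hy₀.symm hy₀s
  have hLs : Function.Surjective (L u₀) := by
    intro y
    obtain ⟨w, rfl⟩ := (chartCoord_bijective hy₀s).2 y
    obtain ⟨X, rfl⟩ := hfr₀.surj w
    exact ⟨X, (hc₀ X).symm⟩
  obtain ⟨R₀, hR₀⟩ := (L u₀).toLinearMap.exists_rightInverse_of_surjective
    (LinearMap.range_eq_top.2 hLs)
  let R : EY →L[ℝ] EG := LinearMap.toContinuousLinearMap R₀
  let r : TangentSpace 𝓘(ℝ, EY) y₀ →ₗ[ℝ] Lie EG G :=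
    (R.toLinearMap ∘ₗ (chartCoord y₀ y₀).toLinearMap : TangentSpace 𝓘(ℝ, EY) y₀ →ₗ[ℝ] EG)
  have hr : ∀ y, C.frm (EY := EY) g u₀ y₀ (r y) = y := fun y =>
    (chartCoord_bijective hy₀s).1 ((hc₀ _).trans (DFunLike.congr_fun hR₀ (chartCoord y₀ y₀ y)))
  obtain ⟨Φ, hΦ⟩ := exists_clm_grMat b hk
  have hRL : ∀ u, C.π u ∈ U ∧ g (C.π u) ∈ (chartAt EY y₀).source →
      MDifferentiableAt 𝓘(ℝ, EB) 𝓘(ℝ, EG →L[ℝ] EG) (fun u => R ∘L L u) u := fun u hu =>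
    mdifferentiableAt_const.clm_comp (hLd u hu)
  -- On the fibre through `u₀` this is the matrix of a map `f` with `frm u₀ ∘ f = frm u`, so it
  -- compares the two graded frames. Using `Φ` and the chart makes it a differentiable function of
  -- `u` off the fibre as well.
  refine ⟨fun u => Φ (R ∘L L u), ?_⟩
  filter_upwards [hev.eventually_nhds] with u hu hgu
  have hu' := hu.self_of_nhds
  have hfr := h.isFrame_of_eq hu'.1 hgu
  let f : Lie EG G →ₗ[ℝ] Lie EG G := r ∘ₗ C.frm (EY := EY) g u y₀
  have hf : PreservesFil D f := hfr₀.preservesFil_of_rightInverse hfr hr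
  have hTf : C.frm (EY := EY) g u₀ y₀ ∘ₗ f = C.frm (EY := EY) g u y₀ :=
    IsFrame.comp_rightInverse hr
  have hcu : ∀ X : EG, (f X : EG) = R (L u X) := fun X =>
    congrArg R (h.chartCoord_frm_of_eq hu'.1 hgu hy₀s X)
  have hTu : Φ (R ∘L L u) = grMat b f := by
    rw [hΦ f hf]
    exact congrArg Φ (ContinuousLinearMap.ext fun X => (hcu X).symm)
  have hunit : IsUnit (grMat b f) := hfr₀.bijective_grMat b hfr hk hf hTf
  refine ⟨?_, ?_, ?_, ?_⟩
  · rw [hTu]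
    exact hunit
  · exact Φ.differentiableAt.mdifferentiableAt.comp (I' := 𝓘(ℝ, EG →L[ℝ] EG)) u (hRL u hu')
  · intro a
    rw [hTu, ← a.2.1 (C.grFrame g A b u₀ y₀) (h.bijective_grFrame b hk hu₀ hy₀.symm) _ hunit]
    refine congrArg _ (congrArg a.1 (funext fun i => ?_))
    unfold grFrame
    rw [← hTf, hfr₀.grOf_comp b hk hf]
  · intro (X : EG) hX
    have hL' : ∀ Y : EG, fd C.par L u X Y = L u (parBr C.par u X Y) := by
      intro Y
      have h2 : fd C.par L u Y X = 0 := by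
        have h3 := vd_clm (ContinuousLinearMap.apply ℝ EY (X : EG)) (hLd u hu') ((C.par u).symm Y)
        refine h3.symm.trans ?_
        have h4 : (fun u' => ContinuousLinearMap.apply ℝ EY (X : EG) (L u')) =ᶠ[𝓝 u]
            fun _ => (0 : EY) := by
          filter_upwards [hu] with u' hu'
          refine (h.chartCoord_frm hu'.1 hu'.2 X).symm.trans ?_
          rw [hker u' hu'.1 X hX, map_zero]
        rw [vd_congr h4]
        unfold vd
        rw [mfderiv_const]
        rfl
      have h3 := fd_parBr C.isSmoothPar_par (hF u hu') X Y
      refine Eq.trans ?_ h3.symm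
      rw [show fd C.par (fd C.par Fc) = fd C.par L from rfl, h2, sub_zero]
    let m : Lie EG G →ₗ[ℝ] Lie EG G := ((R ∘L fd C.par L u X : EG →L[ℝ] EG) : EG →ₗ[ℝ] EG)
    have hm : ∀ Y : EG, m Y = f (parBr C.par u X Y : EG) := fun Y =>
      (congrArg R (hL' Y)).trans (hcu _).symm
    have hmfil : PreservesFil D m := by
      intro i hi (Y : EG) hY
      have h1 := hf i hi _ (C.parBr_mem_fil hi (hτ i hi) u hX hY)
      exact (congrArg (fun w : EG => (w : Lie EG G) ∈ D.fil i) (hm Y)).mpr h1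
    have had := preservesFil_adL hX
    have hfad := hf.comp had
    -- The derivative `m` of the comparison map and `f ∘ ad X` differ by `f` applied to a curvature
    -- term; under the stronger torsion condition this raises the degree and is invisible on the
    -- graded pieces.
    have hmad : grMat b m = grMat b (f ∘ₗ LieAlgebra.ad ℝ (Lie EG G) X) := by
      funext i
      have h1 : k i ≤ 0 := (hk i).le
      have h2 : k i + 1 ≤ 0 := by have := hk i; omega
      unfold grMat
      rw [grMap_congr (f' := m) (hfad _ h1) (hfad _ h2) (hmfil _ h1) (hmfil _ h2)]
      intro (Y : EG) hY
      have h3 := hf _ h2 _ (C.parBr_sub_lie_mem_fil (hk i) (hτ' _ (hk i)) u hX hY)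
      have h4 : m Y - (f ∘ₗ LieAlgebra.ad ℝ (Lie EG G) X) Y =
          f ((parBr C.par u X Y - lieB G X Y : EG) : Lie EG G) := by
        refine Eq.trans ?_ (map_sub f ((parBr C.par u X Y : EG) : Lie EG G)
          ((lieB G X Y : EG) : Lie EG G)).symm
        exact congrArg (· - (f ∘ₗ LieAlgebra.ad ℝ (Lie EG G) X) Y) (hm Y)
      rw [h4]
      exact h3
    have hvd : vd (fun u => Φ (R ∘L L u)) u ((C.conn u).symm X) =
        Φ (R ∘L fd C.par L u X) := by
      have h1 := vd_clm (W' := ∀ i, (Fin (n i) → ℝ) →L[ℝ] (Fin (n i) → ℝ))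
        (Φ ∘L ContinuousLinearMap.compL ℝ EG EY EG R) (hLd u hu') ((C.conn u).symm X)
      exact h1
    rw [hvd, hTu, ← grMat_comp b hk hf had, ← hmad, hΦ m hmfil]
    rfl

end ParabolicGeometry

/-! ### Parallel sections descend to the leaf space -/

namespace ParabolicGeometry

variable {EG : Type*} [NormedAddCommGroup EG] [NormedSpace ℝ EG] [FiniteDimensional ℝ EG]
  {G : Type*} [TopologicalSpace G] [ChartedSpace EG G] [Group G] [LieGroup 𝓘(ℝ, EG) ∞ G]
  {EP : Type*} [NormedAddCommGroup EP] [NormedSpace ℝ EP] [FiniteDimensional ℝ EP]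
  {P : Type*} [TopologicalSpace P] [ChartedSpace EP P] [Group P] [LieGroup 𝓘(ℝ, EP) ∞ P]
  {EQ : Type*} [NormedAddCommGroup EQ] [NormedSpace ℝ EQ] [FiniteDimensional ℝ EQ]
  {Q : Type*} [TopologicalSpace Q] [ChartedSpace EQ Q] [Group Q] [LieGroup 𝓘(ℝ, EQ) ∞ Q]
  {EM : Type*} [NormedAddCommGroup EM] [NormedSpace ℝ EM] [FiniteDimensional ℝ EM]
  {M : Type*} [TopologicalSpace M] [ChartedSpace EM M] [IsManifold 𝓘(ℝ, EM) ∞ M]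
  {EB : Type*} [NormedAddCommGroup EB] [NormedSpace ℝ EB] [FiniteDimensional ℝ EB]
  {B : Type*} [TopologicalSpace B] [ChartedSpace EB B] [IsManifold 𝓘(ℝ, EB) ∞ B]
  {EY : Type*} [NormedAddCommGroup EY] [NormedSpace ℝ EY] [FiniteDimensional ℝ EY]
  {Y : Type*} [TopologicalSpace Y] [ChartedSpace EY Y] [IsManifold 𝓘(ℝ, EY) ∞ Y]
  {D : NestedParabolics (Lie EG G)} {H : NestedGroups D EP P EQ Q}
  {C : ParabolicGeometry H EM M EB B}
  {U : Set M} {ψ : M → Y}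

variable [LieAlgebra.IsSemisimple ℝ (Lie EG G)]
variable {ι : Type*} [Fintype ι] {n : ι → ℕ} {k : ι → ℤ}
  (b : ∀ i, (Fin (n i) → ℝ) ≃ₗ[ℝ] D.VV (k i))
  {W : Type*} [NormedAddCommGroup W] [NormedSpace ℝ W] (F : TensorialConstruction n W)

theorem dHom_jP_mem_fil_zero (H : NestedGroups D EP P EQ Q) (Z : Lie EP P) :
    dHom (EG := EG) H.jP Z ∈ D.fil 0 := by
  rw [← range_dHom_jP H]
  exact LinearMap.mem_range_self _ Z

theorem IsLeafSpace.grFrame_eq (h : C.IsLeafSpace EY U ψ)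
    (hτ : ∀ i : ℤ, i ≤ 0 → C.TorsionMapsTo i i) (hk : ∀ i, k i < 0) {u : B} (hu : C.π u ∈ U) :
    (fun i => C.grψ EY U ψ (C.π u) (k i) ∘ₗ C.toVBundle u (k i) ∘ₗ (b i).toLinearMap) =
      C.grFrame ψ (C.tanFilN EY U ψ) b u (ψ (C.π u)) :=
  funext fun i => LinearMap.ext fun e => h.grψ_toVBundle hτ (hk i) hu (b i e)

/-- Along the fibres, parallel sections are locally given by parallel transport. -/
theorem IsLeafSpace.eventually_eq_of_isParallel (h : C.IsLeafSpace EY U ψ)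
    (hk : ∀ i, k i < 0)
    {f : B → W} (hf : ContMDiffOn 𝓘(ℝ, EB) 𝓘(ℝ, W) ∞ f (C.π ⁻¹' U))
    (hpar : C.IsParallel (tensorRep H F k b) U f) {u₀ : B} (hu₀ : C.π u₀ ∈ U)
    {T : B → ∀ i, (Fin (n i) → ℝ) →L[ℝ] (Fin (n i) → ℝ)}
    (hT : ∀ᶠ u in 𝓝 u₀, ψ (C.π u) = ψ (C.π u₀) → IsUnit (T u) ∧
        MDifferentiableAt 𝓘(ℝ, EB) 𝓘(ℝ, ∀ i, (Fin (n i) → ℝ) →L[ℝ] (Fin (n i) → ℝ)) T u ∧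
        ∀ X ∈ D.fil 0, vd T u ((C.conn u).symm X) =
          T u * grMat b (LieAlgebra.ad ℝ (Lie EG G) X)) :
    ∀ᶠ u in 𝓝 u₀, ψ (C.π u) = ψ (C.π u₀) → F.rep (T u) (f u) = F.rep (T u₀) (f u₀) := by
  have hr := h.isRelSubmersion
  refine eventually_eq_of_vd_eq_zero hr.isOpen_preimage hu₀ hr.contMDiffOn_comp
    (hr.mfderiv_comp_surjective hu₀) (g := fun u => F.rep (T u) (f u)) ?_
  filter_upwards [hT, hr.isOpen_preimage.mem_nhds hu₀] with u hu huU hgu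
  obtain ⟨h1, h2, h3⟩ := hu hgu
  have hfd : MDifferentiableAt 𝓘(ℝ, EB) 𝓘(ℝ, W) f u :=
    (hf.contMDiffAt (hr.isOpen_preimage.mem_nhds huU)).mdifferentiableAt (by norm_num)
  refine ⟨mdifferentiableAt_rep_apply F h2 h1 hfd, fun v hv => ?_⟩
  have hX : ((C.par u v : EG) : Lie EG G) ∈ D.fil 0 :=
    hr.mem_fil_zero huU ((frm_par_eq_mfderiv C u v).trans hv)
  rw [← range_dHom_jP H] at hX
  obtain ⟨Z, hZ⟩ := hX
  have h4 : v = (C.conn u).symm (dHom H.jP Z) := by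
    rw [hZ]
    exact ((C.conn u).symm_apply_apply v).symm
  rw [h4, vd_rep_apply_eq b F hk h2 h1 hfd Z (h3 _ (dHom_jP_mem_fil_zero H Z)), hpar u huU Z,
    map_zero]

/-- Parallel sections descend to the leaf space. -/
theorem IsLeafSpace.exists_descent (h : C.IsLeafSpace EY U ψ)
    (hτ : ∀ i : ℤ, i ≤ 0 → C.TorsionMapsTo i i)
    (hτ' : ∀ i : ℤ, i < 0 → C.TorsionMapsTo i (i + 1)) (hk : ∀ i, k i < 0)
    {f : B → W} (hf : ContMDiffOn 𝓘(ℝ, EB) 𝓘(ℝ, W) ∞ f (C.π ⁻¹' U))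
    (hsec : C.IsSection (tensorRep H F k b) U f)
    (hpar : C.IsParallel (tensorRep H F k b) U f) (z : Y) :
    ∃ a : F.obj fun i => C.grTN EY U ψ (k i) z, ∀ u, C.π u ∈ U → ψ (C.π u) = z →
      a.1 (C.grFrame ψ (C.tanFilN EY U ψ) b u z) = f u := by
  classical
  have ha := h.isAdapted hτ
  have hbij : ∀ u, C.π u ∈ U → ψ (C.π u) = z →
      ∀ i, Function.Bijective (C.grFrame ψ (C.tanFilN EY U ψ) b u z i) := fun u hu hz =>
    ha.bijective_grFrame b hk hu hz
  choose a ha' using fun u hu hz => (F.bijective_eval (hbij u hu hz)).2 (f u)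
  -- The element with value `f u` on the frame of `u` depends only on `π u`, by equivariance of `f`.
  have hact : ∀ u u', C.π u = C.π u' → ∀ hu hz hu' hz', a u hu hz = a u' hu' hz' := by
    intro u u' huu' hu hz hu' hz'
    obtain ⟨q, rfl⟩ := C.exists_act_eq huu'
    refine (F.bijective_eval (hbij u hu hz)).1 ?_
    change (a u hu hz).1 _ = (a _ hu' hz').1 _
    rw [← ha.rep_grFrame_act b F hk hu hz q (a _ hu' hz')]
    refine (ha' u hu hz).trans ((hsec u hu q).symm.trans ?_)
    exact congrArg (tensorRep H F k b (H.jQ q)) (ha' _ hu' hz').symm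
  choose v hv using C.π_surjective
  let R : M → F.obj fun i => C.grTN EY U ψ (k i) z := fun y =>
    if hy : C.π (v y) ∈ U ∧ ψ (C.π (v y)) = z then a (v y) hy.1 hy.2 else 0
  have hR : ∀ u, ∀ hu : C.π u ∈ U, ∀ hz : ψ (C.π u) = z, R (C.π u) = a u hu hz := by
    intro u hu hz
    have hy : C.π (v (C.π u)) ∈ U ∧ ψ (C.π (v (C.π u))) = z := by
      rw [hv]
      exact ⟨hu, hz⟩
    simp only [R, dif_pos hy]
    exact hact _ _ (hv _) _ _ _ _
  -- Evaluated on the frame at `u₀`, the element at a nearby point `u` of the fibre is `F.rep (T u)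
  -- (f u)`, which is locally constant for parallel `f`.
  have hloc : ∀ y ∈ U, ψ y = z → ∀ᶠ y' in 𝓝 y, ψ y' = z → R y' = R y := by
    intro y hy hyz
    obtain ⟨u₀, rfl⟩ := C.π_surjective y
    obtain ⟨T, hT⟩ := ha.exists_transport b F (fun u hu X hX => h.frm_eq_zero hu hX) hτ hτ' hk hy
    have h1 := h.eventually_eq_of_isParallel b F hk hf hpar hy (T := T) (by
      filter_upwards [hT] with u hu hgu
      exact ⟨(hu hgu).1, (hu hgu).2.1, (hu hgu).2.2.2⟩)
    obtain ⟨s, O, hO, hyO, hs, hsu, hπs⟩ := C.exists_section_through u₀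
    have h2 : Filter.Tendsto s (𝓝 (C.π u₀)) (𝓝 u₀) := by
      have h3 := (hs.continuousOn.continuousAt (hO.mem_nhds hyO))
      rwa [ContinuousAt, hsu] at h3
    have hT₀ := (hT.self_of_nhds rfl).2.2.1
    filter_upwards [h2.eventually h1, h2.eventually hT, hO.mem_nhds hyO, h.isOpen.mem_nhds hy]
      with y' h3 h4 h5 h6 h7
    have hsU : C.π (s y') ∈ U := by rw [hπs y' h5]; exact h6
    have hsz : ψ (C.π (s y')) = z := by rw [hπs y' h5]; exact h7
    have h8 := hR (s y') hsU hsz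
    rw [hπs y' h5] at h8
    rw [h8, hR u₀ hy hyz]
    subst hyz
    refine (F.bijective_eval (hbij u₀ hy rfl)).1 ?_
    change (a (s y') hsU hsz).1 _ = (a u₀ hy rfl).1 _
    rw [← (h4 hsz).2.2.1, ← hT₀]
    refine Eq.trans ?_ ((h3 hsz).trans ?_)
    · exact congrArg (F.rep (T (s y'))) (ha' _ hsU hsz)
    · exact congrArg (F.rep (T u₀)) (ha' _ hy rfl).symm
  obtain ⟨y₀, hy₀, hyz₀⟩ : z ∈ ψ '' U := h.surjective ▸ Set.mem_univ z
  refine ⟨R y₀, fun u hu hz => ?_⟩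
  rw [eq_of_eventually_eq_of_isConnected (h.connected_fibers z) hloc hy₀ hyz₀ hu hz, hR u hu hz]
  exact ha' u hu hz

/-- Parallel sections of relative tractor bundles are the pullbacks of sections on the leaf space. -/
theorem IsLeafSpace.isParallel_iff (h : C.IsLeafSpace EY U ψ)
    (hτ : ∀ i : ℤ, i ≤ 0 → C.TorsionMapsTo i i)
    (hτ' : ∀ i : ℤ, i < 0 → C.TorsionMapsTo i (i + 1)) (hk : ∀ i, k i < 0)
    {f : B → W} (hf : ContMDiffOn 𝓘(ℝ, EB) 𝓘(ℝ, W) ∞ f (C.π ⁻¹' U))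
    (hsec : C.IsSection (tensorRep H F k b) U f) :
    C.IsParallel (tensorRep H F k b) U f ↔
      ∃ σ : ∀ z : Y, F.obj fun i => C.grTN EY U ψ (k i) z,
        IsSmoothTensorSection EY F (fun z : Y => z)
          (fun i => C.tanFilN EY U ψ (k i)) (fun i => C.tanFilN EY U ψ (k i + 1)) Set.univ σ ∧
        ∀ u, C.π u ∈ U →
          f u = (σ (ψ (C.π u))).1 (C.grFrame ψ (C.tanFilN EY U ψ) b u (ψ (C.π u))) := by
  have ha := h.isAdapted hτ
  have hker : ∀ u, C.π u ∈ U → ∀ X ∈ D.fil 0, C.frm (EY := EY) ψ u (ψ (C.π u)) X = 0 :=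
    fun u hu X hX => h.frm_eq_zero hu hX
  constructor
  · intro hpar
    choose σ hσ using h.exists_descent b F hτ hτ' hk hf hsec hpar
    refine ⟨σ, fun z _ => ?_, fun u hu => (hσ _ u hu rfl).symm⟩
    obtain ⟨y, hy, rfl⟩ : z ∈ ψ '' U := h.surjective ▸ Set.mem_univ z
    obtain ⟨u, rfl⟩ := C.π_surjective y
    obtain ⟨s, O, hO, hO₀, hs, -, hsU, hsg⟩ := ha.exists_local_section hy
    refine ⟨O, hO, hO₀, fun z => C.grFrame ψ (C.tanFilN EY U ψ) b (s z) z,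
      fun z hz => ha.bijective_grFrame b hk (hsU z hz) (hsg z hz),
      ha.isSmoothGrSection_grFrame b hk hO hs hsU hsg, ?_⟩
    rw [Set.univ_inter]
    -- On the smooth frame given by the local section `s`, the descended section has the value `f ∘
    -- s`.
    exact (hf.comp hs hsU).congr fun z hz => hσ z (s z) (hsU z hz) (hsg z hz)
  · rintro ⟨σ, -, hσ⟩ u₀ hu₀ Z
    obtain ⟨T, hT⟩ := ha.exists_transport b F hker hτ hτ' hk hu₀
    obtain ⟨h1, h2, -, h3⟩ := hT.self_of_nhds rfl
    have hr := h.isRelSubmersion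
    have hfd : MDifferentiableAt 𝓘(ℝ, EB) 𝓘(ℝ, W) f u₀ :=
      (hf.contMDiffAt (hr.isOpen_preimage.mem_nhds hu₀)).mdifferentiableAt (by norm_num)
    -- By invertibility of `F.rep (T u₀)` it suffices that the derivative of `F.rep (T u) (f u)`
    -- along the fibre vanishes. For a pullback this function is the fixed element `σ` evaluated on
    -- the fixed frame at `u₀`.
    refine (F.rep_bijective h1).1 ?_
    rw [← vd_rep_apply_eq b F hk h2 h1 hfd Z (h3 _ (dHom_jP_mem_fil_zero H Z)), map_zero]
    have hconst : ∀ᶠ u in 𝓝 u₀, ψ (C.π u) = ψ (C.π u₀) →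
        F.rep (T u) (f u) = (σ (ψ (C.π u₀))).1
          (C.grFrame ψ (C.tanFilN EY U ψ) b u₀ (ψ (C.π u₀))) := by
      filter_upwards [hT, hr.isOpen_preimage.mem_nhds hu₀] with u hu huU hgu
      rw [hσ u huU, ← (hu hgu).2.2.1]
      have h4 : ∀ z, z = ψ (C.π u₀) →
          (σ z).1 (C.grFrame ψ (C.tanFilN EY U ψ) b u z) =
            (σ (ψ (C.π u₀))).1 (C.grFrame ψ (C.tanFilN EY U ψ) b u (ψ (C.π u₀))) := by
        rintro _ rfl
        rfl
      rw [h4 _ hgu]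
    refine vd_eq_zero_of_eventually_eq hr.isOpen_preimage hu₀ hr.contMDiffOn_comp
      (hr.mfderiv_comp_surjective hu₀) (mdifferentiableAt_rep_apply F h2 h1 hfd) ?_ ?_
    · filter_upwards [hconst] with u hu hgu
      rw [hu hgu, hconst.self_of_nhds rfl]
    · exact h.frm_eq_zero hu₀ (dHom_jP_mem_fil_zero H Z)

end ParabolicGeometry

end RelativeBGG

/-! ### The main theorem -/

theorem corollary3p3
    {EG : Type*} [NormedAddCommGroup EG] [NormedSpace ℝ EG] [FiniteDimensional ℝ EG]
    {G : Type*} [TopologicalSpace G] [ChartedSpace EG G] [Group G] [LieGroup 𝓘(ℝ, EG) ∞ G]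
    {EP : Type*} [NormedAddCommGroup EP] [NormedSpace ℝ EP] [FiniteDimensional ℝ EP]
    {P : Type*} [TopologicalSpace P] [ChartedSpace EP P] [Group P] [LieGroup 𝓘(ℝ, EP) ∞ P]
    {EQ : Type*} [NormedAddCommGroup EQ] [NormedSpace ℝ EQ] [FiniteDimensional ℝ EQ]
    {Q : Type*} [TopologicalSpace Q] [ChartedSpace EQ Q] [Group Q] [LieGroup 𝓘(ℝ, EQ) ∞ Q]
    {EM : Type*} [NormedAddCommGroup EM] [NormedSpace ℝ EM] [FiniteDimensional ℝ EM]
    {M : Type*} [TopologicalSpace M] [ChartedSpace EM M] [IsManifold 𝓘(ℝ, EM) ∞ M]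
    [T2Space M] [SecondCountableTopology M]
    {EB : Type*} [NormedAddCommGroup EB] [NormedSpace ℝ EB] [FiniteDimensional ℝ EB]
    {B : Type*} [TopologicalSpace B] [ChartedSpace EB B] [IsManifold 𝓘(ℝ, EB) ∞ B]
    [T2Space B] [SecondCountableTopology B]
    {EN : Type*} [NormedAddCommGroup EN] [NormedSpace ℝ EN] [FiniteDimensional ℝ EN]
    {N : Type*} [TopologicalSpace N] [ChartedSpace EN N] [IsManifold 𝓘(ℝ, EN) ∞ N]
    [T2Space N] [SecondCountableTopology N]
    -- a semisimple Lie algebra `𝔤 = Lie(G)` with nested parabolics and groups `Q ⊆ P ⊆ G`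
    [LieAlgebra.IsSemisimple ℝ (Lie EG G)]
    (D : NestedParabolics (Lie EG G)) (H : NestedGroups D EP P EQ Q)
    -- a parabolic geometry of type `(G, Q)` with `τ(T_ρ M, T^i_P M) ⊆ T^i_P M` for all `i ≤ 0`
    (C : ParabolicGeometry H EM M EB B)
    (hτ : ∀ i : ℤ, i ≤ 0 → C.TorsionMapsTo i i)
    -- a local leaf space with connected fibers
    (U : Set M) (ψ : M → N) (hψ : C.IsLeafSpace EN U ψ)
    -- a tensorial construction with finitely many of the bundles `𝒱_i M`, `i < 0`
    {ι : Type*} [Fintype ι] (k : ι → ℤ) (hk : ∀ i, k i < 0)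
    (n : ι → ℕ) (b : ∀ i, (Fin (n i) → ℝ) ≃ₗ[ℝ] D.VV (k i))
    {W : Type*} [NormedAddCommGroup W] [NormedSpace ℝ W] [FiniteDimensional ℝ W]
    (F : TensorialConstruction n W) :
    -- the subspaces `T^i N` form smooth subbundles of `TN` that correspond to `T^i_P M / T_ρ M`
    (∀ i : ℤ, i ≤ 0 → IsSmoothSubbundle (C.tanFilN EN U ψ i) ∧
      ∀ y ∈ U, (C.tanFilN EN U ψ i (ψ y)).comap
        (mfderiv 𝓘(ℝ, EM) 𝓘(ℝ, EN) ψ y).toLinearMap = C.tanFil i y) ∧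
    (∀ z : N, C.tanFilN EN U ψ 0 z = ⊥) ∧
    -- (1) `Tψ` induces an isomorphism `𝒱_i M|_U ≅ ψ^* gr_i(TN)` of smooth vector bundles
    (∀ i : ℤ, i < 0 →
      (∀ y ∈ U, Function.Bijective (C.grψ EN U ψ y i)) ∧
      ∀ V ⊆ U, IsOpen V → ∀ t : ∀ y, C.VBundle i y,
        IsSmoothGrSection EM (fun y : M => y) (C.tanFil i) (C.tanFil (i + 1)) V t ↔
        IsSmoothGrSection EM ψ (C.tanFilN EN U ψ i) (C.tanFilN EN U ψ (i + 1)) V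
          (fun y => C.grψ EN U ψ y i (t y))) ∧
    -- the construction `F` applied to the `P`-representations `𝕍_i` induces a relative tractor bundle
    (∀ (p : P) (i : ℤ), (D.fil i).map (Ad (H.jP p)) = D.fil i) ∧
    ParabolicGeometry.IsRelTractorRep H (ParabolicGeometry.tensorRep H F k b) ∧
    -- this relative tractor bundle is the construction `F` applied to the bundles `𝒱_i M`
    C.IdentifiesBundles (ParabolicGeometry.tensorRep H F k b) F Set.univ (fun y : M => y)
      (fun i => C.tanFil (k i)) (fun i => C.tanFil (k i + 1))
      (fun u i => C.toVBundle u (k i) ∘ₗ (b i).toLinearMap) ∧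
    -- and its restriction to `U` is the pullback of `F` applied to the bundles `gr_i(TN)`
    C.IdentifiesBundles (ParabolicGeometry.tensorRep H F k b) F U ψ
      (fun i => C.tanFilN EN U ψ (k i)) (fun i => C.tanFilN EN U ψ (k i + 1))
      (fun u i => C.grψ EN U ψ (C.π u) (k i) ∘ₗ C.toVBundle u (k i) ∘ₗ (b i).toLinearMap) ∧
    -- (2) if `τ(T_ρ M, T^i_P M) ⊆ T^(i+1)_P M` for all `i < 0`, then the parallel sections over `U`
    -- are exactly the pullbacks of smooth sections over `N`
    ((∀ i : ℤ, i < 0 → C.TorsionMapsTo i (i + 1)) →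
      ∀ f : B → W, ContMDiffOn 𝓘(ℝ, EB) 𝓘(ℝ, W) ∞ f (C.π ⁻¹' U) →
        C.IsSection (ParabolicGeometry.tensorRep H F k b) U f →
        (C.IsParallel (ParabolicGeometry.tensorRep H F k b) U f ↔
          ∃ σ : ∀ z : N, F.obj fun i => C.grTN EN U ψ (k i) z,
            IsSmoothTensorSection EN F (fun z : N => z)
              (fun i => C.tanFilN EN U ψ (k i)) (fun i => C.tanFilN EN U ψ (k i + 1))
              Set.univ σ ∧
            ∀ u, C.π u ∈ U → f u = (σ (ψ (C.π u))).1
              (fun i => C.grψ EN U ψ (C.π u) (k i) ∘ₗ C.toVBundle u (k i) ∘ₗ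
                (b i).toLinearMap))) := by
  have h1 := hψ.isAdapted hτ
  refine ⟨fun i hi => ⟨hψ.isSmoothSubbundle hτ hi, fun y hy => hψ.comap_tanFilN hτ hi hy⟩,
    hψ.tanFilN_zero hτ, fun i hi => ⟨fun y hy => hψ.grψ_bijective hτ hi hy,
      fun V hVU hV t => hψ.isSmoothGrSection_iff hτ hi hVU hV t⟩,
    map_Ad_fil H, isRelTractorRep_tensorRep b H F hk,
    (ParabolicGeometry.isAdapted_id C).identifiesBundles b F hk fun _ _ => rfl,
    h1.identifiesBundles b F hk fun u hu => hψ.grFrame_eq b hτ hk hu, fun hτ' f hf hsec => ?_⟩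
  rw [hψ.isParallel_iff b F hτ hτ' hk hf hsec]
  refine exists_congr fun σ => and_congr_right fun _ => forall₂_congr fun u hu => ?_
  rw [hψ.grFrame_eq b hτ hk hu]
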